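/- Let $r>0$, $\mu>0$, put $\zeta=\mu r$, and let $\nu=i\sqrt{\tfrac14-\zeta^2}$ if $0<\zeta<\tfrac12$ (complementary series), $\nu=\sqrt{\zeta^2-\tfrac14}$ if $\zeta\ge\tfrac12$ (principal series), $s^+=-\tfrac12-i\nu$ and $c_\nu=-\frac{1}{2\sin(\pi s^+)}$. Let $P_s(z)={}_2F_1(-s,s+1;1;\tfrac{1-z}{2})$ be the Legendre function and let $\widehat{\mathfrak h}(S^1)$ be the Hilbert space completion of $C^\infty(S^1)$ for the scalar product $$\langle h,h'\rangle=c_\nu\int_{S^1}r\,d\psi\int_{S^1}r\,d\psi'\;\overline{h(\psi)}\,P_{s^+}\bigl(-\cos(\psi'-\psi)\bigr)\,h'(\psi').$$ Let $\omega$ be the operator that multiplies the $k$-th Fourier coefficient, $k\in\mathbb Z$, by $$\widetilde\omega(k)=\frac{k+s^+}{r}\,\frac{\Gamma\bigl(\frac{k+s^+}{2}\bigr)}{\Gamma\bigl(\frac{k-s^+}{2}\bigr)}\,\frac{\Gamma\bigl(\frac{k+1-s^+}{2}\bigr)}{\Gamma\bigl(\frac{k+1+s^+}{2}\bigr)} .$$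 Let $SO_0(1,2)$ be the group of real $3\times3$ matrices $\Lambda$ that preserve the form $x_0^2-x_1^2-x_2^2$ and satisfy $\det\Lambda=1$, $\Lambda_{00}>0$. Let $R_0(\alpha)$ be the rotation by $\alpha$ in the $(x_1,x_2)$-plane, and $\Lambda_1(t)$, $\Lambda_2(s)$ the boosts in the $(x_0,x_2)$- and $(x_0,x_1)$-plane. Then, for all $r,\mu>0$ (so both for the principal and for the complementary series): 1. For all $k\in\mathbb Z$, $\widetilde\omega(k)\,\widetilde\omega(k\pm1)=r^{-2}k(k\pm1)+\mu^2$. 2. The operator $\omega r\cos_\psi\colon h\mapsto\omega(r\cos\psi\,h)$ is defined on $C^\infty(S^1)$, with values in $C^\infty(S^1)$, and is essentially self-adjoint there as an operator in $\widehat{\mathfrak h}(S^1)$. There is exactly one representation $\widehat u$ of $SO_0(1,2)$ by unitary operators on $\widehat{\mathfrak h}(S^1)$ with $$(\widehat u(R_0(\alpha))h)(\psi)=h(\psi-\alpha)\quad(h\in C^\infty(S^1),\ \alpha\in\mathbb R),\qquad \widehat u(\Lambda_1(t))=e^{it\,\omega r\cos_\psi}\quad(t\in\mathbb R),$$ where the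 exponential is that of the self-adjoint closure. It is strongly continuous. Moreover $\omega r\sin_\psi$ is essentially self-adjoint on $C^\infty(S^1)$ and $\widehat u(\Lambda_2(-s))=e^{is\,\omega r\sin_\psi}$ for $s\in\mathbb R$. 3. $\widehat u$ is irreducible: $\widehat{\mathfrak h}(S^1)\ne0$, and its only closed invariant subspaces are $0$ and $\widehat{\mathfrak h}(S^1)$. 4. Let $K_0,L_1,L_2$ be the self-adjoint generators of $\alpha\mapsto\widehat u(R_0(\alpha))$, $t\mapsto\widehat u(\Lambda_1(t))$, $s\mapsto\widehat u(\Lambda_2(s))$. The Casimir operator $C^2=-K_0^2+L_1^2+L_2^2$ is defined on $C^\infty(S^1)$ and equals $\zeta^2$ there; indeed $C^2x=\zeta^2x$ for every $x$ in the common domain of $K_0^2$, $L_1^2$, $L_2^2$. -/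

import Mathlib

open MeasureTheory Complex
open scoped ContDiff ComplexConjugate

noncomputable section

namespace DeSitter

/-- The radius `r` of de Sitter space and the mass `μ`. -/
structure Params where
  r : ℝ
  μ : ℝ
  r_pos : 0 < r
  μ_pos : 0 < μ

variable (P : Params)

/-- `ζ = μ r`. -/
def Params.zeta : ℝ := P.μ * P.r

theorem Params.zeta_pos : 0 < P.zeta := mul_pos P.μ_pos P.r_pos

/-- `ν = i √(1/4 - ζ²)` if `0 < ζ < 1/2` (complementary series) and `ν = √(ζ² - 1/4)` if `ζ ≥ 1/2`
(principal series). -/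
def Params.nu : ℂ :=
  if P.zeta < 1 / 2 then I * (√(1 / 4 - P.zeta ^ 2) : ℝ) else (√(P.zeta ^ 2 - 1 / 4) : ℝ)

/-- `s⁺ = -1/2 - i ν`. -/
def Params.sPlus : ℂ := -1 / 2 - I * P.nu

/-- `c_ν = -1 / (2 sin (π s⁺))`. -/
def Params.cNu : ℂ := -1 / (2 * Complex.sin (Real.pi * P.sPlus))

/-- The Legendre function `P_s(z) = ₂F₁(-s, s + 1; 1; (1 - z)/2)`, for `|1 - z| < 2`. -/
def legendreP (s z : ℂ) : ℂ := ordinaryHypergeometric (-s) (s + 1) (1 : ℂ) ((1 - z) / 2)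

/-- `C^∞(S¹)`: smooth complex functions on the line with period `2π`. -/
def smoothCircle : Submodule ℂ (ℝ → ℂ) where
  carrier := {h | ContDiff ℝ ∞ h ∧ Function.Periodic h (2 * Real.pi)}
  zero_mem' := ⟨contDiff_const, fun _ => rfl⟩
  add_mem' := fun ha hb => ⟨ha.1.add hb.1, ha.2.add hb.2⟩
  smul_mem' := fun c _ ha => ⟨contDiff_const.smul ha.1, fun x => by simp [ha.2 x]⟩

/-- The sesquilinear form
`c_ν ∫ r dψ ∫ r dψ' conj(h ψ) P_{s⁺}(-cos (ψ' - ψ)) h'(ψ')` on functions on the circle. -/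
def form (h h' : ℝ → ℂ) : ℂ :=
  P.cNu * ∫ ψ in (0 : ℝ)..2 * Real.pi, ∫ ψ' in (0 : ℝ)..2 * Real.pi,
    conj (h ψ) * legendreP P.sPlus (-Real.cos (ψ' - ψ) : ℝ) * h' ψ' * P.r * P.r

theorem Params.nu_sq : P.nu ^ 2 = (P.zeta : ℂ) ^ 2 - 1 / 4 := by
  have hz := P.zeta_pos
  unfold Params.nu
  split_ifs with h
  · rw [mul_pow, I_sq, ← ofReal_pow, Real.sq_sqrt (by nlinarith)]
    push_cast; ring
  · rw [← ofReal_pow, Real.sq_sqrt (by nlinarith)]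
    push_cast; ring

/-- The Casimir eigenvalue: `-s(s+1) = ζ²`. -/
theorem Params.sPlus_eq : -P.sPlus * (P.sPlus + 1) = (P.zeta : ℂ) ^ 2 := by
  have := P.nu_sq
  unfold Params.sPlus
  have hI := I_sq
  linear_combination (1 : ℂ) * this - P.nu ^ 2 * hI

theorem Params.cNu_pos : ∃ c : ℝ, 0 < c ∧ P.cNu = c := by
  have hz := P.zeta_pos
  have h1 : P.cNu = 1 / (2 * Complex.cos (Real.pi * (I * P.nu))) := by
    unfold Params.cNu Params.sPlus
    have : (Real.pi : ℂ) * (-1 / 2 - I * P.nu) = -(Real.pi * (I * P.nu) + Real.pi / 2) := by ring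
    rw [this, Complex.sin_neg, Complex.sin_add_pi_div_two]
    rw [mul_neg, neg_div_neg_eq]
  rw [h1]
  unfold Params.nu
  split_ifs with h
  · set q := √(1 / 4 - P.zeta ^ 2) with hq
    have hq0 : 0 ≤ q := Real.sqrt_nonneg _
    have hq1 : q < 1 / 2 := by
      rw [hq, Real.sqrt_lt' (by norm_num)]; nlinarith
    refine ⟨1 / (2 * Real.cos (Real.pi * q)), ?_, ?_⟩
    · have : 0 < Real.cos (Real.pi * q) := by
        apply Real.cos_pos_of_mem_Ioo
        constructor <;> nlinarith [Real.pi_pos]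
      positivity
    · have : (Real.pi : ℂ) * (I * (I * (q : ℂ))) = -((Real.pi * q : ℝ) : ℂ) := by
        push_cast; linear_combination (Real.pi : ℂ) * q * I_sq
      rw [this, Complex.cos_neg]; push_cast; rfl
  · set q := √(P.zeta ^ 2 - 1 / 4)
    refine ⟨1 / (2 * Real.cosh (Real.pi * q)), ?_, ?_⟩
    · have := Real.cosh_pos (Real.pi * q)
      positivity
    · have : (Real.pi : ℂ) * (I * (q : ℂ)) = ((Real.pi * q : ℝ) : ℂ) * I := by
        push_cast; ring
      rw [this, Complex.cos_mul_I]; push_cast; rfl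

/-- Taylor coefficients of the kernel at `u = cos² (θ/2)`. -/
def kerCoeff (n : ℕ) : ℝ := ∏ j ∈ Finset.range n, ((j : ℝ) * (j + 1) + P.zeta ^ 2) / (j + 1) ^ 2

theorem kerCoeff_pos (n : ℕ) : 0 < kerCoeff P n := by
  have hz := P.zeta_pos
  unfold kerCoeff
  exact Finset.prod_pos fun j _ => by positivity

theorem kerCoeff_eq (n : ℕ) : ((n.factorial : ℂ)⁻¹) * (ascPochhammer ℂ n).eval (-P.sPlus) *
    (ascPochhammer ℂ n).eval (P.sPlus + 1) * ((ascPochhammer ℂ n).eval 1)⁻¹ = kerCoeff P n := by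
  induction n with
  | zero => simp [kerCoeff]
  | succ n ih =>
    have hs := P.sPlus_eq
    have h1 : ((n : ℂ) + 1) ≠ 0 := by exact_mod_cast Nat.succ_ne_zero n
    rw [kerCoeff, Finset.prod_range_succ, ← kerCoeff]
    push_cast
    rw [← ih]
    simp only [ascPochhammer_succ_eval, Nat.factorial_succ]
    push_cast
    rw [mul_inv, mul_inv]
    have h2 : (1 + (n : ℂ)) ≠ 0 := by rwa [add_comm]
    have key : (-P.sPlus + n) * (P.sPlus + 1 + n) = (n : ℂ) * (n + 1) + (P.zeta : ℂ) ^ 2 := by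
      rw [← hs]; ring
    rw [← key]
    rw [add_comm (1 : ℂ) n]
    field_simp

theorem legendreP_eq (θ : ℝ) : legendreP P.sPlus (-Real.cos θ : ℝ) =
    ∑' n, (kerCoeff P n : ℂ) * (((1 + Real.cos θ) / 2 : ℝ) : ℂ) ^ n := by
  unfold legendreP
  rw [ordinaryHypergeometric_eq_tsum]
  simp only [kerCoeff_eq, smul_eq_mul]
  congr! 4
  push_cast; ring

/-- `∫ cos²ⁿ(θ/2) dθ` over a period. -/
def wallis (n : ℕ) : ℝ := ∫ θ in (0 : ℝ)..2 * Real.pi, ((1 + Real.cos θ) / 2) ^ n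

theorem wallis_nonneg (n : ℕ) : 0 ≤ wallis n := by
  apply intervalIntegral.integral_nonneg (by positivity)
  intro θ _
  have := Real.neg_one_le_cos θ
  apply pow_nonneg; linarith

theorem wallis_succ (n : ℕ) : wallis (n + 1) = (2 * n + 1) / (2 * n + 2) * wallis n := by
  have h : ∀ n, wallis n = 2 * ∫ x in (0 : ℝ)..Real.pi, Real.cos x ^ (2 * n) := by
    intro n
    have := intervalIntegral.integral_comp_mul_left (a := 0) (b := Real.pi)
      (fun θ => ((1 + Real.cos θ) / 2) ^ n) (c := 2) (by norm_num)
    simp only [smul_eq_mul, mul_zero] at this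
    rw [wallis]
    have h2 : ∀ x : ℝ, ((1 + Real.cos (2 * x)) / 2) ^ n = Real.cos x ^ (2 * n) := by
      intro x
      rw [pow_mul, Real.cos_sq]; ring_nf
    simp only [h2] at this
    rw [this]; ring
  rw [h, h, show 2 * (n + 1) = 2 * n + 2 by ring, integral_cos_pow]
  simp
  ring

theorem summable_kerCoeff_wallis : Summable fun n => kerCoeff P n * wallis n := by
  set b : ℕ → ℝ := fun n => kerCoeff P n * wallis n with hb
  have hb0 : ∀ n, 0 ≤ b n := fun n => mul_nonneg (kerCoeff_pos P n).le (wallis_nonneg n)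
  have hrec : ∀ n, b (n + 1) * (n + 1) = b n *
      (((n : ℝ) * (n + 1) + P.zeta ^ 2) / (n + 1) * ((2 * n + 1) / (2 * n + 2))) := by
    intro n
    have h1 : ((n : ℝ) + 1) ≠ 0 := by positivity
    simp only [hb]
    rw [wallis_succ, kerCoeff, Finset.prod_range_succ, ← kerCoeff]
    field_simp
  obtain ⟨N, hN⟩ := exists_nat_ge (4 * P.zeta ^ 2)
  have hstep : ∀ n, N ≤ n → b n ≤ 8 * (n * b n - (n + 1) * b (n + 1)) := by
    intro n hn
    have hnN : 4 * P.zeta ^ 2 ≤ n := hN.trans (by exact_mod_cast hn)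
    have h0 : (0 : ℝ) ≤ n := by positivity
    have : (((n : ℝ) * (n + 1) + P.zeta ^ 2) / (n + 1) * ((2 * n + 1) / (2 * n + 2)))
        ≤ n - 1 / 8 := by
      have hn1 : (1 : ℝ) ≤ n := by
        have : 0 < (n : ℝ) := by have := P.zeta_pos; nlinarith [sq_nonneg P.zeta, mul_pos this this]
        exact_mod_cast (by exact_mod_cast this : 0 < n)
      rw [div_mul_div_comm, div_le_iff₀ (by positivity)]
      have h5 : P.zeta ^ 2 * (2 * n + 1) ≤ n / 4 * (2 * n + 1) :=
        mul_le_mul_of_nonneg_right (by linarith) (by linarith)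
      nlinarith [mul_nonneg h0 h0, mul_nonneg h0 (sub_nonneg.2 hn1)]
    have h2 := mul_le_mul_of_nonneg_left this (hb0 n)
    rw [← hrec] at h2
    linarith
  rw [← summable_nat_add_iff N]
  refine summable_of_sum_range_le (c := 8 * (N * b N)) (fun n => hb0 _) fun n => ?_
  have : ∀ n, ∑ i ∈ Finset.range n, b (i + N) ≤ 8 * (N * b N) - 8 * ((n + N : ℕ) * b (n + N)) := by
    intro n
    induction n with
    | zero => simp
    | succ n ih =>
      rw [Finset.sum_range_succ]
      have := hstep (n + N) (by omega)
      rw [show n + 1 + N = n + N + 1 by ring]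
      push_cast at *
      linarith
  have h3 := this n
  have h4 : 0 ≤ ((n + N : ℕ) : ℝ) * b (n + N) := mul_nonneg (by positivity) (hb0 _)
  linarith

/-- Unnormalised Fourier coefficients. -/
def fint (h : ℝ → ℂ) (m : ℤ) : ℂ := ∫ ψ in (0 : ℝ)..2 * Real.pi, cexp (I * (m * ψ : ℝ)) * h ψ

/-- The form with kernel `cos²ⁿ((ψ' - ψ)/2)`, in Fourier space. -/
def sform (n : ℕ) (h h' : ℝ → ℂ) : ℂ :=
  ∑ j ∈ Finset.range (n + 1), ∑ l ∈ Finset.range (n + 1),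
    (((n.choose j * n.choose l : ℕ) : ℝ) * ((4 : ℝ) ^ n)⁻¹ : ℝ) *
      (conj (fint h ((j : ℤ) - l)) * fint h' ((j : ℤ) - l))

theorem cos_pow_expand (n : ℕ) (θ : ℝ) : (((1 + Real.cos θ) / 2 : ℝ) : ℂ) ^ n =
    ∑ j ∈ Finset.range (n + 1), ∑ l ∈ Finset.range (n + 1),
      (((n.choose j * n.choose l : ℕ) : ℝ) * ((4 : ℝ) ^ n)⁻¹ : ℝ) *
        cexp (I * ((((j : ℤ) - l : ℤ) : ℝ) * θ : ℝ)) := by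
  have h1 : (((1 + Real.cos θ) / 2 : ℝ) : ℂ) =
      (4 : ℂ)⁻¹ * ((cexp (I * θ) + 1) * (cexp (-(I * θ)) + 1)) := by
    push_cast
    rw [Complex.cos]
    have : cexp (I * θ) * cexp (-(I * θ)) = 1 := by rw [← Complex.exp_add]; simp
    rw [mul_comm (θ : ℂ) I, neg_mul, mul_comm (θ : ℂ) I]
    linear_combination (-1 / 4 : ℂ) * this
  rw [h1, mul_pow, mul_pow, add_pow, add_pow, Finset.sum_mul_sum, Finset.mul_sum]
  refine Finset.sum_congr rfl fun j _ => ?_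
  rw [Finset.mul_sum]
  refine Finset.sum_congr rfl fun l _ => ?_
  have : cexp (I * ((((j : ℤ) - l : ℤ) : ℝ) * θ : ℝ)) =
      cexp (I * θ) ^ j * cexp (-(I * θ)) ^ l := by
    rw [← Complex.exp_nat_mul, ← Complex.exp_nat_mul, ← Complex.exp_add]
    congr 1; push_cast; ring
  rw [this]
  push_cast
  simp only [one_pow, inv_pow]
  ring

theorem hasSum_form {h h' : ℝ → ℂ} (hh : Continuous h) (hh' : Continuous h') :
    HasSum (fun n => P.cNu * (P.r * P.r) * (kerCoeff P n * sform n h h')) (form P h h') := by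
  have hpi : (0 : ℝ) ≤ 2 * Real.pi := by positivity
  obtain ⟨M, hM⟩ := (isCompact_Icc (a := (0 : ℝ)) (b := 2 * Real.pi)).exists_bound_of_continuousOn
    hh.continuousOn
  obtain ⟨M', hM'⟩ := (isCompact_Icc (a := (0 : ℝ)) (b := 2 * Real.pi)).exists_bound_of_continuousOn
    hh'.continuousOn
  have hM0 : 0 ≤ M := (norm_nonneg _).trans (hM 0 ⟨le_rfl, hpi⟩)
  have hM'0 : 0 ≤ M' := (norm_nonneg _).trans (hM' 0 ⟨le_rfl, hpi⟩)
  set ν : Measure ℝ := volume.restrict (Set.Ioc 0 (2 * Real.pi)) with hν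
  -- the integrand
  set u : ℝ → ℝ := fun θ => (1 + Real.cos θ) / 2 with hu
  have hucont : Continuous u := by fun_prop
  have hu0 : ∀ θ, 0 ≤ u θ := fun θ => by
    have := Real.neg_one_le_cos θ
    simp only [hu]; linarith
  have hwal : ∀ n ψ, ∫ ψ' in (0 : ℝ)..2 * Real.pi, u (ψ' - ψ) ^ n = wallis n := by
    intro n ψ
    rw [intervalIntegral.integral_comp_sub_right (fun θ => u θ ^ n)]
    have hper : Function.Periodic (fun θ => u θ ^ n) (2 * Real.pi) := fun θ => by simp [hu]
    have := hper.intervalIntegral_add_eq (-ψ) 0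
    rw [show (0 : ℝ) - ψ = -ψ by ring, show 2 * Real.pi - ψ = -ψ + 2 * Real.pi by ring, this,
      zero_add]
    rfl
  set F : ℕ → ℝ → ℝ → ℂ := fun n ψ ψ' =>
    conj (h ψ) * ((kerCoeff P n : ℂ) * ((u (ψ' - ψ) : ℝ) : ℂ) ^ n) * h' ψ' * P.r * P.r with hF
  have hFcont : ∀ n ψ, Continuous (F n ψ) := fun n ψ => by
    simp only [hF]; fun_prop
  have hint : ∀ {f : ℝ → ℂ}, Continuous f → Integrable f ν := fun hf =>
    (hf.integrableOn_Icc).mono_set Set.Ioc_subset_Icc_self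
  have hintR : ∀ {f : ℝ → ℝ}, Continuous f → Integrable f ν := fun hf =>
    (hf.integrableOn_Icc).mono_set Set.Ioc_subset_Icc_self
  have hnorm : ∀ n ψ, ψ ∈ Set.Ioc 0 (2 * Real.pi) →
      ∫ ψ', ‖F n ψ ψ'‖ ∂ν ≤ M * M' * P.r * P.r * (kerCoeff P n * wallis n) := by
    intro n ψ hψ
    have : ∀ ψ' ∈ Set.Ioc 0 (2 * Real.pi),
        ‖F n ψ ψ'‖ ≤ M * M' * P.r * P.r * kerCoeff P n * u (ψ' - ψ) ^ n := by
      intro ψ' hψ'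
      have e1 := hM ψ ⟨hψ.1.le, hψ.2⟩
      have e2 := hM' ψ' ⟨hψ'.1.le, hψ'.2⟩
      have e3 := kerCoeff_pos P n
      have e4 : 0 ≤ u (ψ' - ψ) ^ n := pow_nonneg (hu0 _) n
      have e5 := P.r_pos
      simp only [hF, norm_mul, norm_pow, RCLike.norm_conj, Complex.norm_real, Real.norm_eq_abs,
        abs_of_pos e3, abs_of_nonneg (hu0 _), abs_of_pos e5]
      calc ‖h ψ‖ * (kerCoeff P n * u (ψ' - ψ) ^ n) * ‖h' ψ'‖ * P.r * P.r
          ≤ M * (kerCoeff P n * u (ψ' - ψ) ^ n) * M' * P.r * P.r := by gcongr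
        _ = _ := by ring
    calc ∫ ψ', ‖F n ψ ψ'‖ ∂ν
        ≤ ∫ ψ', M * M' * P.r * P.r * kerCoeff P n * u (ψ' - ψ) ^ n ∂ν := by
          refine setIntegral_mono_on (hint (hFcont n ψ)).norm (hintR (by fun_prop))
            measurableSet_Ioc this
      _ = _ := by
          rw [integral_const_mul, hν, ← intervalIntegral.integral_of_le hpi, hwal]; ring
  have hsumb : Summable fun n => M * M' * P.r * P.r * (kerCoeff P n * wallis n) :=
    (summable_kerCoeff_wallis P).mul_left _
  -- inner integral
  set G : ℕ → ℝ → ℂ := fun n ψ => ∫ ψ', F n ψ ψ' ∂ν with hG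
  have hinner : ∀ ψ ∈ Set.Ioc 0 (2 * Real.pi),
      ∫ ψ' in (0 : ℝ)..2 * Real.pi,
        conj (h ψ) * legendreP P.sPlus (-Real.cos (ψ' - ψ) : ℝ) * h' ψ' * P.r * P.r =
      ∑' n, G n ψ := by
    intro ψ hψ
    have := hasSum_integral_of_summable_integral_norm (F := fun n => F n ψ) (μ := ν)
      (fun n => hint (hFcont n ψ))
      (Summable.of_nonneg_of_le (fun n => integral_nonneg fun _ => norm_nonneg _)
        (fun n => hnorm n ψ hψ) hsumb)
    rw [this.tsum_eq, intervalIntegral.integral_of_le hpi]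
    congr 1
    funext ψ'
    rw [legendreP_eq, ← tsum_mul_left, ← tsum_mul_right, ← tsum_mul_right, ← tsum_mul_right]
  have hGeq : ∀ n ψ, G n ψ = ∑ j ∈ Finset.range (n + 1), ∑ l ∈ Finset.range (n + 1),
      (P.r * P.r * kerCoeff P n * (((n.choose j * n.choose l : ℕ) : ℝ) * ((4 : ℝ) ^ n)⁻¹ : ℝ) *
        fint h' ((j : ℤ) - l)) * conj (cexp (I * ((((j : ℤ) - l : ℤ) : ℝ) * ψ : ℝ)) * h ψ) := by
    intro n ψ
    have e : ∀ ψ', F n ψ ψ' = ∑ j ∈ Finset.range (n + 1), ∑ l ∈ Finset.range (n + 1),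
      (P.r * P.r * kerCoeff P n * (((n.choose j * n.choose l : ℕ) : ℝ) * ((4 : ℝ) ^ n)⁻¹ : ℝ) *
        conj (cexp (I * ((((j : ℤ) - l : ℤ) : ℝ) * ψ : ℝ)) * h ψ)) *
        (cexp (I * ((((j : ℤ) - l : ℤ) : ℝ) * ψ' : ℝ)) * h' ψ') := by
      intro ψ'
      simp only [hF, hu]
      rw [cos_pow_expand]
      simp only [Finset.mul_sum, Finset.sum_mul]
      refine Finset.sum_congr rfl fun j _ => Finset.sum_congr rfl fun l _ => ?_
      have : cexp (I * ((((j : ℤ) - l : ℤ) : ℝ) * (ψ' - ψ) : ℝ)) =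
          cexp (I * ((((j : ℤ) - l : ℤ) : ℝ) * ψ' : ℝ)) *
            conj (cexp (I * ((((j : ℤ) - l : ℤ) : ℝ) * ψ : ℝ))) := by
        rw [← Complex.exp_conj, ← Complex.exp_add, map_mul, conj_I, conj_ofReal]
        congr 1; push_cast; ring
      rw [this, map_mul]
      ring
    simp only [hG, e]
    rw [integral_finsetSum _ fun j _ => integrable_finsetSum _ fun l _ => hint (by fun_prop)]
    refine Finset.sum_congr rfl fun j _ => ?_
    rw [integral_finsetSum _ fun l _ => hint (by fun_prop)]
    refine Finset.sum_congr rfl fun l _ => ?_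
    rw [integral_const_mul, hν, ← intervalIntegral.integral_of_le hpi]
    rw [← fint]; ring
  have hGcont : ∀ n, Continuous (G n) := fun n => by
    rw [show G n = _ from funext (hGeq n)]
    have := Complex.continuous_conj
    fun_prop
  have hGint : ∀ n, ∫ ψ, G n ψ ∂ν = P.r * P.r * (kerCoeff P n * sform n h h') := by
    intro n
    simp only [hGeq]
    have := Complex.continuous_conj
    rw [integral_finsetSum _ fun j _ => integrable_finsetSum _ fun l _ => hint (by fun_prop)]
    simp only [sform, Finset.mul_sum]
    refine Finset.sum_congr rfl fun j _ => ?_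
    rw [integral_finsetSum _ fun l _ => hint (by fun_prop)]
    refine Finset.sum_congr rfl fun l _ => ?_
    rw [integral_const_mul, integral_conj, hν, ← intervalIntegral.integral_of_le hpi]
    rw [← fint]; ring
  have hGn : ∀ n, ∫ ψ, ‖G n ψ‖ ∂ν ≤
      2 * Real.pi * (M * M' * P.r * P.r * (kerCoeff P n * wallis n)) := by
    intro n
    calc ∫ ψ, ‖G n ψ‖ ∂ν ≤ ∫ _, M * M' * P.r * P.r * (kerCoeff P n * wallis n) ∂ν := by
          refine setIntegral_mono_on (hint (hGcont n)).norm (hintR (by fun_prop))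
            measurableSet_Ioc fun ψ hψ => (norm_integral_le_integral_norm _).trans (hnorm n ψ hψ)
      _ = _ := by
          rw [hν, ← intervalIntegral.integral_of_le hpi, intervalIntegral.integral_const]
          simp
  have houter := hasSum_integral_of_summable_integral_norm (F := G) (μ := ν)
    (fun n => hint (hGcont n))
    (Summable.of_nonneg_of_le (fun n => integral_nonneg fun _ => norm_nonneg _) hGn
      (hsumb.mul_left _))
  have hfin : ∫ ψ, (∑' n, G n ψ) ∂ν = ∫ ψ in (0 : ℝ)..2 * Real.pi,
      ∫ ψ' in (0 : ℝ)..2 * Real.pi,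
        conj (h ψ) * legendreP P.sPlus (-Real.cos (ψ' - ψ) : ℝ) * h' ψ' * P.r * P.r := by
    rw [intervalIntegral.integral_of_le hpi]
    exact setIntegral_congr_fun measurableSet_Ioc fun ψ hψ => (hinner ψ hψ).symm
  rw [hfin] at houter
  have := houter.mul_left P.cNu
  simp only [hGint] at this
  simpa only [form, mul_assoc] using this


theorem fint_add {f g : ℝ → ℂ} (hf : Continuous f) (hg : Continuous g) (m : ℤ) :
    fint (f + g) m = fint f m + fint g m := by
  unfold fint
  rw [← intervalIntegral.integral_add
    ((by fun_prop : Continuous _).intervalIntegrable _ _)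
    ((by fun_prop : Continuous _).intervalIntegrable _ _)]
  simp only [Pi.add_apply, mul_add]

theorem fint_smul (c : ℂ) (f : ℝ → ℂ) (m : ℤ) : fint (c • f) m = c * fint f m := by
  unfold fint
  rw [← intervalIntegral.integral_const_mul]
  simp only [Pi.smul_apply, smul_eq_mul, mul_left_comm]

theorem sform_conj (n : ℕ) (h h' : ℝ → ℂ) : conj (sform n h' h) = sform n h h' := by
  simp only [sform, map_sum, map_mul, conj_conj, conj_ofReal]
  simp only [mul_comm (fint h' _)]

theorem sform_self (n : ℕ) (h : ℝ → ℂ) : sform n h h =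
    ((∑ j ∈ Finset.range (n + 1), ∑ l ∈ Finset.range (n + 1),
      ((n.choose j * n.choose l : ℕ) : ℝ) * ((4 : ℝ) ^ n)⁻¹ * ‖fint h ((j : ℤ) - l)‖ ^ 2 : ℝ) : ℂ) := by
  simp only [sform, Complex.conj_mul']
  push_cast
  rfl

theorem form_conj {h h' : ℝ → ℂ} (hh : Continuous h) (hh' : Continuous h') :
    conj (form P h' h) = form P h h' := by
  obtain ⟨c, -, hc⟩ := P.cNu_pos
  have h1 := (hasSum_form P hh' hh)
  have h2 := h1.map (starRingEnd ℂ) Complex.continuous_conj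
  refine h2.unique ?_
  have h3 : (starRingEnd ℂ) ∘ (fun n => P.cNu * (P.r * P.r) * (kerCoeff P n * sform n h' h)) =
      fun n => P.cNu * (P.r * P.r) * (kerCoeff P n * sform n h h') := by
    funext n
    simp only [Function.comp, map_mul, conj_ofReal, hc, sform_conj]
  rw [h3]
  exact hasSum_form P hh hh'

theorem form_add {h g h' : ℝ → ℂ} (hh : Continuous h) (hg : Continuous g) (hh' : Continuous h') :
    form P (h + g) h' = form P h h' + form P g h' := by
  refine (hasSum_form P (hh.add hg) hh').unique ?_
  convert (hasSum_form P hh hh').add (hasSum_form P hg hh') using 2 with n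
  rw [← mul_add, ← mul_add]
  congr 2
  simp only [sform, fint_add hh hg, map_add, ← Finset.sum_add_distrib]
  refine Finset.sum_congr rfl fun _ _ => Finset.sum_congr rfl fun _ _ => ?_
  ring

theorem form_smul (c : ℂ) {h h' : ℝ → ℂ} (hh : Continuous h) (hh' : Continuous h') :
    form P (c • h) h' = conj c * form P h h' := by
  refine (hasSum_form P (hh.const_smul c) hh').unique ?_
  have e : (fun n => P.cNu * (P.r * P.r) * (kerCoeff P n * sform n (c • h) h')) =
      fun n => conj c * (P.cNu * (P.r * P.r) * (kerCoeff P n * sform n h h')) := by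
    funext n
    simp only [sform, fint_smul, map_mul, Finset.mul_sum]
    refine Finset.sum_congr rfl fun _ _ => Finset.sum_congr rfl fun _ _ => ?_
    ring
  rw [e]
  exact (hasSum_form P hh hh').mul_left (conj c)

theorem form_self {h : ℝ → ℂ} (hh : Continuous h) :
    ∃ (x : ℝ) (f : ℕ → ℝ), form P h h = x ∧ HasSum f x ∧ (∀ n, 0 ≤ f n) ∧
      ∀ n, f n = 0 → ∀ j ≤ n, ∀ l ≤ n, fint h ((j : ℤ) - l) = 0 := by
  obtain ⟨c, hc0, hc⟩ := P.cNu_pos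
  have h1 := hasSum_form P hh hh
  have hr := P.r_pos
  set f : ℕ → ℝ := fun n => c * (P.r * P.r) * (kerCoeff P n *
    ∑ j ∈ Finset.range (n + 1), ∑ l ∈ Finset.range (n + 1),
      ((n.choose j * n.choose l : ℕ) : ℝ) * ((4 : ℝ) ^ n)⁻¹ * ‖fint h ((j : ℤ) - l)‖ ^ 2) with hf
  have h2 : (fun n => P.cNu * (P.r * P.r) * (kerCoeff P n * sform n h h)) =
      fun n => (f n : ℂ) := by
    funext n
    simp only [hf, sform_self, hc]
    push_cast
    rfl
  rw [h2] at h1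
  obtain ⟨x, hx⟩ : ∃ x : ℝ, form P h h = x :=
    Complex.conj_eq_iff_real.1 (form_conj P hh hh)
  rw [hx, Complex.hasSum_ofReal] at h1
  refine ⟨x, f, hx, h1, fun n => ?_, fun n hn j hj l hl => ?_⟩
  · have := (kerCoeff_pos P n).le
    simp only [hf]; positivity
  · have hk := kerCoeff_pos P n
    have h3 : ∑ j ∈ Finset.range (n + 1), ∑ l ∈ Finset.range (n + 1),
      ((n.choose j * n.choose l : ℕ) : ℝ) * ((4 : ℝ) ^ n)⁻¹ * ‖fint h ((j : ℤ) - l)‖ ^ 2 = 0 := by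
      have : c * (P.r * P.r) ≠ 0 := by positivity
      simpa [hf, hk.ne', this, hc0.ne', hr.ne'] using hn
    rw [Finset.sum_eq_zero_iff_of_nonneg fun _ _ => by positivity] at h3
    have h4 := h3 j (Finset.mem_range.2 (by omega))
    rw [Finset.sum_eq_zero_iff_of_nonneg fun _ _ => by positivity] at h4
    have h5 := h4 l (Finset.mem_range.2 (by omega))
    have c1 : ((n.choose j * n.choose l : ℕ) : ℝ) * ((4 : ℝ) ^ n)⁻¹ ≠ 0 := by
      have := Nat.choose_pos hj
      have := Nat.choose_pos hl
      positivity
    have := (mul_eq_zero.1 h5).resolve_left c1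
    simpa using this

theorem eq_zero_of_fint {h : ℝ → ℂ} (hh : Continuous h) (hp : Function.Periodic h (2 * Real.pi))
    (h0 : ∀ m, fint h m = 0) : h = 0 := by
  have : Fact (0 < 2 * Real.pi) := ⟨by positivity⟩
  let F : C(AddCircle (2 * Real.pi), ℂ) := ⟨hp.lift, continuous_quot_lift _ hh⟩
  have hF : ∀ x : ℝ, F (x : AddCircle (2 * Real.pi)) = h x := fun x => hp.lift_coe x
  have hc : ∀ n, fourierCoeff F n = 0 := by
    intro n
    rw [fourierCoeff_eq_intervalIntegral _ _ 0, zero_add]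
    have := h0 (-n)
    rw [fint] at this
    have e : ∫ x in (0 : ℝ)..2 * Real.pi, @fourier (2 * Real.pi) (-n) x • F x = 0 := by
      rw [← this]
      congr 1
      funext x
      rw [hF, fourier_coe_apply, smul_eq_mul]
      congr 2
      push_cast
      have : (Real.pi : ℂ) ≠ 0 := by exact_mod_cast Real.pi_ne_zero
      field_simp
    rw [e, smul_zero]
  have hs := has_pointwise_sum_fourier_series_of_summable (f := F) (by
    rw [show fourierCoeff F = fun _ => 0 from funext hc]; exact summable_zero)
  funext x
  have := hs x
  simp only [hc, zero_smul, hF] at this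
  simpa using this.unique hasSum_zero

theorem form_definite {h : ℝ → ℂ} (hh : Continuous h) (hp : Function.Periodic h (2 * Real.pi))
    (h0 : form P h h = 0) : h = 0 := by
  obtain ⟨x, f, hx, hs, hf0, hf⟩ := form_self P hh
  have hx0 : x = 0 := by rw [hx] at h0; exact_mod_cast h0
  rw [hx0] at hs
  have hz := (hasSum_zero_iff_of_nonneg hf0).1 hs
  refine eq_zero_of_fint hh hp fun m => ?_
  obtain ⟨n, rfl | rfl⟩ := m.eq_nat_or_neg
  · simpa using hf n (congrFun hz n) n le_rfl 0 (Nat.zero_le _)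
  · simpa using hf n (congrFun hz n) 0 (Nat.zero_le _) n le_rfl

/-- `C^∞(S¹)` carrying the scalar product `form P`. -/
def TestFn (_ : Params) : Type := smoothCircle

instance : AddCommGroup (TestFn P) := inferInstanceAs (AddCommGroup smoothCircle)
instance : Module ℂ (TestFn P) := inferInstanceAs (Module ℂ smoothCircle)
instance : CoeFun (TestFn P) fun _ => ℝ → ℂ := ⟨fun h => h.1⟩

variable {P} in
theorem TestFn.continuous (h : TestFn P) : Continuous h := h.2.1.continuous

instance TestFn.core : InnerProductSpace.Core ℂ (TestFn P) where
  inner h h' := form P h h'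
  conj_inner_symm h h' := form_conj P h.continuous h'.continuous
  re_inner_nonneg h := by
    obtain ⟨x, f, hx, hs, hf0, -⟩ := form_self P h.continuous
    change 0 ≤ (form P h h).re
    rw [hx]
    exact hs.nonneg hf0
  add_left h g h' := form_add P h.continuous g.continuous h'.continuous
  smul_left h h' c := form_smul P c h.continuous h'.continuous
  definite h h0 := Subtype.ext (form_definite P h.continuous h.2.2 h0)

instance : NormedAddCommGroup (TestFn P) :=
  (TestFn.core P).toNormedAddCommGroup

instance : InnerProductSpace ℂ (TestFn P) := .ofCore (TestFn.core P).toCore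

theorem TestFn.inner_eq (h h' : TestFn P) : inner ℂ h h' = form P h h' := rfl

/-- The time-zero Hilbert space: the completion of `C^∞(S¹)` for the scalar product `form P`. -/
abbrev Hilb : Type := UniformSpace.Completion (TestFn P)

/-- The embedding of `C^∞(S¹)` into the time-zero Hilbert space. -/
def emb : TestFn P →ₗ[ℂ] Hilb P := (UniformSpace.Completion.toComplL (𝕜 := ℂ)).toLinearMap

/-- Fourier coefficients `(2π)⁻¹ ∫ e^{-ikψ} h(ψ) dψ`. -/
def fcoeff (h : ℝ → ℂ) (k : ℤ) : ℂ :=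
  (2 * Real.pi : ℂ)⁻¹ * ∫ ψ in (0 : ℝ)..2 * Real.pi, cexp (-(I * (k * ψ : ℝ))) * h ψ

theorem fcoeff_eq (h : ℝ → ℂ) (k : ℤ) : fcoeff h k = (2 * Real.pi : ℂ)⁻¹ * fint h (-k) := by
  unfold fcoeff fint
  congr 2
  funext ψ
  congr 2
  push_cast; ring

/-- The Fourier multiplier `ω̃(k)` of the operator `ω`. -/
def omegaTilde (k : ℤ) : ℂ :=
  (P.r : ℂ)⁻¹ * (k + P.sPlus) *
    (Gamma ((k + P.sPlus) / 2) / Gamma ((k - P.sPlus) / 2)) *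
    (Gamma ((k + 1 - P.sPlus) / 2) / Gamma ((k + 1 + P.sPlus) / 2))

/-- The graph of the operator `h ↦ ω (r f h)` with domain `C^∞(S¹)`, as a subspace of
`Hilb P × Hilb P`: here `f` is a multiplication operator, and `ω` multiplies the `k`-th Fourier
coefficient by `ω̃(k)`. -/
def omegaMulGraph (f : C(ℝ, ℝ)) : Submodule ℂ (Hilb P × Hilb P) where
  carrier := {x | ∃ h g : TestFn P, x = (emb P h, emb P g) ∧
    ∀ k, fcoeff g k = omegaTilde P k * fcoeff (fun ψ => P.r * f ψ * h ψ) k}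
  zero_mem' := ⟨0, 0, by simp; rfl, fun k => by
    have : ((0 : TestFn P) : ℝ → ℂ) = fun _ => 0 := rfl
    simp [this, fcoeff]⟩
  add_mem' := by
    rintro _ _ ⟨h, g, rfl, hg⟩ ⟨h', g', rfl, hg'⟩
    refine ⟨h + h', g + g', by simp, fun k => ?_⟩
    have hc := h.continuous
    have hc' := h'.continuous
    have e1 : ((g + g' : TestFn P) : ℝ → ℂ) = (g : ℝ → ℂ) + (g' : ℝ → ℂ) := rfl
    have e2 : (fun ψ => P.r * f ψ * (h + h' : TestFn P) ψ) =
        (fun ψ => (P.r : ℂ) * f ψ * h ψ) + (fun ψ => (P.r : ℂ) * f ψ * h' ψ) := by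
      funext ψ
      exact mul_add _ _ _
    have hg := hg k
    have hg' := hg' k
    rw [fcoeff_eq] at hg hg' ⊢
    rw [fcoeff_eq] at hg hg' ⊢
    rw [e1, e2, fint_add g.continuous g'.continuous, fint_add (by fun_prop) (by fun_prop), mul_add,
      hg, hg']
    ring
  smul_mem' := by
    rintro c _ ⟨h, g, rfl, hg⟩
    refine ⟨c • h, c • g, by simp, fun k => ?_⟩
    have e1 : ((c • g : TestFn P) : ℝ → ℂ) = c • (g : ℝ → ℂ) := rfl
    have e2 : (fun ψ => P.r * f ψ * (c • h : TestFn P) ψ) =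
        c • (fun ψ => (P.r : ℂ) * f ψ * h ψ) := by
      funext ψ
      exact mul_left_comm _ _ _
    have hg := hg k
    rw [fcoeff_eq] at hg ⊢
    rw [fcoeff_eq] at hg ⊢
    rw [e1, e2, fint_smul, fint_smul, mul_left_comm, hg]
    ring

theorem emb_injective : Function.Injective (emb P) :=
  UniformSpace.Completion.coe_injective (TestFn P)

/-- `omegaMulGraph` is the graph of an operator. -/
theorem omegaMulGraph_functional (f : C(ℝ, ℝ)) (x : Hilb P × Hilb P) (hx : x ∈ omegaMulGraph P f)
    (hx0 : x.1 = 0) : x.2 = 0 := by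
  obtain ⟨h, g, rfl, hg⟩ := hx
  have h0 : h = 0 := emb_injective P (hx0.trans (map_zero (emb P)).symm)
  subst h0
  have : ((0 : TestFn P) : ℝ → ℂ) = fun _ => 0 := rfl
  have g0 : g = 0 := by
    refine Subtype.ext (eq_zero_of_fint g.continuous g.2.2 fun m => ?_)
    have := hg (-m)
    rw [fcoeff_eq, neg_neg] at this
    have e : fcoeff (fun ψ => P.r * f ψ * (0 : TestFn P) ψ) (-m) = 0 := by
      simp [fcoeff, ‹((0 : TestFn P) : ℝ → ℂ) = _›]
    rw [e, mul_zero] at this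
    have hpi : (2 * Real.pi : ℂ)⁻¹ ≠ 0 := by
      have : (Real.pi : ℂ) ≠ 0 := by exact_mod_cast Real.pi_ne_zero
      exact inv_ne_zero (mul_ne_zero two_ne_zero this)
    exact (mul_eq_zero.1 this).resolve_left hpi
  rw [g0]
  exact map_zero (emb P)

/-- The operator `ω r cos_ψ` in `Hilb P` with domain `C^∞(S¹)`. -/
def omegaRCos : Hilb P →ₗ.[ℂ] Hilb P := (omegaMulGraph P ⟨Real.cos, Real.continuous_cos⟩).toLinearPMap

/-- The operator `ω r sin_ψ` in `Hilb P` with domain `C^∞(S¹)`. -/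
def omegaRSin : Hilb P →ₗ.[ℂ] Hilb P := (omegaMulGraph P ⟨Real.sin, Real.continuous_sin⟩).toLinearPMap

/-- The rotated function `ψ ↦ h (ψ - α)`. -/
def rotate (α : ℝ) (h : TestFn P) : TestFn P :=
  ⟨fun ψ => h (ψ - α), h.2.1.comp (contDiff_id.sub contDiff_const), fun ψ => by
    change h.1 _ = h.1 _
    rw [add_sub_right_comm, h.2.2]⟩

/-- `y = A x`, where `A` is the self-adjoint generator of the unitary group `V(t) = e^{itA}`. -/
def GeneratorRel {H : Type*} [NormedAddCommGroup H] [InnerProductSpace ℂ H]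
    (V : ℝ → H ≃ₗᵢ[ℂ] H) (x y : H) : Prop :=
  HasDerivAt (fun t => V t x) (I • y) 0

/-- `V(t) = e^{itA}` for all `t`: `V` is the strongly continuous one-parameter unitary group whose
generator (in the sense of Stone's theorem) is the self-adjoint operator `A`. -/
structure IsExpI {H : Type*} [NormedAddCommGroup H] [InnerProductSpace ℂ H] [CompleteSpace H]
    (A : H →ₗ.[ℂ] H) (V : ℝ → H ≃ₗᵢ[ℂ] H) : Prop where
  selfAdjoint : IsSelfAdjoint A
  map_zero : V 0 = 1
  map_add : ∀ s t, V (s + t) = V s * V t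
  continuous : ∀ x, Continuous fun t => V t x
  generator : ∀ x y, (x, y) ∈ A.graph ↔ GeneratorRel V x y

/-! ### The Lorentz group -/

/-- The metric `diag(1, -1, -1)` of `ℝ^{1+2}`. -/
def eta : Matrix (Fin 3) (Fin 3) ℝ := Matrix.diagonal ![1, -1, -1]

theorem eta_mul_eta : eta * eta = 1 := by
  rw [eta, Matrix.diagonal_mul_diagonal, ← Matrix.diagonal_one]
  congr 1
  funext i
  fin_cases i <;> simp

theorem lorentz_transpose {A : Matrix (Fin 3) (Fin 3) ℝ} (h : A.transpose * eta * A = eta) :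
    A * eta * A.transpose = eta := by
  have h1 : (eta * A.transpose * eta) * A = 1 := by
    rw [mul_assoc, mul_assoc, ← mul_assoc A.transpose, h, eta_mul_eta]
  have h2 := mul_eq_one_comm.1 h1
  calc A * eta * A.transpose = (A * (eta * A.transpose * eta)) * eta := by
        simp only [mul_assoc, eta_mul_eta, mul_one]
    _ = eta := by rw [h2, one_mul]

theorem lorentz_col {A : Matrix (Fin 3) (Fin 3) ℝ} (h : A.transpose * eta * A = eta) :
    A 0 0 ^ 2 = 1 + A 1 0 ^ 2 + A 2 0 ^ 2 := by
  have := congrFun (congrFun h 0) 0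
  simp [eta, Matrix.mul_apply, Fin.sum_univ_three, Matrix.diagonal] at this
  linarith

theorem lorentz_row {A : Matrix (Fin 3) (Fin 3) ℝ} (h : A.transpose * eta * A = eta) :
    A 0 0 ^ 2 = 1 + A 0 1 ^ 2 + A 0 2 ^ 2 := by
  have := congrFun (congrFun (lorentz_transpose h) 0) 0
  simp [eta, Matrix.mul_apply, Fin.sum_univ_three, Matrix.diagonal] at this
  linarith

/-- The proper orthochronous Lorentz group `SO₀(1,2)`. -/
def SO012 : Subgroup (GL (Fin 3) ℝ) where
  carrier := {Λ | Λ.1.transpose * eta * Λ.1 = eta ∧ Λ.1.det = 1 ∧ 0 < Λ.1 0 0}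
  one_mem' := by simp
  mul_mem' := by
    rintro A B ⟨hA, hA1, hA0⟩ ⟨hB, hB1, hB0⟩
    refine ⟨?_, ?_, ?_⟩
    · rw [Units.val_mul, Matrix.transpose_mul]
      calc B.1.transpose * A.1.transpose * eta * (A.1 * B.1)
          = B.1.transpose * (A.1.transpose * eta * A.1) * B.1 := by simp only [mul_assoc]
        _ = eta := by rw [hA, hB]
    · rw [Units.val_mul, Matrix.det_mul, hA1, hB1, one_mul]
    · have h1 := lorentz_row hA
      have h2 := lorentz_col hB
      rw [Units.val_mul, Matrix.mul_apply, Fin.sum_univ_three]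
      set a := A.1 0 0
      set b := B.1 0 0
      have h3 : (A.1 0 1 * B.1 1 0 + A.1 0 2 * B.1 2 0) ^ 2 < (a * b) ^ 2 := by
        nlinarith [sq_nonneg (A.1 0 1 * B.1 2 0 - A.1 0 2 * B.1 1 0), sq_nonneg (A.1 0 1),
          sq_nonneg (A.1 0 2), sq_nonneg (B.1 1 0), sq_nonneg (B.1 2 0)]
      have h4 := (abs_lt_of_sq_lt_sq h3 (by positivity))
      have := (abs_lt.1 h4).1
      linarith
  inv_mem' := by
    rintro A ⟨hA, hA1, hA0⟩
    have hinv : (A⁻¹).1 = eta * A.1.transpose * eta := by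
      have h1 : (eta * A.1.transpose * eta) * A.1 = 1 := by
        rw [mul_assoc, mul_assoc, ← mul_assoc A.1.transpose, hA, eta_mul_eta]
      calc (A⁻¹).1 = ((eta * A.1.transpose * eta) * A.1) * (A⁻¹).1 := by rw [h1, one_mul]
        _ = _ := by rw [mul_assoc, Units.mul_inv, mul_one]
    refine ⟨?_, ?_, ?_⟩
    · have ht : eta.transpose = eta := by simp [eta]
      rw [hinv, Matrix.transpose_mul, Matrix.transpose_mul, Matrix.transpose_transpose, ht]
      calc eta * (A.1 * eta) * eta * (eta * A.1.transpose * eta)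
          = eta * (A.1 * (eta * (eta * eta)) * A.1.transpose) * eta := by simp only [mul_assoc]
        _ = eta := by
          rw [eta_mul_eta, mul_one, lorentz_transpose hA, eta_mul_eta, one_mul]
    · have : (A⁻¹).1.det * A.1.det = 1 := by
        rw [← Matrix.det_mul, Units.inv_mul, Matrix.det_one]
      rwa [hA1, mul_one] at this
    · rw [hinv]
      simpa [eta, Matrix.mul_apply, Fin.sum_univ_three, Matrix.diagonal] using hA0

/-- An element of `SO₀(1,2)` from its matrix. -/
def SO012.mk (A : Matrix (Fin 3) (Fin 3) ℝ) (h : A.transpose * eta * A = eta) (h1 : A.det = 1)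
    (h0 : 0 < A 0 0) : SO012 :=
  ⟨Matrix.GeneralLinearGroup.mk'' A (by rw [h1]; exact isUnit_one), h, h1, h0⟩

/-- The rotation `R₀(α)`. -/
def R0 (α : ℝ) : SO012 :=
  SO012.mk !![1, 0, 0; 0, Real.cos α, -Real.sin α; 0, Real.sin α, Real.cos α]
    (by
      have := Real.sin_sq_add_cos_sq α
      ext i j
      fin_cases i <;> fin_cases j <;>
        simp [eta, Matrix.mul_apply, Fin.sum_univ_three, Matrix.diagonal] <;> nlinarith)
    (by
      have := Real.sin_sq_add_cos_sq α
      simp [Matrix.det_fin_three]; nlinarith)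
    (by simp)

/-- The boost `Λ₁(t)`. -/
def Lambda1 (t : ℝ) : SO012 :=
  SO012.mk !![Real.cosh t, 0, Real.sinh t; 0, 1, 0; Real.sinh t, 0, Real.cosh t]
    (by
      have := Real.cosh_sq t
      ext i j
      fin_cases i <;> fin_cases j <;>
        simp [eta, Matrix.mul_apply, Fin.sum_univ_three, Matrix.diagonal] <;> nlinarith)
    (by
      have := Real.cosh_sq t
      simp [Matrix.det_fin_three]; nlinarith)
    (by simpa using Real.cosh_pos t)

/-- The boost `Λ₂(s)`. -/
def Lambda2 (s : ℝ) : SO012 :=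
  SO012.mk !![Real.cosh s, Real.sinh s, 0; Real.sinh s, Real.cosh s, 0; 0, 0, 1]
    (by
      have := Real.cosh_sq s
      ext i j
      fin_cases i <;> fin_cases j <;>
        simp [eta, Matrix.mul_apply, Fin.sum_univ_three, Matrix.diagonal] <;> nlinarith)
    (by
      have := Real.cosh_sq s
      simp [Matrix.det_fin_three]; nlinarith)
    (by simpa using Real.cosh_pos s)

/-! ### Representations -/

section Rep

variable {H : Type*} [NormedAddCommGroup H] [InnerProductSpace ℂ H]

/-- Strong continuity of a representation by unitary operators. -/
def StronglyContinuous (U : SO012 →* (H ≃ₗᵢ[ℂ] H)) : Prop := ∀ x, Continuous fun Λ => U Λ x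

/-- Irreducibility: there are exactly two closed invariant subspaces. -/
def IsIrreducibleRep (U : SO012 →* (H ≃ₗᵢ[ℂ] H)) : Prop :=
  Nontrivial H ∧ ∀ K : Submodule ℂ H, IsClosed (K : Set H) → (∀ Λ, ∀ x ∈ K, U Λ x ∈ K) →
    K = ⊥ ∨ K = ⊤

/-- `C² x = y` for the Casimir operator `C² = -K₀² + L₁² + L₂²`, with `K₀`, `L₁`, `L₂` the
self-adjoint generators of `α ↦ U(R₀(α))`, `t ↦ U(Λ₁(t))`, `s ↦ U(Λ₂(s))`, on the domain
`D(K₀²) ∩ D(L₁²) ∩ D(L₂²)`. -/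
def CasimirRel (U : SO012 →* (H ≃ₗᵢ[ℂ] H)) (x y : H) : Prop :=
  ∃ x₀ x₁ x₂ y₀ y₁ y₂ : H,
    GeneratorRel (fun α => U (R0 α)) x x₀ ∧ GeneratorRel (fun α => U (R0 α)) x₀ y₀ ∧
    GeneratorRel (fun t => U (Lambda1 t)) x x₁ ∧ GeneratorRel (fun t => U (Lambda1 t)) x₁ y₁ ∧
    GeneratorRel (fun s => U (Lambda2 s)) x x₂ ∧ GeneratorRel (fun s => U (Lambda2 s)) x₂ y₂ ∧
    y = -y₀ + y₁ + y₂

end Rep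

/-- `U` is given by `(U(R₀(α))h)(ψ) = h(ψ - α)` on the rotations and by
`U(Λ₁(t)) = e^{i t ω r cos_ψ}` on the boosts. -/
structure IsTimeZeroRep (U : SO012 →* (Hilb P ≃ₗᵢ[ℂ] Hilb P)) : Prop where
  rotation : ∀ α h, U (R0 α) (emb P h) = emb P (rotate P α h)
  boost : IsExpI (omegaRCos P).closure (fun t => U (Lambda1 t))

end DeSitter

end

noncomputable section
namespace DeSitter
variable (P : Params)

/-! ### Fourier coefficients of the powers of `cos² (θ / 2)` -/

/-! The kernel depends on ψ' - ψ only, so the characters e^{ikψ} are orthogonal for the scalar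
product, and their norms are given by the Fourier coefficients λ_k of P_{s⁺}(-cos θ)
(`legendreCoeff`). Expanding the kernel in powers of cos²(θ/2) and telescoping gives a two-step
recurrence for λ_k (`legendreCoeff_recurrence`). Combined with the product formula for ω̃(k)
ω̃(k+1), it says that λ_k ω̃(k) is constant on even k and on odd k; comparing the behaviour at
infinity shows that both constants agree (`legendreCoeff_mul_omegaReal`). Hence ‖e^{ikψ}‖² = const /
ω̃(k), and in the basis f_k of normalised characters ω r cos_ψ is the Jacobi matrix with zero
diagonal and off-diagonal entries a_k = ½ √(k(k+1) + ζ²) (`ladder`). The operator ω r sin_ψ has the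
same matrix up to a constant phase.

Since a_k grows at most linearly, Carleman's argument applies: the maximal operator of the matrix is
symmetric (`JacobiRel.inner_comm`) and the finite vectors are a core for it
(`JacobiRel.mem_of_isClosed`). This gives essential self-adjointness, and it also shows that a
unitary group whose generator acts on the f_k by the matrix is generated by the maximal operator
(`generatorRel_iff_jacobiRel`).

The representation is obtained without integrating a Lie algebra. The group acts by pullback on the
functions on the forward light cone that are homogeneous of degree -(1 + s⁺). Restrict such a
function to the circle and send e^{ikψ} to d_k f_k, where the bounded non-zero numbers d_k
(`ladderPhase`) are chosen so that the infinitesimal boost becomes i times the Jacobi matrix. By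
Carleman's symmetry the norm of the image is constant along boosts; along rotations this is clear;
the Cartan decomposition Λ = R₀(α) Λ₁(t) R₀(β) (`exists_cartan`) then covers the whole group. The
images are dense, so the action extends to unitary operators (`timeZeroRep`).

Uniqueness follows from the Cartan decomposition and from the uniqueness of the group generated by a
self-adjoint operator. Irreducibility holds because the rotations have simple spectrum on the f_k
and the boost generator connects neighbouring f_k. The Casimir relation is an identity between
products of tridiagonal matrices, checked on each coefficient. -/

/-- The character `ψ ↦ e^{ikψ}`. -/
def expFn (k : ℤ) (ψ : ℝ) : ℂ := cexp (I * (k * ψ : ℝ))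

theorem continuous_expFn (k : ℤ) : Continuous (expFn k) := by
  unfold expFn; fun_prop

theorem expFn_add (j k : ℤ) (ψ : ℝ) : expFn (j + k) ψ = expFn j ψ * expFn k ψ := by
  unfold expFn
  rw [← Complex.exp_add]
  congr 1; push_cast; ring

theorem expFn_zero (ψ : ℝ) : expFn 0 ψ = 1 := by simp [expFn]

theorem norm_expFn (k : ℤ) (ψ : ℝ) : ‖expFn k ψ‖ = 1 := by
  rw [expFn, mul_comm, Complex.norm_exp_ofReal_mul_I]

theorem expFn_periodic (k : ℤ) : Function.Periodic (expFn k) (2 * Real.pi) := fun ψ => by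
  unfold expFn
  rw [Complex.exp_eq_exp_iff_exists_int]
  exact ⟨k, by push_cast; ring⟩

theorem integral_expFn (k : ℤ) :
    ∫ ψ in (0 : ℝ)..2 * Real.pi, expFn k ψ = if k = 0 then 2 * Real.pi else 0 := by
  split_ifs with h
  · subst h
    simp [expFn_zero]
  · have hk : (I * k : ℂ) ≠ 0 := mul_ne_zero I_ne_zero (by exact_mod_cast h)
    have := integral_exp_mul_complex (a := 0) (b := 2 * Real.pi) hk
    have e : ∀ ψ : ℝ, expFn k ψ = cexp (I * k * ψ) := fun ψ => by
      unfold expFn; congr 1; push_cast; ring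
    have h2 := expFn_periodic k 0
    rw [zero_add, e, e] at h2
    simp only [e]
    rw [this, h2]
    simp

theorem fint_expFn (k m : ℤ) : fint (expFn k) m = if m + k = 0 then 2 * Real.pi else 0 := by
  rw [← integral_expFn, fint]
  congr 1
  funext ψ
  rw [expFn_add]; rfl

theorem fcoeff_expFn (k m : ℤ) : fcoeff (expFn k) m = if m = k then 1 else 0 := by
  have hpi : (2 * Real.pi : ℂ) ≠ 0 := by
    have : (Real.pi : ℂ) ≠ 0 := by exact_mod_cast Real.pi_ne_zero
    exact mul_ne_zero two_ne_zero this
  rw [fcoeff_eq, fint_expFn]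
  by_cases h : m = k
  · subst h
    rw [if_pos (by omega), if_pos rfl]
    push_cast
    exact inv_mul_cancel₀ hpi
  · rw [if_neg h, if_neg (by omega)]; simp

/-- The Fourier coefficients of `cos²ⁿ (θ / 2)`. -/
def cosPowCoeff (n : ℕ) (m : ℤ) : ℝ :=
  ∑ j ∈ Finset.range (n + 1), ∑ l ∈ Finset.range (n + 1),
    if (j : ℤ) - l = m then ((n.choose j * n.choose l : ℕ) : ℝ) * ((4 : ℝ) ^ n)⁻¹ else 0

theorem cosPowCoeff_nonneg (n : ℕ) (m : ℤ) : 0 ≤ cosPowCoeff n m := by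
  unfold cosPowCoeff
  refine Finset.sum_nonneg fun _ _ => Finset.sum_nonneg fun _ _ => ?_
  split_ifs <;> positivity

theorem cosPowCoeff_neg (n : ℕ) (m : ℤ) : cosPowCoeff n (-m) = cosPowCoeff n m := by
  unfold cosPowCoeff
  rw [Finset.sum_comm]
  refine Finset.sum_congr rfl fun j _ => Finset.sum_congr rfl fun l _ => ?_
  rw [mul_comm (n.choose l)]
  congr 1
  exact propext ⟨fun h => by omega, fun h => by omega⟩

theorem integral_cos_pow_mul_expFn (n : ℕ) (m : ℤ) :
    ∫ θ in (0 : ℝ)..2 * Real.pi, (((1 + Real.cos θ) / 2 : ℝ) : ℂ) ^ n * expFn m θ =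
      2 * Real.pi * cosPowCoeff n m := by
  simp only [cos_pow_expand, Finset.sum_mul]
  -- Integration against e^{imθ} selects the coefficient with index -m; evenness in m restores the
  -- sign.
  rw [← cosPowCoeff_neg, cosPowCoeff]
  push_cast
  rw [intervalIntegral.integral_finsetSum fun j _ =>
      (by have := continuous_expFn m; fun_prop : Continuous _).intervalIntegrable _ _,
    Finset.mul_sum]
  refine Finset.sum_congr rfl fun j _ => ?_
  rw [intervalIntegral.integral_finsetSum fun l _ =>
      (by have := continuous_expFn m; fun_prop : Continuous _).intervalIntegrable _ _,
    Finset.mul_sum]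
  refine Finset.sum_congr rfl fun l _ => ?_
  have e : ∀ θ : ℝ, (n.choose j * n.choose l * ((4 : ℂ) ^ n)⁻¹) *
      cexp (I * ((j - l) * θ)) * expFn m θ =
      (n.choose j * n.choose l * ((4 : ℂ) ^ n)⁻¹) * expFn ((j - l : ℤ) + m) θ := by
    intro θ
    rw [expFn_add, mul_assoc]
    congr 2
    unfold expFn; push_cast; ring_nf
  simp only [e]
  rw [intervalIntegral.integral_const_mul, integral_expFn]
  by_cases h : (j : ℤ) - l = -m
  · rw [if_pos (by omega), if_pos h]; push_cast; ring
  · rw [if_neg (by omega), if_neg h]; simp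

theorem cosPowCoeff_zero_left (m : ℤ) : cosPowCoeff 0 m = if m = 0 then 1 else 0 := by
  simp [cosPowCoeff, eq_comm]

theorem two_pi_ne_zero : (2 * Real.pi : ℂ) ≠ 0 := by
  have : (Real.pi : ℂ) ≠ 0 := by exact_mod_cast Real.pi_ne_zero
  exact mul_ne_zero two_ne_zero this

theorem cos_eq_expFn (θ : ℝ) : (Real.cos θ : ℂ) = (expFn 1 θ + expFn (-1) θ) / 2 := by
  push_cast
  rw [Complex.cos]
  unfold expFn
  congr 3 <;> (push_cast; ring)

theorem sin_eq_expFn (θ : ℝ) : (Real.sin θ : ℂ) = (expFn (-1) θ - expFn 1 θ) * I / 2 := by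
  push_cast
  rw [Complex.sin]
  unfold expFn
  congr 4 <;> (push_cast; ring)

/-- One more factor cos²(θ/2) = (e^{iθ} + 2 + e^{-iθ}) / 4 mixes three neighbouring Fourier
coefficients. -/
theorem cosPowCoeff_succ_left (n : ℕ) (m : ℤ) : cosPowCoeff (n + 1) m =
    (cosPowCoeff n (m - 1) + 2 * cosPowCoeff n m + cosPowCoeff n (m + 1)) / 4 := by
  have h := integral_cos_pow_mul_expFn (n + 1) m
  have e : ∀ θ : ℝ, (((1 + Real.cos θ) / 2 : ℝ) : ℂ) ^ (n + 1) * expFn m θ =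
      4⁻¹ * ((((1 + Real.cos θ) / 2 : ℝ) : ℂ) ^ n * expFn (m - 1) θ) +
      2⁻¹ * ((((1 + Real.cos θ) / 2 : ℝ) : ℂ) ^ n * expFn m θ) +
      4⁻¹ * ((((1 + Real.cos θ) / 2 : ℝ) : ℂ) ^ n * expFn (m + 1) θ) := by
    intro θ
    rw [pow_succ, sub_eq_add_neg, expFn_add m (-1), expFn_add m 1]
    have : (((1 + Real.cos θ) / 2 : ℝ) : ℂ) = 2⁻¹ + (expFn 1 θ + expFn (-1) θ) / 4 := by
      rw [ofReal_div, ofReal_add, cos_eq_expFn]; push_cast; ring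
    generalize (((1 + Real.cos θ) / 2 : ℝ) : ℂ) ^ n = z
    rw [this]; ring
  simp only [e] at h
  have c : ∀ k, Continuous fun θ : ℝ => (((1 + Real.cos θ) / 2 : ℝ) : ℂ) ^ n * expFn k θ :=
    fun k => by have := continuous_expFn k; fun_prop
  have c' : ∀ (a : ℂ) k, Continuous fun θ : ℝ =>
      a * ((((1 + Real.cos θ) / 2 : ℝ) : ℂ) ^ n * expFn k θ) := fun a k => (c k).const_mul a
  rw [intervalIntegral.integral_add
      (by exact ((c' _ _).add (c' _ _)).intervalIntegrable _ _)
      ((c' _ _).intervalIntegrable _ _),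
    intervalIntegral.integral_add
      ((c' _ _).intervalIntegrable _ _) ((c' _ _).intervalIntegrable _ _),
    intervalIntegral.integral_const_mul, intervalIntegral.integral_const_mul,
    intervalIntegral.integral_const_mul, integral_cos_pow_mul_expFn, integral_cos_pow_mul_expFn,
    integral_cos_pow_mul_expFn] at h
  have h2 : (cosPowCoeff (n + 1) m : ℂ) =
      (cosPowCoeff n (m - 1) + 2 * cosPowCoeff n m + cosPowCoeff n (m + 1)) / 4 := by
    apply mul_left_cancel₀ two_pi_ne_zero
    rw [← h]; ring
  exact_mod_cast h2

theorem wallis_eq_cosPowCoeff (n : ℕ) : wallis n = 2 * Real.pi * cosPowCoeff n 0 := by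
  have h := integral_cos_pow_mul_expFn n 0
  simp only [expFn_zero, mul_one] at h
  have : ((wallis n : ℝ) : ℂ) = 2 * Real.pi * cosPowCoeff n 0 := by
    rw [← h, wallis, ← intervalIntegral.integral_ofReal]
    simp
  exact_mod_cast this

/-- The coefficient is binom(2n, n+m) / 4ⁿ, and this is the ratio of neighbouring binomial
coefficients. The induction avoids the closed form by using `cosPowCoeff_succ_left`. -/
theorem cosPowCoeff_succ_right (n : ℕ) (m : ℤ) :
    (n + m + 1 : ℝ) * cosPowCoeff n (m + 1) = (n - m) * cosPowCoeff n m := by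
  induction n generalizing m with
  | zero =>
    rw [cosPowCoeff_zero_left, cosPowCoeff_zero_left]
    by_cases h0 : m = 0
    · subst h0; simp
    · by_cases h1 : m + 1 = 0
      · obtain rfl : m = -1 := by omega
        simp
      · simp [h0, h1]
  | succ n ih =>
    rw [cosPowCoeff_succ_left, cosPowCoeff_succ_left]
    have h1 := ih m
    have h2 := ih (m + 1)
    have h3 := ih (m - 1)
    rw [show m + 1 - 1 = m by ring]
    rw [show m - 1 + 1 = m by ring] at h3
    push_cast at *
    linear_combination (1 / 2 : ℝ) * h1 + (1 / 4 : ℝ) * h2 + (1 / 4 : ℝ) * h3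

theorem cosPowCoeff_succ_le (n : ℕ) {m : ℤ} (hm : 0 ≤ m) :
    cosPowCoeff n (m + 1) ≤ cosPowCoeff n m := by
  have h := cosPowCoeff_succ_right n m
  have h0 := cosPowCoeff_nonneg n m
  have hm' : (0 : ℝ) ≤ m := by exact_mod_cast hm
  have hn : (0 : ℝ) ≤ n := by positivity
  have hpos : (0 : ℝ) < n + m + 1 := by positivity
  by_contra hlt
  push Not at hlt
  have := mul_lt_mul_of_pos_left hlt hpos
  nlinarith

theorem cosPowCoeff_le_zero (n : ℕ) (m : ℤ) : cosPowCoeff n m ≤ cosPowCoeff n 0 := by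
  have h : ∀ k : ℕ, cosPowCoeff n k ≤ cosPowCoeff n 0 := by
    intro k
    induction k with
    | zero => simp
    | succ k ih => exact (by exact_mod_cast cosPowCoeff_succ_le n (Int.natCast_nonneg k) :
        cosPowCoeff n ((k + 1 : ℕ) : ℤ) ≤ cosPowCoeff n k).trans ih
  obtain ⟨k, rfl | rfl⟩ := m.eq_nat_or_neg
  · exact h k
  · rw [cosPowCoeff_neg]; exact h k

/-- For index k with 0 ≤ k ≤ n the single summand j = k, l = 0 is already positive; evenness gives
negative indices. -/
theorem cosPowCoeff_pos (n : ℕ) {m : ℤ} (hm : |m| ≤ n) : 0 < cosPowCoeff n m := by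
  have h : ∀ k : ℕ, k ≤ n → 0 < cosPowCoeff n k := by
    intro k hk
    refine lt_of_lt_of_le ?_ (Finset.single_le_sum (f := fun j => _) (fun j _ => ?_)
      (Finset.mem_range.2 (by omega : k < n + 1)))
    · refine lt_of_lt_of_le ?_ (Finset.single_le_sum (f := fun l => _) (fun l _ => ?_)
        (Finset.mem_range.2 (by omega : 0 < n + 1)))
      · have := Nat.choose_pos hk
        simp only [CharP.cast_eq_zero, sub_zero, if_true, Nat.choose_zero_right]
        positivity
      · split_ifs <;> positivity
    · exact Finset.sum_nonneg fun _ _ => by split_ifs <;> positivity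
  obtain ⟨k, rfl | rfl⟩ := m.eq_nat_or_neg
  · exact h k (by simpa using hm)
  · rw [cosPowCoeff_neg]; exact h k (by simpa using hm)

/-! ### The scalar product on characters -/

/-- The coefficient at 0 dominates, and for it the series is the one with Wallis integrals. -/
theorem summable_kerCoeff_mul_cosPowCoeff (m : ℤ) :
    Summable fun n => kerCoeff P n * cosPowCoeff n m := by
  have h := (summable_kerCoeff_wallis P).mul_left (2 * Real.pi)⁻¹
  refine Summable.of_nonneg_of_le
    (fun n => mul_nonneg (kerCoeff_pos P n).le (cosPowCoeff_nonneg n m)) (fun n => ?_) h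
  rw [wallis_eq_cosPowCoeff]
  have := Real.pi_pos
  calc kerCoeff P n * cosPowCoeff n m ≤ kerCoeff P n * cosPowCoeff n 0 :=
        mul_le_mul_of_nonneg_left (cosPowCoeff_le_zero n m) (kerCoeff_pos P n).le
    _ = _ := by field_simp

/-- The Fourier coefficients of the kernel `P_{s⁺}(-cos θ)`. -/
def legendreCoeff (m : ℤ) : ℝ := ∑' n, kerCoeff P n * cosPowCoeff n m

theorem legendreCoeff_pos (m : ℤ) : 0 < legendreCoeff P m := by
  refine (summable_kerCoeff_mul_cosPowCoeff P m).tsum_pos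
    (fun n => mul_nonneg (kerCoeff_pos P n).le (cosPowCoeff_nonneg n m)) m.natAbs
    (mul_pos (kerCoeff_pos P _) (cosPowCoeff_pos _ ?_))
  simp

theorem legendreCoeff_succ_le {m : ℤ} (hm : 0 ≤ m) :
    legendreCoeff P (m + 1) ≤ legendreCoeff P m :=
  (summable_kerCoeff_mul_cosPowCoeff P _).tsum_le_tsum
    (fun n => mul_le_mul_of_nonneg_left (cosPowCoeff_succ_le n hm) (kerCoeff_pos P n).le)
    (summable_kerCoeff_mul_cosPowCoeff P _)

/-- The termwise form of the recurrence for the λ_m. The terms do not vanish one by one, but by the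
relation between neighbouring `cosPowCoeff` they are consecutive differences of n · 4m · `kerCoeff P
n` · `cosPowCoeff n m`. -/
theorem legendreCoeff_telescope (m : ℤ) (n : ℕ) :
    kerCoeff P n * ((m * (m + 1) + P.zeta ^ 2) * cosPowCoeff n (m + 1) -
      (m * (m - 1) + P.zeta ^ 2) * cosPowCoeff n (m - 1)) =
    n * (4 * m * (kerCoeff P n * cosPowCoeff n m)) -
      (n + 1 : ℕ) * (4 * m * (kerCoeff P (n + 1) * cosPowCoeff (n + 1) m)) := by
  have hk : kerCoeff P (n + 1) * (n + 1) ^ 2 = kerCoeff P n * (n * (n + 1) + P.zeta ^ 2) := by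
    have : ((n : ℝ) + 1) ≠ 0 := by positivity
    rw [kerCoeff, Finset.prod_range_succ, ← kerCoeff]
    field_simp
  have h1 := cosPowCoeff_succ_right n m
  have h2 := cosPowCoeff_succ_right n (m - 1)
  rw [show m - 1 + 1 = m by ring] at h2
  push_cast at h2 ⊢
  have h3 : (n + 1 : ℝ) * (4 * m * cosPowCoeff (n + 1) m) =
      (n + 1) ^ 2 * (cosPowCoeff n (m - 1) - cosPowCoeff n (m + 1)) := by
    rw [cosPowCoeff_succ_left]
    linear_combination (n + 1 : ℝ) * h1 + (n + 1 : ℝ) * h2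
  have h4 : m * (m + 1) * cosPowCoeff n (m + 1) - m * (m - 1) * cosPowCoeff n (m - 1) +
      n * (n + 1) * (cosPowCoeff n (m - 1) - cosPowCoeff n (m + 1)) =
      n * (4 * m * cosPowCoeff n m) := by
    linear_combination -(n - m : ℝ) * h1 - (n + m : ℝ) * h2
  linear_combination kerCoeff P n * h4 + (cosPowCoeff n (m - 1) - cosPowCoeff n (m + 1)) * hk +
    kerCoeff P (n + 1) * h3

/-- By telescoping, the N-th partial sum of the difference of both sides is -N b_N with b summable.
A non-zero limit would force |b_N| ≥ const / N eventually, against the divergence of the harmonic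
series. -/
theorem legendreCoeff_recurrence (m : ℤ) : (m * (m + 1) + P.zeta ^ 2) * legendreCoeff P (m + 1) =
    (m * (m - 1) + P.zeta ^ 2) * legendreCoeff P (m - 1) := by
  set b : ℕ → ℝ := fun n => 4 * m * (kerCoeff P n * cosPowCoeff n m) with hb
  have hs1 := (summable_kerCoeff_mul_cosPowCoeff P (m + 1)).hasSum.mul_left
    (m * (m + 1) + P.zeta ^ 2)
  have hs2 := (summable_kerCoeff_mul_cosPowCoeff P (m - 1)).hasSum.mul_left
    (m * (m - 1) + P.zeta ^ 2)
  have hs := (hs1.sub hs2).tendsto_sum_nat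
  set L := (m * (m + 1) + P.zeta ^ 2) * legendreCoeff P (m + 1) -
    (m * (m - 1) + P.zeta ^ 2) * legendreCoeff P (m - 1) with hL
  have hpart : ∀ N : ℕ, ∑ n ∈ Finset.range N, ((m * (m + 1) + P.zeta ^ 2) *
      (kerCoeff P n * cosPowCoeff n (m + 1)) - (m * (m - 1) + P.zeta ^ 2) *
      (kerCoeff P n * cosPowCoeff n (m - 1))) = -(N * b N) := by
    intro N
    induction N with
    | zero => simp
    | succ N ih =>
      rw [Finset.sum_range_succ, ih]
      have := legendreCoeff_telescope P m N
      simp only [hb]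
      linear_combination this
  have hlim : Filter.Tendsto (fun N : ℕ => -(N * b N)) Filter.atTop (nhds L) := by
    simpa only [hpart, hL, legendreCoeff] using hs
  have hbs : Summable b := (summable_kerCoeff_mul_cosPowCoeff P m).mul_left _
  have hL0 : L = 0 := by
    by_contra hne
    have hpos : 0 < |L| := abs_pos.2 hne
    have hev : ∀ᶠ N : ℕ in Filter.atTop, |L| / 2 < |-(N * b N)| :=
      hlim.abs.eventually (lt_mem_nhds (by linarith))
    have hdiv : Summable fun N : ℕ => |L| / 2 * (1 / (N : ℝ)) := by
      refine Summable.of_norm_bounded_eventually_nat hbs.abs ?_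
      filter_upwards [hev, Filter.eventually_gt_atTop 0] with N hN hN0
      have hN1 : (0 : ℝ) < N := by exact_mod_cast hN0
      rw [abs_neg, abs_mul, abs_of_pos hN1] at hN
      rw [Real.norm_of_nonneg (by positivity), mul_one_div, div_le_iff₀ hN1]
      linarith
    have := (summable_mul_left_iff (by positivity)).1 hdiv
    exact Real.not_summable_one_div_natCast this
  rw [hL, sub_eq_zero] at hL0
  exact hL0

theorem sform_expFn (n : ℕ) (k : ℤ) (h : ℝ → ℂ) :
    sform n (expFn k) h = 2 * Real.pi * cosPowCoeff n k * fint h (-k) := by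
  rw [← cosPowCoeff_neg, sform, cosPowCoeff]
  push_cast
  simp only [Finset.mul_sum, Finset.sum_mul]
  refine Finset.sum_congr rfl fun j _ => Finset.sum_congr rfl fun l _ => ?_
  rw [fint_expFn]
  by_cases hjl : (j : ℤ) - l = -k
  · rw [if_pos (by omega), if_pos hjl, hjl]
    simp only [map_mul, map_ofNat, conj_ofReal, ofReal_mul, ofReal_ofNat]
    push_cast; ring
  · rw [if_neg (by omega), if_neg hjl]; simp

/-- A convolution kernel is diagonal on characters, with its Fourier coefficients as eigenvalues. -/
theorem form_expFn (k : ℤ) {h : ℝ → ℂ} (hh : Continuous h) : form P (expFn k) h =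
    P.cNu * (P.r * P.r) * (2 * Real.pi) ^ 2 * legendreCoeff P k * fcoeff h k := by
  refine (hasSum_form P (continuous_expFn k) hh).unique ?_
  have h1 := Complex.hasSum_ofReal.2 (summable_kerCoeff_mul_cosPowCoeff P k).hasSum
  have h2 := h1.mul_left (P.cNu * (P.r * P.r) * (2 * Real.pi) * fint h (-k))
  have e1 : (fun n => P.cNu * (P.r * P.r) * (kerCoeff P n * sform n (expFn k) h)) = fun n =>
      P.cNu * (P.r * P.r) * (2 * Real.pi) * fint h (-k) *
        ((kerCoeff P n * cosPowCoeff n k : ℝ) : ℂ) := by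
    funext n
    rw [sform_expFn]; push_cast; ring
  rw [e1]
  have e2 : P.cNu * (P.r * P.r) * (2 * Real.pi) ^ 2 * legendreCoeff P k * fcoeff h k =
      P.cNu * (P.r * P.r) * (2 * Real.pi) * fint h (-k) * legendreCoeff P k := by
    rw [fcoeff_eq]
    have := two_pi_ne_zero
    field_simp
  rw [e2]
  exact h2

/-- A bound of the norm by Fourier coefficients. -/
theorem form_self_le : ∃ C : ℝ, 0 ≤ C ∧ ∀ h : ℝ → ℂ, Continuous h →
    Summable (fun m => ‖fint h m‖ ^ 2) → ‖form P h h‖ ≤ C * ∑' m, ‖fint h m‖ ^ 2 := by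
  refine ⟨‖P.cNu * (P.r * P.r)‖ * legendreCoeff P 0,
    mul_nonneg (norm_nonneg _) (legendreCoeff_pos P 0).le, fun h hh hs => ?_⟩
  have hle : ∀ n, ‖sform n h h‖ ≤ cosPowCoeff n 0 * ∑' m, ‖fint h m‖ ^ 2 := by
    intro n
    rw [sform_self, Complex.norm_real, Real.norm_of_nonneg
      (Finset.sum_nonneg fun _ _ => Finset.sum_nonneg fun _ _ => by positivity)]
    -- The pairs (j, l) are collected by their difference m, which satisfies |m| ≤ n.
    have e : ∑ j ∈ Finset.range (n + 1), ∑ l ∈ Finset.range (n + 1),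
        ((n.choose j * n.choose l : ℕ) : ℝ) * ((4 : ℝ) ^ n)⁻¹ * ‖fint h ((j : ℤ) - l)‖ ^ 2 =
        ∑ m ∈ Finset.Icc (-n : ℤ) n, cosPowCoeff n m * ‖fint h m‖ ^ 2 := by
      simp only [cosPowCoeff, Finset.sum_mul]
      rw [Finset.sum_comm (s := Finset.Icc (-n : ℤ) n)]
      refine Finset.sum_congr rfl fun j hj => ?_
      rw [Finset.sum_comm (s := Finset.Icc (-n : ℤ) n)]
      refine Finset.sum_congr rfl fun l hl => ?_
      rw [Finset.mem_range] at hj hl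
      simp only [ite_mul, zero_mul]
      rw [Finset.sum_ite_eq, if_pos (Finset.mem_Icc.2 (by omega))]
    rw [e]
    calc ∑ m ∈ Finset.Icc (-n : ℤ) n, cosPowCoeff n m * ‖fint h m‖ ^ 2
        ≤ ∑ m ∈ Finset.Icc (-n : ℤ) n, cosPowCoeff n 0 * ‖fint h m‖ ^ 2 :=
          Finset.sum_le_sum fun m _ =>
            mul_le_mul_of_nonneg_right (cosPowCoeff_le_zero n m) (by positivity)
      _ ≤ _ := by
          rw [← Finset.mul_sum]
          exact mul_le_mul_of_nonneg_left (hs.sum_le_tsum _ fun _ _ => by positivity)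
            (cosPowCoeff_nonneg n 0)
  have hsum := ((summable_kerCoeff_mul_cosPowCoeff P 0).hasSum.mul_left
    ‖P.cNu * (P.r * P.r)‖).mul_right (∑' m, ‖fint h m‖ ^ 2)
  rw [← (hasSum_form P hh hh).tsum_eq]
  refine tsum_of_norm_bounded hsum fun n => ?_
  rw [norm_mul, norm_mul (kerCoeff P n : ℂ), Complex.norm_real,
    Real.norm_of_nonneg (kerCoeff_pos P n).le, mul_assoc _ (_ * _), mul_assoc (kerCoeff P n)]
  exact mul_le_mul_of_nonneg_left
    (mul_le_mul_of_nonneg_left (hle n) (kerCoeff_pos P n).le) (norm_nonneg _)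

/-! ### The multiplier `ω̃` -/

/-- The two series: s⁺ is real in the complementary one, and Re s⁺ = -1/2 in the principal one. -/
theorem Params.sPlus_cases : (∃ σ : ℝ, -1 / 2 < σ ∧ σ < 0 ∧ P.sPlus = σ) ∨
    conj P.sPlus = -1 - P.sPlus := by
  have hz := P.zeta_pos
  unfold Params.sPlus Params.nu
  split_ifs with h
  · left
    have hpos : 0 < 1 / 4 - P.zeta ^ 2 := by nlinarith
    refine ⟨-1 / 2 + √(1 / 4 - P.zeta ^ 2), ?_, ?_, ?_⟩
    · have := Real.sqrt_pos.2 hpos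
      linarith
    · have : √(1 / 4 - P.zeta ^ 2) < 1 / 2 := by
        rw [Real.sqrt_lt' (by norm_num)]; nlinarith
      linarith
    · push_cast
      linear_combination -((√(1 / 4 - P.zeta ^ 2) : ℝ) : ℂ) * I_sq
  · right
    rw [map_sub, map_div₀, map_neg, map_one, map_ofNat, map_mul, conj_I, conj_ofReal]
    ring

theorem Params.sPlus_re : -1 / 2 ≤ P.sPlus.re ∧ P.sPlus.re < 0 := by
  rcases P.sPlus_cases with ⟨σ, h1, h2, h⟩ | h
  · rw [h, ofReal_re]; exact ⟨h1.le, h2⟩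
  · have := congrArg re h
    simp at this
    constructor <;> linarith

/-- Since -1/2 ≤ Re s⁺ < 0, no integer is equal to -s⁺. This keeps all Gamma arguments in ω̃ away
from the poles. -/
theorem int_add_sPlus_ne_zero (k : ℤ) : (k : ℂ) + P.sPlus ≠ 0 := by
  intro h
  have h1 := congrArg re h
  have h2 := P.sPlus_re
  simp at h1
  have h3 : (0 : ℝ) < k := by linarith
  have h4 : (k : ℝ) < 1 := by linarith
  have : 0 < k := by exact_mod_cast h3
  have : k < 1 := by exact_mod_cast h4
  omega

theorem int_sub_sPlus_ne_zero (k : ℤ) : (k : ℂ) - P.sPlus ≠ 0 := by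
  intro h
  have := int_add_sPlus_ne_zero P (-k)
  apply this
  push_cast
  linear_combination -h

theorem Gamma_half_add_ne_zero (k : ℤ) : Gamma ((k + P.sPlus) / 2) ≠ 0 := by
  refine Gamma_ne_zero fun m hm => int_add_sPlus_ne_zero P (k + 2 * m) ?_
  push_cast
  linear_combination 2 * hm

theorem Gamma_half_sub_ne_zero (k : ℤ) : Gamma ((k - P.sPlus) / 2) ≠ 0 := by
  refine Gamma_ne_zero fun m hm => int_sub_sPlus_ne_zero P (k + 2 * m) ?_
  push_cast
  linear_combination 2 * hm

theorem Gamma_half_add_two (k : ℤ) :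
    Gamma ((k + 2 + P.sPlus) / 2) = (k + P.sPlus) / 2 * Gamma ((k + P.sPlus) / 2) := by
  rw [← Gamma_add_one _ (div_ne_zero (int_add_sPlus_ne_zero P k) two_ne_zero)]
  congr 1; ring

theorem Gamma_half_sub_two (k : ℤ) :
    Gamma ((k + 2 - P.sPlus) / 2) = (k - P.sPlus) / 2 * Gamma ((k - P.sPlus) / 2) := by
  rw [← Gamma_add_one _ (div_ne_zero (int_sub_sPlus_ne_zero P k) two_ne_zero)]
  congr 1; ring

theorem Params.r_ne_zero : (P.r : ℂ) ≠ 0 := by exact_mod_cast P.r_pos.ne'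

/-- The Gamma factors with arguments (k+1±s)/2 cancel, and Γ(z+1) = zΓ(z) reduces the others to
(k-s)/(k+s). What remains is r⁻² (k+1+s)(k-s) = r⁻² (k(k+1) - s(s+1)), and -s(s+1) = ζ². -/
theorem omegaTilde_mul_succ (k : ℤ) : omegaTilde P k * omegaTilde P (k + 1) =
    ((P.r : ℂ) ^ 2)⁻¹ * (k * (k + 1)) + (P.μ : ℂ) ^ 2 := by
  have hr := P.r_ne_zero
  have hs := P.sPlus_eq
  have h1 := Gamma_half_add_ne_zero P k
  have h2 := Gamma_half_sub_ne_zero P k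
  have h3 := Gamma_half_add_ne_zero P (k + 1)
  have h4 := Gamma_half_sub_ne_zero P (k + 1)
  have h5 := Gamma_half_add_two P k
  have h6 := Gamma_half_sub_two P k
  have h7 := int_add_sPlus_ne_zero P k
  unfold omegaTilde
  push_cast at *
  rw [show (k : ℂ) + 1 + 1 - P.sPlus = k + 2 - P.sPlus by ring,
    show (k : ℂ) + 1 + 1 + P.sPlus = k + 2 + P.sPlus by ring, h5, h6]
  have hz : (P.μ : ℂ) = P.zeta * (P.r : ℂ)⁻¹ := by
    unfold Params.zeta; push_cast; field_simp
  rw [hz, mul_pow, ← hs]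
  field_simp
  ring

theorem omegaTilde_mul_pred (k : ℤ) : omegaTilde P k * omegaTilde P (k - 1) =
    ((P.r : ℂ) ^ 2)⁻¹ * (k * (k - 1)) + (P.μ : ℂ) ^ 2 := by
  have := omegaTilde_mul_succ P (k - 1)
  rw [sub_add_cancel] at this
  rw [mul_comm, this]
  push_cast; ring

theorem omegaTilde_zero_pos : ∃ c : ℝ, 0 < c ∧ omegaTilde P 0 = c := by
  have hr := P.r_pos
  -- The prefactor s is absorbed by sΓ(s/2) = 2Γ(1+s/2), so that all Gamma arguments get positive
  -- real part. In the complementary series all four values are then positive; in the principal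
  -- series they form complex conjugate pairs.
  have e : omegaTilde P 0 = (P.r : ℂ)⁻¹ * (2 * (Gamma (1 + P.sPlus / 2) *
      Gamma ((1 - P.sPlus) / 2)) / (Gamma (-P.sPlus / 2) * Gamma ((1 + P.sPlus) / 2))) := by
    have h := Gamma_half_add_two P 0
    rw [Int.cast_zero, zero_add, zero_add,
      show (2 + P.sPlus) / 2 = 1 + P.sPlus / 2 by ring] at h
    rw [h, omegaTilde]
    simp only [Int.cast_zero, zero_add, zero_sub]
    ring
  rw [e]
  rcases P.sPlus_cases with ⟨σ, h1, h2, h⟩ | h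
  · refine ⟨P.r⁻¹ * (2 * (Real.Gamma (1 + σ / 2) * Real.Gamma ((1 - σ) / 2)) /
      (Real.Gamma (-σ / 2) * Real.Gamma ((1 + σ) / 2))), ?_, ?_⟩
    · have g1 := Real.Gamma_pos_of_pos (by linarith : 0 < 1 + σ / 2)
      have g2 := Real.Gamma_pos_of_pos (by linarith : 0 < (1 - σ) / 2)
      have g3 := Real.Gamma_pos_of_pos (by linarith : 0 < -σ / 2)
      have g4 := Real.Gamma_pos_of_pos (by linarith : 0 < (1 + σ) / 2)
      positivity
    · rw [h]
      push_cast [← Complex.Gamma_ofReal]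
      rfl
  · have c1 : (1 - P.sPlus) / 2 = conj (1 + P.sPlus / 2) := by
      rw [map_add, map_div₀, map_one, map_ofNat, h]; ring
    have c2 : -P.sPlus / 2 = conj ((1 + P.sPlus) / 2) := by
      rw [map_div₀, map_add, map_one, map_ofNat, h]; ring
    have g1 : Gamma (1 + P.sPlus / 2) ≠ 0 := by
      convert Gamma_half_add_ne_zero P 2 using 2
      push_cast; ring
    have g2 : Gamma ((1 + P.sPlus) / 2) ≠ 0 := by
      convert Gamma_half_add_ne_zero P 1 using 2
      push_cast; ring
    rw [c1, c2, Gamma_conj, Gamma_conj, mul_conj, mul_comm (conj _), mul_conj]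
    refine ⟨P.r⁻¹ * (2 * normSq (Gamma (1 + P.sPlus / 2)) / normSq (Gamma ((1 + P.sPlus) / 2))),
      ?_, by push_cast; rfl⟩
    have := normSq_pos.2 g1
    have := normSq_pos.2 g2
    positivity

theorem quad_pos (k : ℤ) : (0 : ℝ) < k * (k + 1) + P.zeta ^ 2 := by
  have h1 : 0 ≤ k * (k + 1) := by
    rcases le_or_gt 0 k with h | h
    · positivity
    · exact mul_nonneg_of_nonpos_of_nonpos h.le (by omega)
  have h2 : (0 : ℝ) ≤ k * (k + 1) := by exact_mod_cast h1
  have := P.zeta_pos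
  positivity

/-- Positivity at k = 0 spreads in both directions because ω̃(k) ω̃(k+1) is positive. -/
theorem omegaTilde_pos (k : ℤ) : ∃ c : ℝ, 0 < c ∧ omegaTilde P k = c := by
  have hr := P.r_pos
  have key : ∀ k : ℤ, omegaTilde P k * omegaTilde P (k + 1) =
      (((P.r ^ 2)⁻¹ * (k * (k + 1) + P.zeta ^ 2) : ℝ) : ℂ) := by
    intro k
    have := P.r_ne_zero
    rw [omegaTilde_mul_succ, Params.zeta]
    push_cast; field_simp
  induction k using Int.induction_on with
  | zero => exact omegaTilde_zero_pos P
  | succ n ih =>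
    obtain ⟨c, hc, h⟩ := ih
    have hk := key n
    have hq := quad_pos P n
    refine ⟨c⁻¹ * ((P.r ^ 2)⁻¹ * ((n : ℤ) * ((n : ℤ) + 1) + P.zeta ^ 2)), by positivity, ?_⟩
    rw [ofReal_mul, ← hk, h, ofReal_inv, inv_mul_cancel_left₀ (by exact_mod_cast hc.ne')]
  | pred n ih =>
    obtain ⟨c, hc, h⟩ := ih
    have hk := key (-n - 1)
    have hq := quad_pos P (-n - 1)
    rw [sub_add_cancel] at hk
    refine ⟨c⁻¹ * ((P.r ^ 2)⁻¹ * (((-n - 1 : ℤ) : ℝ) * (((-n - 1 : ℤ) : ℝ) + 1) + P.zeta ^ 2)),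
      by positivity, ?_⟩
    rw [ofReal_mul, ← hk, h, ofReal_inv, mul_comm (omegaTilde P _),
      inv_mul_cancel_left₀ (by exact_mod_cast hc.ne')]

/-- The multiplier `ω̃(k)` as a real number. -/
def omegaReal (k : ℤ) : ℝ := (omegaTilde P k).re

theorem omegaTilde_eq (k : ℤ) : omegaTilde P k = omegaReal P k := by
  obtain ⟨c, -, h⟩ := omegaTilde_pos P k
  rw [omegaReal, h, ofReal_re]

theorem omegaReal_pos (k : ℤ) : 0 < omegaReal P k := by
  obtain ⟨c, hc, h⟩ := omegaTilde_pos P k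
  rwa [omegaReal, h, ofReal_re]

theorem omegaReal_mul_succ (k : ℤ) : P.r ^ 2 * (omegaReal P k * omegaReal P (k + 1)) =
    k * (k + 1) + P.zeta ^ 2 := by
  have h := omegaTilde_mul_succ P k
  have hr := P.r_ne_zero
  rw [omegaTilde_eq, omegaTilde_eq] at h
  have h2 : (P.r : ℂ) ^ 2 * (omegaReal P k * omegaReal P (k + 1)) =
      k * (k + 1) + (P.zeta : ℂ) ^ 2 := by
    rw [h, Params.zeta]; push_cast; field_simp
  exact_mod_cast h2

/-! ### Asymptotics of ω̃ -/

/-- The product in the denominator of Gauss's sequence is Γ(s+n+1)/Γ(s). This turns Gauss's limit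
formula into the asymptotics of Γ(s+n+1). -/
theorem Gamma_add_nat_mul_GammaSeq {s : ℂ} (hs : ∀ m : ℕ, s + m ≠ 0) (n : ℕ) :
    Gamma (s + (n + 1 : ℕ)) * GammaSeq s n = Gamma s * ((n : ℂ) ^ s * n.factorial) := by
  have h : ∀ N : ℕ, Gamma (s + N) = Gamma s * ∏ j ∈ Finset.range N, (s + j) := by
    intro N
    induction N with
    | zero => simp
    | succ N ih =>
      rw [Finset.prod_range_succ, ← mul_assoc, ← ih, mul_comm, ← Gamma_add_one _ (hs N)]
      congr 1; push_cast; ring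
  rw [h, GammaSeq]
  have : ∏ j ∈ Finset.range (n + 1), (s + j) ≠ 0 := Finset.prod_ne_zero_iff.2 fun j _ => hs j
  field_simp

/-- For even k the Gamma arguments are fixed numbers plus an integer. The powers of n in Gauss's
formula cancel because s/2 + (1-s)/2 = -s/2 + (1+s)/2. -/
theorem tendsto_omegaTilde_even : Filter.Tendsto
    (fun n : ℕ => P.r * omegaTilde P (2 * (n + 1 : ℕ)) / ((2 * (n + 1 : ℕ) : ℤ) + P.sPlus))
    Filter.atTop (nhds 1) := by
  set s := P.sPlus with hs
  have n1 : ∀ m : ℕ, s / 2 + m ≠ 0 := fun m h => int_add_sPlus_ne_zero P (2 * m) (by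
    push_cast; linear_combination 2 * h)
  have n2 : ∀ m : ℕ, (1 - s) / 2 + m ≠ 0 := fun m h => int_sub_sPlus_ne_zero P (2 * m + 1) (by
    push_cast; linear_combination 2 * h)
  have n3 : ∀ m : ℕ, -s / 2 + m ≠ 0 := fun m h => int_sub_sPlus_ne_zero P (2 * m) (by
    push_cast; linear_combination 2 * h)
  have n4 : ∀ m : ℕ, (1 + s) / 2 + m ≠ 0 := fun m h => int_add_sPlus_ne_zero P (2 * m + 1) (by
    push_cast; linear_combination 2 * h)
  have g : ∀ {z : ℂ}, (∀ m : ℕ, z + m ≠ 0) → Gamma z ≠ 0 := fun h =>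
    Gamma_ne_zero fun m hm => h m (by rw [hm]; ring)
  have t := ((GammaSeq_tendsto_Gamma (-s / 2)).mul (GammaSeq_tendsto_Gamma ((1 + s) / 2))).div
    ((GammaSeq_tendsto_Gamma (s / 2)).mul (GammaSeq_tendsto_Gamma ((1 - s) / 2)))
    (mul_ne_zero (g n1) (g n2))
  have t2 := t.const_mul (Gamma (s / 2) * Gamma ((1 - s) / 2) /
    (Gamma (-s / 2) * Gamma ((1 + s) / 2)))
  have e : Gamma (s / 2) * Gamma ((1 - s) / 2) / (Gamma (-s / 2) * Gamma ((1 + s) / 2)) *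
      (Gamma (-s / 2) * Gamma ((1 + s) / 2) / (Gamma (s / 2) * Gamma ((1 - s) / 2))) = 1 := by
    exact div_mul_div_cancel₀ (mul_ne_zero (g n3) (g n4)) |>.trans
      (div_self (mul_ne_zero (g n1) (g n2)))
  rw [e] at t2
  refine t2.congr' ?_
  filter_upwards [Filter.eventually_gt_atTop 0] with n hn
  have hn0 : (n : ℂ) ≠ 0 := by exact_mod_cast hn.ne'
  have f1 := Gamma_add_nat_mul_GammaSeq n1 n
  have f2 := Gamma_add_nat_mul_GammaSeq n2 n
  have f3 := Gamma_add_nat_mul_GammaSeq n3 n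
  have f4 := Gamma_add_nat_mul_GammaSeq n4 n
  have hfac : (n.factorial : ℂ) ≠ 0 := by exact_mod_cast n.factorial_ne_zero
  have hp : (n : ℂ) ^ (s / 2) * (n : ℂ) ^ ((1 - s) / 2) =
      (n : ℂ) ^ (-s / 2) * (n : ℂ) ^ ((1 + s) / 2) := by
    rw [← cpow_add _ _ hn0, ← cpow_add _ _ hn0]
    congr 1; ring
  have q : ∀ {z : ℂ}, (∀ m : ℕ, z + m ≠ 0) → GammaSeq z n ≠ 0 ∧ Gamma (z + (n + 1 : ℕ)) ≠ 0 := by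
    intro z hz
    have h := Gamma_add_nat_mul_GammaSeq hz n
    have : Gamma z * ((n : ℂ) ^ z * n.factorial) ≠ 0 :=
      mul_ne_zero (g hz) (mul_ne_zero (by simp [cpow_eq_zero_iff, hn0]) hfac)
    rw [← h] at this
    exact ⟨right_ne_zero_of_mul this, left_ne_zero_of_mul this⟩
  have hk := int_add_sPlus_ne_zero P (2 * (n + 1 : ℕ))
  have hr := P.r_ne_zero
  rw [← hs] at hk
  have hw : P.r * omegaTilde P (2 * (n + 1 : ℕ)) / ((2 * (n + 1 : ℕ) : ℤ) + s) =
      Gamma (s / 2 + (n + 1 : ℕ)) * Gamma ((1 - s) / 2 + (n + 1 : ℕ)) /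
      (Gamma (-s / 2 + (n + 1 : ℕ)) * Gamma ((1 + s) / 2 + (n + 1 : ℕ))) := by
    unfold omegaTilde
    rw [← hs]
    rw [show (((2 * (n + 1 : ℕ) : ℤ) : ℂ) + s) / 2 = s / 2 + (n + 1 : ℕ) by push_cast; ring,
      show (((2 * (n + 1 : ℕ) : ℤ) : ℂ) - s) / 2 = -s / 2 + (n + 1 : ℕ) by push_cast; ring,
      show (((2 * (n + 1 : ℕ) : ℤ) : ℂ) + 1 - s) / 2 = (1 - s) / 2 + (n + 1 : ℕ) by
        push_cast; ring,
      show (((2 * (n + 1 : ℕ) : ℤ) : ℂ) + 1 + s) / 2 = (1 + s) / 2 + (n + 1 : ℕ) by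
        push_cast; ring]
    have := (q n3).2
    have := (q n4).2
    field_simp
  rw [hw]
  have := q n1; have := q n2; have := q n3; have := q n4
  have := g n3; have := g n4
  simp only [Pi.div_apply]
  rw [div_mul_div_comm, div_eq_div_iff (by simp_all) (by simp_all)]
  generalize Gamma (s / 2 + (n + 1 : ℕ)) = A1 at *
  generalize Gamma ((1 - s) / 2 + (n + 1 : ℕ)) = A2 at *
  generalize Gamma (-s / 2 + (n + 1 : ℕ)) = A3 at *
  generalize Gamma ((1 + s) / 2 + (n + 1 : ℕ)) = A4 at *
  set p1 := (n : ℂ) ^ (s / 2)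
  set p2 := (n : ℂ) ^ ((1 - s) / 2)
  set p3 := (n : ℂ) ^ (-s / 2)
  set p4 := (n : ℂ) ^ ((1 + s) / 2)
  set F := (n.factorial : ℂ)
  have hpf : p3 * F * (p4 * F) ≠ 0 := by
    have : p3 ≠ 0 := by simp [p3, cpow_eq_zero_iff, hn0]
    have : p4 ≠ 0 := by simp [p4, cpow_eq_zero_iff, hn0]
    simp_all
  apply mul_right_cancel₀ hpf
  calc _ = Gamma (s / 2) * Gamma ((1 - s) / 2) * (A3 * GammaSeq (-s / 2) n) *
        (A4 * GammaSeq ((1 + s) / 2) n) * (p3 * F * (p4 * F)) := by ring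
    _ = Gamma (-s / 2) * Gamma ((1 + s) / 2) * (Gamma (s / 2) * (p3 * F)) *
        (Gamma ((1 - s) / 2) * (p4 * F)) * (p3 * F * (p4 * F)) := by rw [f3, f4]; ring
    _ = Gamma (-s / 2) * Gamma ((1 + s) / 2) * (Gamma (s / 2) * (p1 * F)) *
        (Gamma ((1 - s) / 2) * (p2 * F)) * (p3 * F * (p4 * F)) := by
          linear_combination -(Gamma (-s / 2) * Gamma ((1 + s) / 2) * Gamma (s / 2) *
            Gamma ((1 - s) / 2) * F ^ 2 * (p3 * F * (p4 * F))) * hp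
    _ = _ := by rw [← f1, ← f2]; ring

/-- By the product formula the ratio is (k-s)(k+1+s) / (r ω̃(k))², and r ω̃(k) is asymptotic to k+s
along even k. -/
theorem tendsto_omegaReal_succ_div : Filter.Tendsto
    (fun n : ℕ => omegaReal P (2 * (n + 1 : ℕ) + 1) / omegaReal P (2 * (n + 1 : ℕ)))
    Filter.atTop (nhds 1) := by
  have hr := P.r_ne_zero
  set s := P.sPlus with hs
  have hinf : Filter.Tendsto (fun n : ℕ => ((2 * (n + 1 : ℕ) : ℤ) : ℂ)⁻¹)
      Filter.atTop (nhds 0) := by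
    have := (tendsto_one_div_add_atTop_nhds_zero_nat (𝕜 := ℂ)).const_mul (2⁻¹ : ℂ)
    rw [mul_zero] at this
    refine this.congr fun n => ?_
    have : (n : ℂ) + 1 ≠ 0 := by exact_mod_cast n.succ_ne_zero
    push_cast; field_simp
  -- The same ratio with powers of k divided out, so that each factor has a limit.
  have hq : Filter.Tendsto (fun n : ℕ => (1 - s * ((2 * (n + 1 : ℕ) : ℤ) : ℂ)⁻¹) *
      (1 + (1 + s) * ((2 * (n + 1 : ℕ) : ℤ) : ℂ)⁻¹) /
      (1 + s * ((2 * (n + 1 : ℕ) : ℤ) : ℂ)⁻¹) ^ 2 / (P.r * omegaTilde P (2 * (n + 1 : ℕ)) /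
        ((2 * (n + 1 : ℕ) : ℤ) + s)) ^ 2) Filter.atTop (nhds 1) := by
    have h1 := (hinf.const_mul s).const_sub 1
    have h2 := (hinf.const_mul (1 + s)).const_add 1
    have h3 := (hinf.const_mul s).const_add 1
    simp only [mul_zero, sub_zero, add_zero] at h1 h2 h3
    have := ((h1.mul h2).div (h3.pow 2) (by simp)).div ((tendsto_omegaTilde_even P).pow 2)
      (by simp)
    rw [one_pow, mul_one, div_one, div_one] at this
    exact this
  have hC : Filter.Tendsto (fun n : ℕ =>
      ((omegaReal P (2 * (n + 1 : ℕ) + 1) / omegaReal P (2 * (n + 1 : ℕ)) : ℝ) : ℂ))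
      Filter.atTop (nhds 1) := by
    refine hq.congr fun n => ?_
    have hk := int_add_sPlus_ne_zero P (2 * (n + 1 : ℕ))
    have h := omegaReal_mul_succ P (2 * (n + 1 : ℕ))
    have hw := omegaReal_pos P (2 * (n + 1 : ℕ))
    rw [omegaTilde_eq]
    rw [← hs] at hk
    have hsz : -s * (s + 1) = (P.zeta : ℂ) ^ 2 := P.sPlus_eq
    have hk0 : ((2 * (n + 1 : ℕ) : ℤ) : ℂ) ≠ 0 := by
      have : (2 * (n + 1 : ℕ) : ℤ) ≠ 0 := by omega
      exact_mod_cast this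
    generalize (2 * (n + 1 : ℕ) : ℤ) = k at *
    have hC : (P.r : ℂ) ^ 2 * (omegaReal P k * omegaReal P (k + 1)) =
        k * (k + 1) + (P.zeta : ℂ) ^ 2 := by exact_mod_cast h
    have hw0 : (omegaReal P k : ℂ) ≠ 0 := by exact_mod_cast hw.ne'
    push_cast
    have a1 : 1 + s * (k : ℂ)⁻¹ ≠ 0 := by
      intro h0
      apply hk
      field_simp at h0
      rw [h0, mul_zero]
    have a2 : 1 + s * (k : ℂ)⁻¹ = (k + s) * (k : ℂ)⁻¹ := by field_simp
    rw [a2]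
    field_simp
    rw [← hsz] at hC
    linear_combination -hC
  exact (Complex.continuous_re.tendsto _).comp hC

/-! ### The Fourier coefficients of the kernel are proportional to 1/ω̃ -/

/-- Both quadratic factors in `legendreCoeff_recurrence` are products of two neighbouring values of
ω̃, with the common factor r² ω̃(m). -/
theorem legendreCoeff_mul_omegaReal_two (m : ℤ) :
    legendreCoeff P (m + 1) * omegaReal P (m + 1) =
      legendreCoeff P (m - 1) * omegaReal P (m - 1) := by
  have h1 := legendreCoeff_recurrence P m
  have h2 := omegaReal_mul_succ P m
  have h3 := omegaReal_mul_succ P (m - 1)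
  rw [sub_add_cancel] at h3
  have hm := omegaReal_pos P m
  have hr := P.r_pos
  have hq := quad_pos P m
  have hq' := quad_pos P (m - 1)
  push_cast at h3
  rw [show ((m : ℝ) * (m - 1) + P.zeta ^ 2) = P.r ^ 2 * (omegaReal P (m - 1) * omegaReal P m) by
    rw [h3]; ring, ← h2] at h1
  have hne : P.r ^ 2 * omegaReal P m ≠ 0 := by positivity
  apply mul_left_cancel₀ hne
  linear_combination h1

/-- The two-step relation leaves one constant for even and one for odd indices. Their quotient is
the limit of (λ_{k+1}/λ_k)(ω̃(k+1)/ω̃(k)) along even k, and both factors tend to 1. -/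
theorem legendreCoeff_mul_omegaReal_succ (k : ℤ) :
    legendreCoeff P (k + 1) * omegaReal P (k + 1) = legendreCoeff P k * omegaReal P k := by
  have heven : ∀ n : ℕ, legendreCoeff P (2 * n) * omegaReal P (2 * n) =
      legendreCoeff P 0 * omegaReal P 0 := by
    intro n
    induction n with
    | zero => simp
    | succ n ih =>
      have := legendreCoeff_mul_omegaReal_two P (2 * n + 1)
      rw [add_sub_cancel_right, ih] at this
      rw [← this]; congr 2
  have hodd : ∀ n : ℕ, legendreCoeff P (2 * n + 1) * omegaReal P (2 * n + 1) =
      legendreCoeff P 1 * omegaReal P 1 := by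
    intro n
    induction n with
    | zero => simp
    | succ n ih =>
      have := legendreCoeff_mul_omegaReal_two P (2 * n + 2)
      rw [show (2 * n + 2 - 1 : ℤ) = 2 * n + 1 by ring, ih] at this
      rw [← this]; congr 2
  have hM : Filter.Tendsto (fun n : ℕ => legendreCoeff P (2 * (n + 1 : ℕ) + 1) /
      legendreCoeff P (2 * (n + 1 : ℕ))) Filter.atTop (nhds 1) := by
    -- For k = 2(n+1), monotonicity and the recurrence give λ_{k+1} ≥ λ_{k+2} = (k(k+1)+ζ²) /
    -- ((k+1)(k+2)+ζ²) · λ_k, and this is at least n/(n+1) · λ_k.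
    have hlow : Filter.Tendsto (fun n : ℕ => 1 - 1 / ((n : ℝ) + 1)) Filter.atTop (nhds 1) := by
      simpa using (tendsto_one_div_add_atTop_nhds_zero_nat (𝕜 := ℝ)).const_sub 1
    refine tendsto_of_tendsto_of_tendsto_of_le_of_le hlow tendsto_const_nhds (fun n => ?_)
      fun n => ?_
    · have h1 := legendreCoeff_succ_le P (by positivity : (0 : ℤ) ≤ 2 * (n + 1 : ℕ) + 1)
      have h2 := legendreCoeff_recurrence P (2 * (n + 1 : ℕ) + 1)
      have h3 := legendreCoeff_pos P (2 * (n + 1 : ℕ))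
      have h4 := legendreCoeff_pos P (2 * (n + 1 : ℕ) + 1 + 1)
      rw [add_sub_cancel_right] at h2
      refine le_trans ?_ (div_le_div_of_nonneg_right h1 h3.le)
      push_cast at h2 h3 h4 ⊢
      rw [le_div_iff₀ h3]
      set A := legendreCoeff P (2 * (n + 1))
      set B := legendreCoeff P (2 * (n + 1) + 1 + 1)
      have hn : (0 : ℝ) ≤ n := by positivity
      have hz := sq_nonneg P.zeta
      have hx : (1 - 1 / ((n : ℝ) + 1)) = n / (n + 1) := by field_simp; ring
      have hB : B = ((2 * (n + 1) + 1) * (2 * ((n : ℝ) + 1)) + P.zeta ^ 2) * A /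
          ((2 * (n + 1) + 1) * (2 * (n + 1) + 1 + 1) + P.zeta ^ 2) := by
        rw [eq_div_iff (by positivity)]; linarith
      rw [hx, hB, mul_comm ((_ + _ : ℝ)) A, mul_comm _ A, mul_div_assoc]
      refine mul_le_mul_of_nonneg_left ?_ h3.le
      rw [div_le_div_iff₀ (by positivity) (by positivity)]
      nlinarith [mul_nonneg hn hn, mul_nonneg hn hz]
    · have h1 := legendreCoeff_succ_le P (by positivity : (0 : ℤ) ≤ 2 * (n + 1 : ℕ))
      exact div_le_one_of_le₀ h1 (legendreCoeff_pos P _).le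
  have hlim := hM.mul (tendsto_omegaReal_succ_div P)
  have hconst : ∀ n : ℕ, legendreCoeff P (2 * (n + 1 : ℕ) + 1) /
      legendreCoeff P (2 * (n + 1 : ℕ)) *
      (omegaReal P (2 * (n + 1 : ℕ) + 1) / omegaReal P (2 * (n + 1 : ℕ))) =
      (legendreCoeff P 1 * omegaReal P 1) / (legendreCoeff P 0 * omegaReal P 0) := fun n => by
    rw [div_mul_div_comm, heven, hodd]
  simp only [hconst, mul_one] at hlim
  have h01 := tendsto_nhds_unique hlim tendsto_const_nhds
  have h0 : legendreCoeff P 0 * omegaReal P 0 ≠ 0 :=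
    (mul_pos (legendreCoeff_pos P 0) (omegaReal_pos P 0)).ne'
  rw [eq_comm, div_eq_one_iff_eq h0] at h01
  induction k using Int.induction_on with
  | zero => simpa using h01
  | succ n ih =>
    have := legendreCoeff_mul_omegaReal_two P (n + 1)
    rw [this, add_sub_cancel_right, ← ih]
  | pred n ih =>
    have := legendreCoeff_mul_omegaReal_two P (-n)
    rw [sub_add_cancel, ← this, ← ih]

theorem legendreCoeff_mul_omegaReal (k : ℤ) :
    legendreCoeff P k * omegaReal P k = legendreCoeff P 0 * omegaReal P 0 := by
  induction k using Int.induction_on with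
  | zero => rfl
  | succ n ih => rw [legendreCoeff_mul_omegaReal_succ, ih]
  | pred n ih =>
    rw [← ih, ← legendreCoeff_mul_omegaReal_succ P (-n - 1), sub_add_cancel]

/-! ### One-parameter unitary groups -/

section UnitaryGroup

variable {H : Type*} [NormedAddCommGroup H] [InnerProductSpace ℂ H]
  {V V' : ℝ → H ≃ₗᵢ[ℂ] H} {x y x' y' : H}

theorem GeneratorRel.add (h : GeneratorRel V x y) (h' : GeneratorRel V x' y') :
    GeneratorRel V (x + x') (y + y') := by
  unfold GeneratorRel at *
  simpa only [map_add, smul_add] using HasDerivAt.fun_add h h'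

theorem GeneratorRel.smul (c : ℂ) (h : GeneratorRel V x y) :
    GeneratorRel V (c • x) (c • y) := by
  unfold GeneratorRel at *
  simpa only [map_smul, smul_comm c I] using HasDerivAt.fun_const_smul c h

theorem GeneratorRel.sub (h : GeneratorRel V x y) (h' : GeneratorRel V x' y') :
    GeneratorRel V (x - x') (y - y') := by
  simpa [sub_eq_add_neg] using h.add (h'.smul (-1))

/-- Symmetry of the generator: differentiate the constant function t ↦ ⟨V(t)x, V(t)x'⟩ at 0. -/
theorem GeneratorRel.inner_comm (h : GeneratorRel V x y) (h' : GeneratorRel V x' y')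
    (h0 : V 0 = 1) : inner ℂ x y' = inner ℂ y x' := by
  have hd := HasDerivAt.inner ℂ h h'
  simp only [LinearIsometryEquiv.inner_map_map, h0, LinearIsometryEquiv.coe_one, id] at hd
  have h2 := hd.unique (hasDerivAt_const (0 : ℝ) (inner ℂ x x'))
  rw [inner_smul_right, inner_smul_left, conj_I] at h2
  apply mul_left_cancel₀ I_ne_zero
  linear_combination h2

theorem GeneratorRel.hasDerivAt (h : GeneratorRel V x y) (hadd : ∀ s t, V (s + t) = V s * V t)
    (t : ℝ) : HasDerivAt (fun t => V t x) (I • V t y) t := by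
  have h1 : HasDerivAt (fun s => V (s - t) x) (I • y) t := by
    have : HasDerivAt (fun s : ℝ => s - t) 1 t := (hasDerivAt_id t).sub_const t
    have h0 : HasDerivAt (fun t => V t x) (I • y) (t - t) := by rw [sub_self]; exact h
    have h2 := HasDerivAt.scomp (h := fun s => s - t) t h0 this
    rwa [one_smul] at h2
  have h2 := ((V t).toContinuousLinearEquiv.toContinuousLinearMap.hasFDerivAt
    (x := V (t - t) x)).restrictScalars ℝ |>.comp_hasDerivAt t h1
  rw [← map_smul]
  refine h2.congr_of_eventuallyEq (Filter.Eventually.of_forall fun s => ?_)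
  change V s x = (V t * V (s - t)) x
  rw [← hadd, add_sub_cancel]

theorem GeneratorRel.map (h : GeneratorRel V x y) (hadd : ∀ s t, V (s + t) = V s * V t)
    (t : ℝ) : GeneratorRel V (V t x) (V t y) := by
  have h1 := h.hasDerivAt hadd t
  unfold GeneratorRel
  have : HasDerivAt (fun s : ℝ => s + t) 1 0 := (hasDerivAt_id 0).add_const t
  have h2 : HasDerivAt (fun t => V t x) (I • V t y) (0 + t) := by rwa [zero_add]
  have h3 := h2.scomp (0 : ℝ) this
  rw [one_smul] at h3
  refine h3.congr_of_eventuallyEq (Filter.Eventually.of_forall fun s => ?_)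
  change (V s * V t) x = V (s + t) x
  rw [hadd]

/-- The graph of the generator. -/
def generatorGraph (V : ℝ → H ≃ₗᵢ[ℂ] H) : Submodule ℂ (H × H) where
  carrier := {p | GeneratorRel V p.1 p.2}
  zero_mem' := by
    change HasDerivAt (fun t => V t 0) (I • (0 : H)) 0
    simpa using hasDerivAt_const (0 : ℝ) (0 : H)
  add_mem' h h' := h.add h'
  smul_mem' c _ h := h.smul c

/-- Differentiable orbits are continuous, the operators are isometries, so continuity at 0 passes
from a dense set to all vectors; the group law moves it to every t. -/
theorem continuous_of_dense_generator (hadd : ∀ s t, V (s + t) = V s * V t)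
    {s : Set H} (hs : ∀ x ∈ s, ∃ y, GeneratorRel V x y)
    (hd : Dense (Submodule.span ℂ s : Set H)) (x : H) : Continuous fun t => V t x := by
  have hspan : ∀ x ∈ Submodule.span ℂ s, ∃ y, GeneratorRel V x y := by
    intro x hx
    induction hx using Submodule.span_induction with
    | mem x hx => exact hs x hx
    | zero => exact ⟨0, (generatorGraph V).zero_mem⟩
    | add x x' _ _ h h' =>
      obtain ⟨y, hy⟩ := h
      obtain ⟨y', hy'⟩ := h'
      exact ⟨_, hy.add hy'⟩
    | smul c x _ h =>
      obtain ⟨y, hy⟩ := h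
      exact ⟨_, hy.smul c⟩
  have key : ∀ x, ContinuousAt (fun t => V t x) 0 := by
    intro x
    rw [Metric.continuousAt_iff]
    intro ε hε
    obtain ⟨u, hu, hxu⟩ := Metric.dense_iff.1 hd x (ε / 3) (by positivity)
    rw [Metric.mem_ball] at hu
    obtain ⟨y, hy⟩ := hspan u hxu
    obtain ⟨δ, hδ, h⟩ := Metric.continuousAt_iff.1 hy.continuousAt (ε / 3) (by positivity)
    refine ⟨δ, hδ, fun {t} ht => ?_⟩
    calc dist (V t x) (V 0 x)
        ≤ dist (V t x) (V t u) + dist (V t u) (V 0 u) + dist (V 0 u) (V 0 x) :=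
          dist_triangle4 _ _ _ _
      _ < ε := by
        have := h ht
        rw [LinearIsometryEquiv.dist_map, LinearIsometryEquiv.dist_map, dist_comm x u]
        linarith
  rw [continuous_iff_continuousAt]
  intro t
  have h1 : ContinuousAt (fun s => V t (V (s - t) x)) t := by
    refine (V t).continuous.continuousAt.comp (f := fun s => V (s - t) x) ?_
    have := key x
    rw [← sub_self t] at this
    exact this.comp (f := fun s => s - t) (continuous_id.sub continuous_const).continuousAt
  refine h1.congr (Filter.Eventually.of_forall fun s => ?_)
  change (V t * V (s - t)) x = V s x
  rw [← hadd, add_sub_cancel]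

/-- For (u, v) in the graph, the mean value inequality bounds V(t)u - u - itv by |t| times the
supremum of ‖V(s)v - v‖. Near a limit point (x, y) this supremum is at most ε + 2‖v-y‖ on an
interval that depends on y only. The resulting bound is a closed condition on (u, v), hence it holds
at (x, y). -/
theorem isClosed_generatorGraph (h0 : V 0 = 1) (hadd : ∀ s t, V (s + t) = V s * V t)
    (hc : ∀ x, Continuous fun t => V t x) : IsClosed (generatorGraph V : Set (H × H)) := by
  refine isClosed_of_closure_subset fun p hp => ?_
  obtain ⟨x, y⟩ := p
  change HasDerivAt (fun t => V t x) (I • y) 0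
  rw [hasDerivAt_iff_isLittleO, Asymptotics.isLittleO_iff]
  intro ε hε
  obtain ⟨δ, hδ, h⟩ := Metric.continuousAt_iff.1 ((hc y).continuousAt (x := 0)) ε hε
  filter_upwards [Metric.ball_mem_nhds (0 : ℝ) hδ] with t ht
  have hclosed : IsClosed {p : H × H |
      ‖V t p.1 - p.1 - t • I • p.2‖ ≤ (ε + 2 * ‖p.2 - y‖) * ‖t‖} := by
    refine isClosed_le ?_ (by fun_prop)
    have := (V t).continuous
    fun_prop
  have hsub : (generatorGraph V : Set (H × H)) ⊆ {p : H × H |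
      ‖V t p.1 - p.1 - t • I • p.2‖ ≤ (ε + 2 * ‖p.2 - y‖) * ‖t‖} := by
    rintro ⟨u, v⟩ huv
    have huv : GeneratorRel V u v := huv
    have hder : ∀ s ∈ Metric.ball (0 : ℝ) δ,
        HasDerivWithinAt (fun s => V s u - s • I • v) (I • V s v - I • v) (Metric.ball 0 δ) s := by
      intro s _
      have h1 : HasDerivAt (fun s : ℝ => s • I • v) (I • v) s := by
        simpa using (hasDerivAt_id s).smul_const (I • v)
      exact ((huv.hasDerivAt hadd s).sub h1).hasDerivWithinAt
    have hbound : ∀ s ∈ Metric.ball (0 : ℝ) δ, ‖I • V s v - I • v‖ ≤ ε + 2 * ‖v - y‖ := by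
      intro s hs
      have h1 := h hs
      rw [h0] at h1
      change dist (V s y) y < ε at h1
      rw [dist_eq_norm] at h1
      rw [← smul_sub, norm_smul, norm_I, one_mul]
      calc ‖V s v - v‖ = ‖V s (v - y) + (V s y - y) - (v - y)‖ := by
            rw [map_sub]; congr 1; abel
        _ ≤ ‖V s (v - y)‖ + ‖V s y - y‖ + ‖v - y‖ :=
            (norm_sub_le _ _).trans (add_le_add_left (norm_add_le _ _) _)
        _ ≤ ε + 2 * ‖v - y‖ := by
            rw [LinearIsometryEquiv.norm_map]; linarith
    have := (convex_ball (0 : ℝ) δ).norm_image_sub_le_of_norm_hasDerivWithin_le hder hbound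
      (Metric.mem_ball_self hδ) ht
    rw [h0, zero_smul, sub_zero, sub_zero] at this
    change ‖V t u - u - t • I • v‖ ≤ _
    convert this using 2
    change _ = _ - u
    abel
  have := closure_minimal hsub hclosed hp
  simp only [Set.mem_ofPred_eq, sub_self, norm_zero, mul_zero, add_zero] at this
  rw [h0, sub_zero]
  exact this

/-- For x in the domain of A, the difference of the two orbits stays in the domain, and symmetry of
A makes its norm constant, hence zero. -/
theorem IsExpI.unique [CompleteSpace H] {A : H →ₗ.[ℂ] H} (h : IsExpI A V) (h' : IsExpI A V') :
    V = V' := by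
  funext t
  ext x
  have hdense : Dense (A.domain : Set H) := IsSelfAdjoint.dense_domain h.selfAdjoint
  have hclosed : IsClosed {x | V t x = V' t x} :=
    isClosed_eq (V t).continuous (V' t).continuous
  refine hclosed.closure_subset_iff.2 ?_ (hdense x)
  intro x hx
  set y := A ⟨x, hx⟩
  have hxy : (x, y) ∈ A.graph := A.mem_graph ⟨x, hx⟩
  have hV := (h.generator x y).1 hxy
  have hV' := (h'.generator x y).1 hxy
  set w : ℝ → H := fun t => V t x - V' t x
  have hw : ∀ t, HasDerivAt w (I • (V t y - V' t y)) t := fun t => by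
    rw [smul_sub]
    exact (hV.hasDerivAt h.map_add t).sub (hV'.hasDerivAt h'.map_add t)
  have hz : ∀ t, inner ℂ (w t) (V t y - V' t y) = inner ℂ (V t y - V' t y) (w t) := by
    intro t
    have h1 := hV.map h.map_add t
    -- The vectors V'(t)x lie in the domain of A, so they can be read as elements of the generator
    -- of V.
    have h2 := (h.generator _ _).1 ((h'.generator _ _).2 (hV'.map h'.map_add t))
    exact (h1.sub h2).inner_comm (h1.sub h2) h.map_zero
  have hd : ∀ t, HasDerivAt (fun t => inner ℂ (w t) (w t)) 0 t := fun t => by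
    have := (hw t).inner ℂ (hw t)
    rwa [inner_smul_right, inner_smul_left, hz t, conj_I, neg_mul, add_neg_cancel] at this
  have hconst := is_const_of_deriv_eq_zero (fun t => (hd t).differentiableAt)
    (fun t => (hd t).deriv) t 0
  have hw0 : w 0 = 0 := by simp [w, h.map_zero, h'.map_zero]
  simp only [hw0, inner_zero_left, inner_self_eq_zero] at hconst
  exact sub_eq_zero.1 hconst

end UnitaryGroup

/-! ### Jacobi operators -/

section Jacobi

variable {H : Type*} [NormedAddCommGroup H] [InnerProductSpace ℂ H]
  (f : HilbertBasis ℤ ℂ H) (b : ℤ → ℝ) (α : ℤ → ℂ)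

/-- `y = A x` for the maximal operator `A` of a Hermitian tridiagonal matrix. -/
def JacobiRel (x y : H) : Prop := ∀ k, f.repr y k =
  b k * f.repr x k + α (k - 1) * f.repr x (k - 1) + conj (α k) * f.repr x (k + 1)

/-- The image of the `k`-th basis vector. -/
def jacobiBasis (k : ℤ) : H :=
  (b k : ℂ) • f k + α k • f (k + 1) + conj (α (k - 1)) • f (k - 1)

/-- The maximal operator is the adjoint of the matrix on the basis vectors. In this form the
relation is visibly linear and closed. -/
theorem jacobiRel_iff {x y : H} :
    JacobiRel f b α x y ↔ ∀ k, inner ℂ (f k) y = inner ℂ (jacobiBasis f b α k) x := by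
  refine forall_congr' fun k => ?_
  rw [jacobiBasis, inner_add_left, inner_add_left, inner_smul_left, inner_smul_left,
    inner_smul_left, conj_ofReal, conj_conj]
  simp only [HilbertBasis.repr_apply_apply]
  rw [add_right_comm]

/-- The graph of the maximal operator. -/
def jacobiGraph : Submodule ℂ (H × H) where
  carrier := {p | JacobiRel f b α p.1 p.2}
  zero_mem' k := by simp
  add_mem' h h' := (jacobiRel_iff f b α).2 fun k => by
    simp only [Prod.fst_add, Prod.snd_add, inner_add_right]
    rw [(jacobiRel_iff f b α).1 h k, (jacobiRel_iff f b α).1 h' k]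
  smul_mem' c _ h := (jacobiRel_iff f b α).2 fun k => by
    simp only [Prod.smul_fst, Prod.smul_snd, inner_smul_right]
    rw [(jacobiRel_iff f b α).1 h k]

theorem isClosed_jacobiGraph : IsClosed (jacobiGraph f b α : Set (H × H)) := by
  have : (jacobiGraph f b α : Set (H × H)) =
      ⋂ k, {p | inner ℂ (f k) p.2 = inner ℂ (jacobiBasis f b α k) p.1} := by
    ext p
    rw [Set.mem_iInter]
    exact jacobiRel_iff f b α
  rw [this]
  exact isClosed_iInter fun k => isClosed_eq (by fun_prop) (by fun_prop)

variable {f b α}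

theorem JacobiRel.unique {x y y' : H} (h : JacobiRel f b α x y) (h' : JacobiRel f b α x y') :
    y = y' := by
  apply f.repr.injective
  ext k
  rw [h k, h' k]

theorem jacobiRel_basis (k : ℤ) : JacobiRel f b α (f k) (jacobiBasis f b α k) := by
  classical
  intro j
  simp only [jacobiBasis, map_add, map_smul, HilbertBasis.repr_self, lp.coeFn_add, lp.coeFn_smul,
    Pi.add_apply, Pi.smul_apply, lp.single_apply, Pi.single_apply, smul_eq_mul]
  rcases eq_or_ne j k with rfl | h1
  · simp [show ¬ j = j - 1 by omega]
  · rcases eq_or_ne j (k + 1) with rfl | h2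
    · simp [show ¬ k + 1 = k - 1 by omega, show ¬ k + 1 + 1 = k by omega]
    · rcases eq_or_ne j (k - 1) with rfl | h3
      · simp [show ¬ k - 1 = k + 1 by omega, show ¬ k - 1 - 1 = k by omega]
      · simp [h1, h2, h3, show ¬ j - 1 = k by omega, show ¬ j + 1 = k by omega]

/-- The maximal operator of a Hermitian tridiagonal matrix whose entries grow at most linearly off
the diagonal is symmetric (Carleman). -/
theorem JacobiRel.inner_comm {C : ℝ} (hα : ∀ k, ‖α k‖ ≤ C * (1 + |(k : ℝ)|)) {x y x' y' : H}
    (h : JacobiRel f b α x y) (h' : JacobiRel f b α x' y') : inner ℂ x y' = inner ℂ y x' := by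
  set u : ℤ → ℂ := fun k => f.repr x k with hu
  set u' : ℤ → ℂ := fun k => f.repr x' k with hu'
  -- The boundary term of the discrete Green formula at the edge between k and k+1: the k-th
  -- contribution to ⟨x, y'⟩ - ⟨y, x'⟩ is T(k-1) - T(k).
  set T : ℤ → ℂ := fun k => α k * (conj (u (k + 1)) * u' k) - conj (α k) * (conj (u k) * u' (k + 1))
    with hT
  have hsq : ∀ z : H, Summable fun k => ‖f.repr z k‖ ^ 2 := fun z => by
    have := (f.repr z).2.summable (by norm_num)
    simpa using this
  have hshift : Summable fun k => ‖u (k + 1)‖ ^ 2 := (hsq x).comp_injective (add_left_injective 1)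
  have hshift' : Summable fun k => ‖u' (k + 1)‖ ^ 2 :=
    (hsq x').comp_injective (add_left_injective 1)
  set t : ℤ → ℝ := fun k => ‖u (k + 1)‖ ^ 2 + ‖u' k‖ ^ 2 + (‖u k‖ ^ 2 + ‖u' (k + 1)‖ ^ 2) with ht
  have hts : Summable t := (hshift.add (hsq x')).add ((hsq x).add hshift')
  have hTt : ∀ k, ‖T k‖ ≤ ‖α k‖ * t k := by
    intro k
    refine (norm_sub_le _ _).trans ?_
    simp only [norm_mul, RCLike.norm_conj]
    rw [← mul_add]
    refine mul_le_mul_of_nonneg_left ?_ (norm_nonneg _)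
    refine add_le_add ?_ ?_
    · nlinarith [sq_nonneg (‖u (k + 1)‖ - ‖u' k‖), sq_nonneg (‖u (k + 1)‖ + ‖u' k‖)]
    · nlinarith [sq_nonneg (‖u k‖ - ‖u' (k + 1)‖), sq_nonneg (‖u k‖ + ‖u' (k + 1)‖)]
  set L := inner ℂ x y' - inner ℂ y x' with hL
  have hD : HasSum (fun k => T (k - 1) - T k) L := by
    have h1 := lp.hasSum_inner (𝕜 := ℂ) (f.repr x) (f.repr y')
    have h2 := lp.hasSum_inner (𝕜 := ℂ) (f.repr y) (f.repr x')
    rw [LinearIsometryEquiv.inner_map_map] at h1 h2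
    have e : (fun k => T (k - 1) - T k) = fun k =>
        inner ℂ (f.repr x k) (f.repr y' k) - inner ℂ (f.repr y k) (f.repr x' k) := by
      funext k
      rw [RCLike.inner_apply, RCLike.inner_apply, h k, h' k]
      simp only [hT, hu, hu', map_add, map_mul, conj_conj, conj_ofReal, sub_add_cancel]
      ring
    rw [e]
    exact h1.sub h2
  have hlim : Filter.Tendsto (fun N : ℕ => T (-N) - T (N - 1)) Filter.atTop (nhds L) := by
    have h1 := hD.nat_add_neg.tendsto_sum_nat
    have h2 : ∀ N : ℕ, ∑ i ∈ Finset.range N, (T (i - 1) - T i + (T (-i - 1) - T (-i))) =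
        T (-1) - T 0 + (T (-N) - T (N - 1)) := by
      intro N
      induction N with
      | zero => simp
      | succ N ih =>
        rw [Finset.sum_range_succ, ih]
        push_cast
        rw [add_sub_cancel_right, neg_add', ]
        ring
    simp only [h2] at h1
    have h3 := h1.sub_const (T (-1) - T 0)
    simpa using h3
  -- The boundary terms at -N and N-1 are at most 2CN times a summable sequence. If they had a
  -- non-zero limit, 1/N would be summable.
  have hL0 : L = 0 := by
    by_contra hne
    have hpos : 0 < ‖L‖ := norm_pos_iff.2 hne
    have hC : 0 ≤ C := by simpa using (norm_nonneg _).trans (hα 0)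
    have hs1 : Summable fun N : ℕ => t (-N) :=
      hts.comp_injective (f := t) fun a b h => by simpa using h
    have hs2 : Summable fun N : ℕ => t (N - 1) :=
      hts.comp_injective (f := t) (i := fun N : ℕ => (N : ℤ) - 1) fun a b h => by simpa using h
    have hdiv : Summable fun N : ℕ => ‖L‖ / 2 * (1 / (N : ℝ)) := by
      refine Summable.of_norm_bounded_eventually_nat ((hs1.add hs2).mul_left (2 * C)) ?_
      filter_upwards [hlim.norm.eventually (lt_mem_nhds (by linarith : ‖L‖ / 2 < ‖L‖)),
        Filter.eventually_gt_atTop 0] with N hN hN0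
      have hN1 : (1 : ℝ) ≤ N := by exact_mod_cast hN0
      rw [Real.norm_of_nonneg (by positivity), mul_one_div, div_le_iff₀ (by linarith)]
      refine hN.le.trans ((norm_sub_le _ _).trans ?_)
      have t1 : 0 ≤ t (-N) := by positivity
      have t2 : 0 ≤ t (N - 1) := by positivity
      have a1 : ‖α (-N)‖ ≤ 2 * C * N := (hα _).trans (by
        push_cast; rw [abs_neg, abs_of_nonneg (by linarith)]; nlinarith)
      have a2 : ‖α (N - 1)‖ ≤ 2 * C * N := (hα _).trans (by
        push_cast; rw [abs_of_nonneg (by linarith)]; nlinarith)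
      calc ‖T (-N)‖ + ‖T (N - 1)‖ ≤ 2 * C * N * t (-N) + 2 * C * N * t (N - 1) :=
            add_le_add ((hTt _).trans (mul_le_mul_of_nonneg_right a1 t1))
              ((hTt _).trans (mul_le_mul_of_nonneg_right a2 t2))
        _ = _ := by ring
    exact Real.not_summable_one_div_natCast ((summable_mul_left_iff (by positivity)).1 hdiv)
  exact sub_eq_zero.1 hL0

/-- The finite vectors are a core of the maximal operator. -/
theorem JacobiRel.mem_of_isClosed [CompleteSpace H] {C : ℝ}
    (hα : ∀ k, ‖α k‖ ≤ C * (1 + |(k : ℝ)|)) {S : Submodule ℂ (H × H)}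
    (hS : IsClosed (S : Set (H × H))) (hf : ∀ k, (f k, jacobiBasis f b α k) ∈ S)
    {x y : H} (h : JacobiRel f b α x y) : (x, y) ∈ S := by
  -- By symmetry the graph norm of (u, v) is the norm of v + iu, so approximation in the graph
  -- reduces to approximation of v + iu.
  have hnorm : ∀ {u v : H}, JacobiRel f b α u v → ‖v + I • u‖ ^ 2 = ‖v‖ ^ 2 + ‖u‖ ^ 2 := by
    intro u v huv
    have h1 := huv.inner_comm hα huv
    have h2 := norm_add_sq (𝕜 := ℂ) v (I • u)
    rw [h2, norm_smul, norm_I, one_mul, inner_smul_right]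
    have h3 : (inner ℂ v u : ℂ).im = 0 := by
      have := inner_conj_symm (𝕜 := ℂ) v u
      rw [h1] at this
      exact Complex.conj_eq_iff_im.1 this
    simp [h3]
  set φ : H × H →ₗ[ℂ] H := LinearMap.snd ℂ H H + I • LinearMap.fst ℂ H H with hφ
  -- `S` need not lie in the graph of the maximal operator, while the norm identity is available
  -- only there.
  set S' := S ⊓ jacobiGraph f b α with hS'
  -- A vector z orthogonal to this range satisfies Az = iz for the maximal operator A, and symmetry
  -- of A forces z = 0.
  have hdense : (S'.map φ).topologicalClosure = ⊤ := by
    rw [Submodule.topologicalClosure_eq_top_iff, Submodule.eq_bot_iff]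
    intro z hz
    rw [Submodule.mem_orthogonal] at hz
    have hz2 : JacobiRel f b α z (I • z) := by
      rw [jacobiRel_iff]
      intro k
      have h1 := hz (φ (f k, jacobiBasis f b α k))
        (Submodule.mem_map_of_mem ⟨hf k, jacobiRel_basis k⟩)
      have h2 : φ (f k, jacobiBasis f b α k) = jacobiBasis f b α k + I • f k := by simp [hφ]
      rw [h2, inner_add_left, inner_smul_left, conj_I] at h1
      rw [inner_smul_right]
      linear_combination -h1
    have h1 := hz2.inner_comm hα hz2
    rw [inner_smul_left, inner_smul_right, conj_I] at h1
    have h2 : (2 * I) * inner ℂ z z = 0 := by linear_combination h1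
    simpa using h2
  have hmem : (x, y) ∈ closure (S : Set (H × H)) := by
    rw [Metric.mem_closure_iff]
    intro ε hε
    have hw : y + I • x ∈ closure ((S'.map φ : Submodule ℂ H) : Set H) := by
      have : y + I • x ∈ (S'.map φ).topologicalClosure := by rw [hdense]; trivial
      exact this
    obtain ⟨_, ⟨⟨u, v⟩, ⟨huv, hJ⟩, rfl⟩, hd⟩ := Metric.mem_closure_iff.1 hw ε hε
    refine ⟨(u, v), huv, ?_⟩
    have hsub : JacobiRel f b α (x - u) (y - v) :=
      (jacobiGraph f b α).sub_mem (x := (x, y)) (y := (u, v)) h hJ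
    have h1 := hnorm hsub
    have h2 : y + I • x - φ (u, v) = y - v + I • (x - u) := by
      simp only [hφ, LinearMap.add_apply, LinearMap.snd_apply, LinearMap.smul_apply,
        LinearMap.fst_apply, smul_sub]
      abel
    rw [dist_eq_norm, h2] at hd
    have h3 : ‖y - v‖ ^ 2 + ‖x - u‖ ^ 2 < ε ^ 2 := by
      rw [← h1]
      exact pow_lt_pow_left₀ hd (norm_nonneg _) two_ne_zero
    rw [Prod.dist_eq, dist_eq_norm, dist_eq_norm]
    refine max_lt ?_ ?_
    · exact lt_of_pow_lt_pow_left₀ 2 hε.le (by nlinarith [sq_nonneg ‖y - v‖])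
    · exact lt_of_pow_lt_pow_left₀ 2 hε.le (by nlinarith [sq_nonneg ‖x - u‖])
  exact hS.closure_subset hmem

variable {V : ℝ → H ≃ₗᵢ[ℂ] H}

theorem continuous_of_basis (hadd : ∀ s t, V (s + t) = V s * V t)
    (hV : ∀ k, GeneratorRel V (f k) (jacobiBasis f b α k)) (x : H) :
    Continuous fun t => V t x := by
  refine continuous_of_dense_generator hadd (s := Set.range f) ?_ ?_ x
  · rintro _ ⟨k, rfl⟩
    exact ⟨_, hV k⟩
  · have := f.dense_span
    rw [← Submodule.dense_iff_topologicalClosure_eq_top] at this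
    exact this

/-- A unitary group whose generator extends a Jacobi matrix is generated by its maximal operator. -/
theorem generatorRel_iff_jacobiRel [CompleteSpace H] {C : ℝ}
    (hα : ∀ k, ‖α k‖ ≤ C * (1 + |(k : ℝ)|)) (h0 : V 0 = 1) (hadd : ∀ s t, V (s + t) = V s * V t)
    (hV : ∀ k, GeneratorRel V (f k) (jacobiBasis f b α k)) {x y : H} :
    GeneratorRel V x y ↔ JacobiRel f b α x y := by
  constructor
  -- Symmetry of the generator, tested against the basis vectors, is the adjoint description of the
  -- Jacobi relation. The converse uses that the closed generator contains a core.
  · intro h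
    rw [jacobiRel_iff]
    intro k
    exact (hV k).inner_comm h h0
  · intro h
    exact h.mem_of_isClosed hα (S := generatorGraph V)
      (isClosed_generatorGraph h0 hadd (continuous_of_basis hadd hV)) hV

/-- Self-adjointness of an operator whose graph is that of a maximal Jacobi operator. -/
theorem isSelfAdjoint_of_jacobi [CompleteSpace H] {C : ℝ}
    (hα : ∀ k, ‖α k‖ ≤ C * (1 + |(k : ℝ)|)) {A : H →ₗ.[ℂ] H}
    (hA : ∀ x y, (x, y) ∈ A.graph ↔ JacobiRel f b α x y) : IsSelfAdjoint A := by
  have hdom : ∀ k, f k ∈ A.domain := fun k =>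
    LinearPMap.mem_domain_of_mem_graph ((hA _ _).2 (jacobiRel_basis k))
  have hdense : Dense (A.domain : Set H) := by
    have := f.dense_span
    rw [← Submodule.dense_iff_topologicalClosure_eq_top] at this
    refine this.mono ?_
    rw [SetLike.coe_subset_coe, Submodule.span_le]
    rintro _ ⟨k, rfl⟩
    exact hdom k
  rw [LinearPMap.isSelfAdjoint_def]
  apply LinearPMap.eq_of_eq_graph
  rw [LinearPMap.adjoint_graph_eq_graph_adjoint hdense]
  ext ⟨x, y⟩
  rw [Submodule.mem_adjoint_iff]
  simp only [hA]
  constructor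
  · intro h
    rw [jacobiRel_iff]
    intro k
    have := h _ _ (jacobiRel_basis k)
    rw [sub_eq_zero] at this
    exact this.symm
  · intro h u v huv
    rw [sub_eq_zero]
    exact (huv.inner_comm hα h).symm

end Jacobi

/-! ### Fourier coefficients of smooth functions -/

theorem fcoeff_eq_expFn (h : ℝ → ℂ) (k : ℤ) :
    fcoeff h k = (2 * Real.pi : ℂ)⁻¹ * ∫ ψ in (0 : ℝ)..2 * Real.pi, expFn (-k) ψ * h ψ := by
  rw [fcoeff]
  congr 3
  funext ψ
  congr 2
  push_cast; ring

theorem fcoeff_add {f g : ℝ → ℂ} (hf : Continuous f) (hg : Continuous g) (k : ℤ) :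
    fcoeff (fun ψ => f ψ + g ψ) k = fcoeff f k + fcoeff g k := by
  rw [fcoeff_eq, fcoeff_eq, fcoeff_eq, ← mul_add, ← fint_add hf hg]
  rfl

theorem fcoeff_const_mul (c : ℂ) (f : ℝ → ℂ) (k : ℤ) :
    fcoeff (fun ψ => c * f ψ) k = c * fcoeff f k := by
  have : fint (fun ψ => c * f ψ) (-k) = c * fint f (-k) := fint_smul c f (-k)
  rw [fcoeff_eq, fcoeff_eq, this, mul_left_comm]

theorem fcoeff_expFn_mul (j : ℤ) (h : ℝ → ℂ) (k : ℤ) :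
    fcoeff (fun ψ => expFn j ψ * h ψ) k = fcoeff h (k - j) := by
  rw [fcoeff_eq_expFn, fcoeff_eq_expFn]
  congr 2
  funext ψ
  rw [← mul_assoc, ← expFn_add]
  congr 2
  ring

theorem norm_fcoeff_le {h : ℝ → ℂ} {M : ℝ} (hM : ∀ ψ, ‖h ψ‖ ≤ M) (k : ℤ) : ‖fcoeff h k‖ ≤ M := by
  have hpi := Real.pi_pos
  have h1 := intervalIntegral.norm_integral_le_of_norm_le_const (a := 0) (b := 2 * Real.pi)
    (f := fun ψ => expFn (-k) ψ * h ψ) (C := M) fun ψ _ => by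
      rw [norm_mul, norm_expFn, one_mul]; exact hM ψ
  rw [fcoeff_eq_expFn, norm_mul, norm_inv]
  have h2 : ‖(2 * Real.pi : ℂ)‖ = 2 * Real.pi := by
    have : (2 * Real.pi : ℂ) = ((2 * Real.pi : ℝ) : ℂ) := by push_cast; rfl
    rw [this, Complex.norm_real, Real.norm_of_nonneg (by positivity)]
  rw [h2, inv_mul_le_iff₀ (by positivity)]
  refine h1.trans (le_of_eq ?_)
  rw [sub_zero, abs_of_pos (by positivity)]; ring

theorem hasDerivAt_expFn (k : ℤ) (ψ : ℝ) : HasDerivAt (expFn k) (I * k * expFn k ψ) ψ := by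
  have h1 : HasDerivAt (fun ψ : ℝ => I * (k * ψ : ℝ)) (I * k) ψ := by
    have := ((hasDerivAt_id ψ).const_mul (k : ℝ)).ofReal_comp.const_mul I
    simpa using this
  have := h1.cexp
  rw [mul_comm]
  exact this

theorem fcoeff_deriv {h h' : ℝ → ℂ} (hd : ∀ ψ, HasDerivAt h (h' ψ) ψ) (hc : Continuous h')
    (hp : Function.Periodic h (2 * Real.pi)) (k : ℤ) : fcoeff h' k = I * k * fcoeff h k := by
  have hcont : Continuous h := continuous_iff_continuousAt.2 fun ψ => (hd ψ).continuousAt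
  have he := continuous_expFn (-k)
  have h1 := intervalIntegral.integral_mul_deriv_eq_deriv_mul (a := 0) (b := 2 * Real.pi)
    (u := expFn (-k)) (v := h) (u' := fun ψ => I * (-k : ℤ) * expFn (-k) ψ) (v' := h')
    (fun ψ _ => hasDerivAt_expFn (-k) ψ) (fun ψ _ => hd ψ)
    ((by fun_prop : Continuous _).intervalIntegrable _ _) (hc.intervalIntegrable _ _)
  have h2 := hp 0
  have h3 := expFn_periodic (-k) 0
  rw [zero_add] at h2 h3
  rw [h2, h3, sub_self, zero_sub] at h1
  rw [fcoeff_eq_expFn, fcoeff_eq_expFn, h1]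
  simp only [mul_assoc, intervalIntegral.integral_const_mul]
  push_cast; ring

/-- Sequences that decrease faster than every power. -/
def RapidDecay (b : ℤ → ℂ) : Prop := ∀ p : ℕ, ∃ C : ℝ, ∀ k : ℤ, |(k : ℝ)| ^ p * ‖b k‖ ≤ C

theorem RapidDecay.summable {b : ℤ → ℂ} (hb : RapidDecay b) (p : ℕ) :
    -- Two extra powers of |k| leave room for comparison with the series of 1/k².
    Summable fun k : ℤ => |(k : ℝ)| ^ p * ‖b k‖ := by
  obtain ⟨C, hC⟩ := hb (p + 2)
  have hs : Summable fun k : ℤ => C * (1 / (k : ℝ) ^ 2) :=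
    (Real.summable_one_div_int_pow.2 (by norm_num)).mul_left C
  refine Summable.of_norm_bounded_eventually hs ?_
  have : ∀ᶠ k : ℤ in Filter.cofinite, k ≠ 0 := (Set.finite_singleton (0 : ℤ)).compl_mem_cofinite
  filter_upwards [this] with k hk
  have hk2 : (0 : ℝ) < |(k : ℝ)| ^ 2 := by
    have : (k : ℝ) ≠ 0 := by exact_mod_cast hk
    positivity
  rw [Real.norm_of_nonneg (by positivity), ← sq_abs, mul_one_div, le_div_iff₀ hk2]
  refine le_trans (le_of_eq ?_) (hC k)
  ring

theorem RapidDecay.mul {b : ℤ → ℂ} (hb : RapidDecay b) {m : ℤ → ℂ} {C : ℝ}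
    (hm : ∀ k, ‖m k‖ ≤ C * (1 + |(k : ℝ)| ^ 2)) : RapidDecay fun k => m k * b k := by
  intro p
  obtain ⟨C1, h1⟩ := hb p
  obtain ⟨C2, h2⟩ := hb (p + 2)
  have hC : 0 ≤ C := by simpa using (norm_nonneg _).trans (hm 0)
  refine ⟨C * (C1 + C2), fun k => ?_⟩
  rw [norm_mul]
  calc |(k : ℝ)| ^ p * (‖m k‖ * ‖b k‖)
      ≤ |(k : ℝ)| ^ p * (C * (1 + |(k : ℝ)| ^ 2) * ‖b k‖) := by
        gcongr; exact hm k
    _ = C * (|(k : ℝ)| ^ p * ‖b k‖ + |(k : ℝ)| ^ (p + 2) * ‖b k‖) := by ring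
    _ ≤ _ := mul_le_mul_of_nonneg_left (add_le_add (h1 k) (h2 k)) hC

theorem periodic_bounded {h : ℝ → ℂ} (hc : Continuous h) (hp : Function.Periodic h (2 * Real.pi)) :
    ∃ M, ∀ ψ, ‖h ψ‖ ≤ M := by
  obtain ⟨M, hM⟩ := (isCompact_Icc (a := (0 : ℝ)) (b := 2 * Real.pi)).exists_bound_of_continuousOn
    hc.continuousOn
  refine ⟨M, fun ψ => ?_⟩
  obtain ⟨y, hy, h1⟩ := hp.exists_mem_Ico₀ (by positivity) ψ
  rw [h1]
  exact hM y ⟨hy.1, hy.2.le⟩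

variable {P} in
theorem TestFn.hasDerivAt (h : TestFn P) (ψ : ℝ) : HasDerivAt h (deriv h ψ) ψ :=
  (h.2.1.differentiable (by simp) ψ).hasDerivAt

/-- The derivative of a smooth function on the circle. -/
def TestFn.der (h : TestFn P) : TestFn P :=
  ⟨deriv h, (contDiff_infty_iff_deriv.1 h.2.1).2, fun ψ => by
    have h1 := h.2.2
    have : deriv (fun ψ => h (ψ + 2 * Real.pi)) ψ = deriv h ψ := by
      congr 1
      exact funext h1
    rwa [deriv_comp_add_const] at this⟩

theorem fcoeff_der (h : TestFn P) (k : ℤ) : fcoeff (h.der P) k = I * k * fcoeff h k :=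
  fcoeff_deriv h.hasDerivAt (h.der P).continuous h.2.2 k

/-- Each derivative multiplies the k-th coefficient by ik, and the coefficients of a continuous
periodic function are bounded. -/
theorem TestFn.rapidDecay (h : TestFn P) : RapidDecay (fcoeff h) := by
  intro p
  induction p generalizing h with
  | zero =>
    obtain ⟨M, hM⟩ := periodic_bounded h.continuous h.2.2
    exact ⟨M, fun k => by simpa using norm_fcoeff_le hM k⟩
  | succ p ih =>
    obtain ⟨C, hC⟩ := ih (h.der P)
    refine ⟨C, fun k => ?_⟩
    have := hC k
    rw [fcoeff_der, norm_mul, norm_mul, norm_I, one_mul, Complex.norm_intCast] at this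
    rwa [pow_succ, mul_assoc]

theorem iteratedDeriv_expFn (n : ℕ) (k : ℤ) (c : ℂ) :
    iteratedDeriv n (fun ψ => c * expFn k ψ) = fun ψ => (I * k) ^ n * (c * expFn k ψ) := by
  induction n with
  | zero => simp
  | succ n ih =>
    rw [iteratedDeriv_succ, ih]
    funext ψ
    rw [(((hasDerivAt_expFn k ψ).const_mul c).const_mul ((I * k) ^ n)).deriv]
    ring

theorem contDiff_expFn (k : ℤ) : ContDiff ℝ ∞ (expFn k) := by
  unfold expFn
  exact (contDiff_const.mul (ofRealCLM.contDiff.comp (contDiff_const.mul contDiff_id))).cexp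

/-- The character `e^{ikψ}` as a test function. -/
def charFn (k : ℤ) : TestFn P := ⟨expFn k, contDiff_expFn k, expFn_periodic k⟩

/-- A smooth function with given rapidly decreasing Fourier coefficients. -/
theorem RapidDecay.exists_testFn {b : ℤ → ℂ} (hb : RapidDecay b) :
    ∃ g : TestFn P, ∀ k, fcoeff g k = b k := by
  have hs0 : Summable fun k => ‖b k‖ := by simpa using hb.summable 0
  have hsm : ContDiff ℝ ∞ fun ψ => ∑' k, b k * expFn k ψ := by
    refine contDiff_tsum (N := ⊤) (v := fun n (k : ℤ) => |(k : ℝ)| ^ n * ‖b k‖)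
      (fun k => contDiff_const.mul (contDiff_expFn k)) (fun n _ => hb.summable n) ?_
    intro n k ψ _
    rw [norm_iteratedFDeriv_eq_norm_iteratedDeriv, iteratedDeriv_expFn]
    simp [norm_expFn]
  refine ⟨⟨_, hsm, fun ψ => by simp only [expFn_periodic _ ψ]⟩, fun k => ?_⟩
  change fcoeff (fun ψ => ∑' k, b k * expFn k ψ) k = b k
  have hpi : (0 : ℝ) ≤ 2 * Real.pi := by positivity
  have h1 := intervalIntegral.hasSum_integral_of_dominated_convergence (μ := volume) (a := 0)
    (b := 2 * Real.pi) (F := fun j ψ => expFn (-k) ψ * (b j * expFn j ψ))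
    (f := fun ψ => expFn (-k) ψ * ∑' j, b j * expFn j ψ) (fun j _ => ‖b j‖)
    (fun j => (by
      have := continuous_expFn j; have := continuous_expFn (-k); fun_prop :
        Continuous _).aestronglyMeasurable)
    (fun j => Filter.Eventually.of_forall fun ψ _ => by simp [norm_expFn])
    (Filter.Eventually.of_forall fun ψ _ => hs0)
    (by simp)
    (Filter.Eventually.of_forall fun ψ _ => by
      refine HasSum.mul_left _ (Summable.hasSum ?_)
      exact Summable.of_norm (by simpa [norm_expFn] using hs0))
  have h2 := h1.mul_left (2 * Real.pi : ℂ)⁻¹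
  rw [← fcoeff_eq_expFn] at h2
  have e : ∀ j, (2 * Real.pi : ℂ)⁻¹ * ∫ ψ in (0 : ℝ)..2 * Real.pi,
      expFn (-k) ψ * (b j * expFn j ψ) = if j = k then b k else 0 := by
    intro j
    rw [← fcoeff_eq_expFn, fcoeff_const_mul, fcoeff_expFn]
    by_cases h : k = j
    · subst h; simp
    · rw [if_neg h, if_neg (Ne.symm h), mul_zero]
  simp only [e] at h2
  exact h2.unique (hasSum_ite_eq k (b k))

/-- Multipliers of at most quadratic growth preserve C^∞(S¹). This serves for ω̃ and for the
generator of the rotations. -/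
theorem exists_testFn_of_multiplier (h : TestFn P) {m : ℤ → ℂ} {C : ℝ}
    (hm : ∀ k, ‖m k‖ ≤ C * (1 + |(k : ℝ)| ^ 2)) :
    ∃ g : TestFn P, ∀ k, fcoeff g k = m k * fcoeff h k :=
  ((h.rapidDecay P).mul hm).exists_testFn P

/-! ### The basis of the time-zero Hilbert space -/

/-- The constant in `‖e^{ikψ}‖² = const / ω̃(k)`. -/
def normConst : ℝ :=
  P.cNu.re * (P.r * P.r) * (2 * Real.pi) ^ 2 * (legendreCoeff P 0 * omegaReal P 0)

theorem normConst_pos : 0 < normConst P := by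
  obtain ⟨c, hc, h⟩ := P.cNu_pos
  have := P.r_pos
  have := legendreCoeff_pos P 0
  have := omegaReal_pos P 0
  rw [normConst, h, ofReal_re]
  positivity

/-- The eigenvalue of the form on e^{ikψ} contains λ_k, which is a constant divided by ω̃(k). -/
theorem inner_charFn (k : ℤ) (h : TestFn P) :
    inner ℂ (charFn P k) h = (normConst P / omegaReal P k : ℝ) * fcoeff h k := by
  rw [TestFn.inner_eq]
  refine (form_expFn P k h.continuous).trans ?_
  obtain ⟨c, hc, hc'⟩ := P.cNu_pos
  have h1 := omegaReal_pos P k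
  rw [normConst, ← legendreCoeff_mul_omegaReal P k, hc', ofReal_re]
  have : (omegaReal P k : ℂ) ≠ 0 := by exact_mod_cast h1.ne'
  push_cast
  field_simp

/-- The norm of `e^{ikψ}`. -/
def charNorm (k : ℤ) : ℝ := √(normConst P / omegaReal P k)

theorem charNorm_pos (k : ℤ) : 0 < charNorm P k :=
  Real.sqrt_pos.2 (div_pos (normConst_pos P) (omegaReal_pos P k))

theorem charNorm_sq (k : ℤ) : charNorm P k ^ 2 = normConst P / omegaReal P k :=
  Real.sq_sqrt (div_pos (normConst_pos P) (omegaReal_pos P k)).le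

/-- The normalised characters. -/
def basisVec (k : ℤ) : Hilb P := ((charNorm P k)⁻¹ : ℂ) • emb P (charFn P k)

theorem inner_emb (h h' : TestFn P) : inner ℂ (emb P h) (emb P h') = inner ℂ h h' :=
  UniformSpace.Completion.inner_coe h h'

theorem inner_basisVec_emb (k : ℤ) (h : TestFn P) :
    inner ℂ (basisVec P k) (emb P h) = charNorm P k * fcoeff h k := by
  have h1 := charNorm_pos P k
  have h2 : (charNorm P k : ℂ) ≠ 0 := by exact_mod_cast h1.ne'
  rw [basisVec, inner_smul_left, inner_emb, inner_charFn, ← charNorm_sq, map_inv₀, conj_ofReal]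
  push_cast
  field_simp

theorem orthonormal_basisVec : Orthonormal ℂ (basisVec P) := by
  classical
  rw [orthonormal_iff_ite]
  intro j k
  have h2 : (charNorm P k : ℂ) ≠ 0 := by exact_mod_cast (charNorm_pos P k).ne'
  conv_lhs => rw [basisVec.eq_def P k]
  rw [inner_smul_right, inner_basisVec_emb]
  change _ * (_ * fcoeff (expFn k) j) = _
  rw [fcoeff_expFn]
  split_ifs with h
  · subst h; field_simp
  · simp

/-- The form norm is bounded by the ℓ² norm of the Fourier coefficients (`form_self_le`), so Fourier
partial sums converge in the Hilbert space. -/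
theorem emb_mem_closure_span (h : TestFn P) :
    emb P h ∈ (Submodule.span ℂ (Set.range (basisVec P))).topologicalClosure := by
  have hdec := h.rapidDecay P
  have hsum : Summable fun m => ‖fint h m‖ ^ 2 := by
    obtain ⟨C, hC⟩ := hdec 0
    have h1 : Summable fun k => ‖fcoeff h k‖ := by simpa using hdec.summable 0
    have h2 : Summable fun k => ‖fcoeff h k‖ ^ 2 := by
      refine Summable.of_nonneg_of_le (fun _ => by positivity) (fun k => ?_) (h1.mul_left C)
      rw [sq]
      exact mul_le_mul_of_nonneg_right (by simpa using hC k) (norm_nonneg _)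
    have h3 := (h2.comp_injective (neg_injective (G := ℤ))).mul_left (‖(2 * Real.pi : ℂ)‖ ^ 2)
    refine h3.congr fun m => ?_
    rw [Function.comp, fcoeff_eq, neg_neg, ← mul_pow, ← norm_mul,
      mul_inv_cancel_left₀ two_pi_ne_zero]
  obtain ⟨C, hC0, hC⟩ := form_self_le P
  -- The index is negated because `fint h m` is 2π times the Fourier coefficient at -m.
  set p : Finset ℤ → TestFn P := fun s => ∑ m ∈ s, fcoeff h (-m) • charFn P (-m) with hp
  have hfun : ∀ s, ((p s : TestFn P) : ℝ → ℂ) = fun ψ => ∑ m ∈ s, fcoeff h (-m) * expFn (-m) ψ := by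
    intro s
    induction s using Finset.induction_on with
    | empty => rfl
    | insert a s ha ih =>
      have e : p (insert a s) = fcoeff h (-a) • charFn P (-a) + p s := by
        simp only [hp, Finset.sum_insert ha]
      rw [e]
      change (fun ψ => fcoeff h (-a) * expFn (-a) ψ + (p s) ψ) = _
      rw [ih]
      funext ψ
      rw [Finset.sum_insert ha]
  have hpf : ∀ s m, fint (h - p s : TestFn P) m = if m ∈ s then 0 else fint h m := by
    intro s m
    have e1 : ((h - p s : TestFn P) : ℝ → ℂ) = (h : ℝ → ℂ) + (-1 : ℂ) • (p s : ℝ → ℂ) := by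
      funext ψ
      change h ψ - (p s) ψ = h ψ + (-1 : ℂ) * (p s) ψ
      ring
    have e2 : fint (p s) m = if m ∈ s then fint h m else 0 := by
      rw [hfun]
      have : ∀ s : Finset ℤ, fint (fun ψ => ∑ m ∈ s, fcoeff h (-m) * expFn (-m) ψ) m =
          ∑ j ∈ s, fcoeff h (-j) * fint (expFn (-j)) m := by
        intro s
        unfold fint
        simp only [Finset.mul_sum]
        rw [intervalIntegral.integral_finsetSum fun j _ =>
          (by have := continuous_expFn (-j); fun_prop : Continuous _).intervalIntegrable _ _]
        refine Finset.sum_congr rfl fun j _ => ?_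
        rw [← intervalIntegral.integral_const_mul]
        simp only [mul_left_comm]
      rw [this]
      simp only [fint_expFn]
      by_cases hm : m ∈ s
      · rw [Finset.sum_eq_single m, if_pos (by omega), if_pos hm, fcoeff_eq, neg_neg]
        · push_cast
          rw [mul_comm, mul_inv_cancel_left₀ two_pi_ne_zero]
        · intro j _ hj
          rw [if_neg (by omega)]; simp
        · intro h; exact absurd hm h
      · rw [if_neg hm]
        refine Finset.sum_eq_zero fun j hj => ?_
        have : j ≠ m := fun h => hm (h ▸ hj)
        rw [if_neg (by omega)]; simp
    rw [e1, fint_add h.continuous (by exact (p s).continuous.const_smul _), fint_smul, e2]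
    split_ifs <;> ring
  rw [← SetLike.mem_coe, Submodule.topologicalClosure_coe, Metric.mem_closure_iff]
  intro ε hε
  have htend := hsum.hasSum
  rw [HasSum] at htend
  -- The summand 1 only keeps the denominator positive when C = 0.
  have hδ : 0 < ε ^ 2 / (C + 1) := by positivity
  obtain ⟨s, hs⟩ := (Metric.tendsto_nhds.1 htend _ hδ).exists
  have hts : (∑' m, ‖fint (h - p s : TestFn P) m‖ ^ 2) =
      (∑' m, ‖fint h m‖ ^ 2) - ∑ m ∈ s, ‖fint h m‖ ^ 2 := by
    have h1 := hsum.hasSum.sub (hasSum_sum_of_ne_finset_zero (s := s)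
      (f := fun m => if m ∈ s then ‖fint h m‖ ^ 2 else 0) fun m hm => if_neg hm)
    rw [Finset.sum_congr rfl fun m hm => if_pos hm] at h1
    rw [← h1.tsum_eq]
    congr 1
    funext m
    rw [hpf]
    split_ifs <;> simp
  have hss : Summable fun m => ‖fint (h - p s : TestFn P) m‖ ^ 2 := by
    refine Summable.of_nonneg_of_le (fun _ => by positivity) (fun m => ?_) hsum
    rw [hpf]
    split_ifs
    · simp
    · exact le_rfl
  refine ⟨emb P (p s), ?_, ?_⟩
  · rw [hp, map_sum]
    refine Submodule.sum_mem _ fun m _ => ?_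
    rw [map_smul]
    refine Submodule.smul_mem _ _ ?_
    have : emb P (charFn P (-m)) = (charNorm P (-m) : ℂ) • basisVec P (-m) := by
      rw [basisVec, smul_smul, mul_inv_cancel₀ (by exact_mod_cast (charNorm_pos P (-m)).ne'),
        one_smul]
    rw [this]
    exact Submodule.smul_mem _ _ (Submodule.subset_span ⟨_, rfl⟩)
  · rw [dist_eq_norm, ← map_sub]
    have h1 := hC _ (h - p s).continuous hss
    have h2 : ‖emb P (h - p s)‖ ^ 2 ≤ C * ∑' m, ‖fint (h - p s : TestFn P) m‖ ^ 2 := by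
      refine le_trans (le_of_eq ?_) h1
      rw [← TestFn.inner_eq, ← inner_emb, inner_self_eq_norm_sq_to_K, norm_pow]
      simp
    refine lt_of_pow_lt_pow_left₀ 2 hε.le (lt_of_le_of_lt h2 ?_)
    rw [hts]
    rw [dist_comm, Real.dist_eq] at hs
    have h3 := lt_of_le_of_lt (le_abs_self _) hs
    rw [lt_div_iff₀ (by positivity)] at h3
    have h4 : 0 ≤ (∑' m, ‖fint h m‖ ^ 2) - ∑ m ∈ s, ‖fint h m‖ ^ 2 :=
      sub_nonneg.2 (hsum.sum_le_tsum _ fun _ _ => by positivity)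
    nlinarith

/-- The Hilbert basis of normalised characters. -/
def hilbBasis : HilbertBasis ℤ ℂ (Hilb P) :=
  HilbertBasis.mk (orthonormal_basisVec P) (by
    intro x _
    rw [← SetLike.mem_coe, Submodule.topologicalClosure_coe]
    refine closure_minimal ?_ isClosed_closure
      (UniformSpace.Completion.denseRange_coe (α := TestFn P) x)
    rintro _ ⟨h, rfl⟩
    exact emb_mem_closure_span P h)

theorem hilbBasis_apply (k : ℤ) : hilbBasis P k = basisVec P k := by
  rw [hilbBasis, HilbertBasis.coe_mk]

theorem repr_emb (h : TestFn P) (k : ℤ) :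
    (hilbBasis P).repr (emb P h) k = charNorm P k * fcoeff h k := by
  rw [HilbertBasis.repr_apply_apply, hilbBasis_apply, inner_basisVec_emb]

/-! ### The operators `ω r cos_ψ` and `ω r sin_ψ` as Jacobi operators -/

/-- The off-diagonal matrix elements. -/
def ladder (k : ℤ) : ℝ := √(k * (k + 1) + P.zeta ^ 2) / 2

theorem ladder_pos (k : ℤ) : 0 < ladder P k :=
  half_pos (Real.sqrt_pos.2 (quad_pos P k))

theorem ladder_sq (k : ℤ) : ladder P k ^ 2 = (k * (k + 1) + P.zeta ^ 2) / 4 := by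
  rw [ladder, div_pow, Real.sq_sqrt (quad_pos P k).le]; norm_num

theorem ladder_le (k : ℤ) : ladder P k ≤ (1 + P.zeta) * (1 + |(k : ℝ)|) := by
  have h := P.zeta_pos
  refine abs_le_of_sq_le_sq' ?_ (by positivity) |>.2
  rw [ladder_sq]
  have h1 := abs_nonneg (k : ℝ)
  have h2 := le_abs_self (k : ℝ)
  have h3 := sq_abs (k : ℝ)
  nlinarith [mul_nonneg h.le h1, mul_nonneg (mul_nonneg h.le h1) h1, mul_nonneg h.le h.le,
    mul_nonneg (mul_nonneg h.le h.le) h1, mul_nonneg (mul_nonneg h.le h1) (mul_nonneg h.le h1)]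

theorem norm_mul_ladder_le {γ : ℂ} (hγ : ‖γ‖ = 1) (k : ℤ) :
    ‖γ * ladder P k‖ ≤ (1 + P.zeta) * (1 + |(k : ℝ)|) := by
  rw [norm_mul, hγ, one_mul, Complex.norm_real, Real.norm_of_nonneg (ladder_pos P k).le]
  exact ladder_le P k

/-- After squaring, 4a_k² = r² ω̃(k) ω̃(k+1) and ‖e^{ikψ}‖² = const / ω̃(k). Together with
`ladder_mul_charNorm'` this makes the matrix of ω r cos_ψ Hermitian in the normalised basis. -/
theorem ladder_mul_charNorm (k : ℤ) :
    2 * ladder P k * charNorm P k = P.r * omegaReal P (k + 1) * charNorm P (k + 1) := by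
  have h1 := ladder_pos P k
  have h2 := charNorm_pos P k
  have h3 := charNorm_pos P (k + 1)
  have h4 := omegaReal_pos P (k + 1)
  have h5 := P.r_pos
  have h6 := omegaReal_pos P k
  refine (sq_eq_sq₀ (by positivity) (by positivity)).1 ?_
  rw [mul_pow, mul_pow, mul_pow, mul_pow, ladder_sq, charNorm_sq, charNorm_sq,
    ← omegaReal_mul_succ]
  field_simp
  norm_num

theorem ladder_mul_charNorm' (k : ℤ) :
    2 * ladder P k * charNorm P (k + 1) = P.r * omegaReal P k * charNorm P k := by
  have h1 := ladder_pos P k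
  have h2 := charNorm_pos P k
  have h3 := charNorm_pos P (k + 1)
  have h4 := omegaReal_pos P (k + 1)
  have h5 := P.r_pos
  have h6 := omegaReal_pos P k
  refine (sq_eq_sq₀ (by positivity) (by positivity)).1 ?_
  rw [mul_pow, mul_pow, mul_pow, mul_pow, ladder_sq, charNorm_sq, charNorm_sq,
    ← omegaReal_mul_succ]
  field_simp
  norm_num

/-- λ_k ω̃(k) is constant and λ_k is largest at k = 0. -/
theorem omegaReal_ge (k : ℤ) : omegaReal P 0 ≤ omegaReal P k := by
  have h1 := legendreCoeff_mul_omegaReal P k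
  have h2 : legendreCoeff P k ≤ legendreCoeff P 0 :=
    (summable_kerCoeff_mul_cosPowCoeff P _).tsum_le_tsum
      (fun n => mul_le_mul_of_nonneg_left (cosPowCoeff_le_zero n k) (kerCoeff_pos P n).le)
      (summable_kerCoeff_mul_cosPowCoeff P _)
  have h3 := legendreCoeff_pos P 0
  have h4 := omegaReal_pos P k
  by_contra! hlt
  nlinarith

theorem exists_omegaReal_le : ∃ C : ℝ, ∀ k, omegaReal P k ≤ C * (1 + |(k : ℝ)| ^ 2) := by
  have hr := P.r_pos
  have h0 := omegaReal_pos P 0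
  -- The product formula with ω̃(k+1) ≥ ω̃(0) gives ω̃(k) ≤ (k(k+1)+ζ²) / (r² ω̃(0)), and k(k+1)+ζ²
  -- ≤ (2+ζ²)(1+k²).
  refine ⟨(2 + P.zeta ^ 2) / (P.r ^ 2 * omegaReal P 0), fun k => ?_⟩
  have h1 := omegaReal_mul_succ P k
  have h2 := omegaReal_ge P (k + 1)
  have h3 := omegaReal_pos P k
  rw [div_mul_eq_mul_div, le_div_iff₀ (by positivity), sq_abs]
  have h4 : omegaReal P k * (P.r ^ 2 * omegaReal P 0) ≤
      P.r ^ 2 * (omegaReal P k * omegaReal P (k + 1)) := by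
    rw [mul_left_comm]; gcongr
  rw [h1] at h4
  nlinarith [sq_nonneg ((k : ℝ) - 1), sq_nonneg P.zeta, sq_nonneg (k : ℝ),
    mul_nonneg (sq_nonneg P.zeta) (sq_nonneg (k : ℝ))]

variable {f : C(ℝ, ℝ)} {γ : ℂ}

/-- With γ = e^{-iα} the function f is cos(ψ-α). The cosine, the sine and its negative are the cases
γ = 1, -i and i, so all are treated at once. -/
theorem fcoeff_trig_mul (hf : ∀ ψ, (f ψ : ℂ) = (γ * expFn 1 ψ + conj γ * expFn (-1) ψ) / 2)
    {h : ℝ → ℂ} (hh : Continuous h) (c : ℂ) (k : ℤ) : fcoeff (fun ψ => c * f ψ * h ψ) k =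
      c / 2 * (γ * fcoeff h (k - 1) + conj γ * fcoeff h (k + 1)) := by
  have e : (fun ψ => c * f ψ * h ψ) = fun ψ => (c / 2 * γ) * (expFn 1 ψ * h ψ) +
      (c / 2 * conj γ) * (expFn (-1) ψ * h ψ) := by
    funext ψ
    rw [hf]; ring
  have := continuous_expFn 1
  have := continuous_expFn (-1)
  rw [e, fcoeff_add (by fun_prop) (by fun_prop), fcoeff_const_mul, fcoeff_const_mul,
    fcoeff_expFn_mul, fcoeff_expFn_mul, sub_neg_eq_add]
  ring

theorem jacobiRel_of_mem_omegaMulGraph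
    (hf : ∀ ψ, (f ψ : ℂ) = (γ * expFn 1 ψ + conj γ * expFn (-1) ψ) / 2)
    {p : Hilb P × Hilb P} (hp : p ∈ omegaMulGraph P f) :
    JacobiRel (hilbBasis P) 0 (fun k => γ * ladder P k) p.1 p.2 := by
  obtain ⟨h, g, rfl, hg⟩ := hp
  intro k
  have h1 := ladder_mul_charNorm P (k - 1)
  have h2 := ladder_mul_charNorm' P k
  rw [sub_add_cancel] at h1
  have h1' : (2 * ladder P (k - 1) * charNorm P (k - 1) : ℂ) =
    P.r * omegaReal P k * charNorm P k := by exact_mod_cast h1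
  have h2' : (2 * ladder P k * charNorm P (k + 1) : ℂ) =
    P.r * omegaReal P k * charNorm P k := by exact_mod_cast h2
  simp only [repr_emb]
  rw [hg, fcoeff_trig_mul hf h.continuous, omegaTilde_eq, map_mul, conj_ofReal]
  simp only [Pi.zero_apply, ofReal_zero, zero_mul, zero_add]
  linear_combination -(1 / 2 : ℂ) * γ * fcoeff h (k - 1) * h1' -
    (1 / 2 : ℂ) * conj γ * fcoeff h (k + 1) * h2'

theorem exists_mem_omegaMulGraph
    (hf : ∀ ψ, (f ψ : ℂ) = (γ * expFn 1 ψ + conj γ * expFn (-1) ψ) / 2)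
    (h : TestFn P) : ∃ g : TestFn P, (emb P h, emb P g) ∈ omegaMulGraph P f := by
  obtain ⟨C, hC⟩ := exists_omegaReal_le P
  let h' : TestFn P := ⟨fun ψ => P.r * f ψ * h ψ, by
    simp only [hf]
    have h1 := contDiff_expFn 1
    have h2 := contDiff_expFn (-1)
    have h3 := h.2.1
    exact (contDiff_const.mul (((contDiff_const.mul h1).add
      (contDiff_const.mul h2)).div_const 2)).mul h3, fun ψ => by
      have := h.2.2 ψ
      simp only [hf, expFn_periodic _ ψ]
      rw [this]⟩
  obtain ⟨g, hg⟩ := exists_testFn_of_multiplier P h' (m := omegaTilde P) (C := C) fun k => by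
    rw [omegaTilde_eq, Complex.norm_real, Real.norm_of_nonneg (omegaReal_pos P k).le]
    exact hC k
  exact ⟨g, h, g, rfl, hg⟩

/-- The graph lies in the closed graph of the maximal Jacobi operator and contains the basis
vectors, which span a core. -/
theorem topologicalClosure_omegaMulGraph (hγ : ‖γ‖ = 1)
    (hf : ∀ ψ, (f ψ : ℂ) = (γ * expFn 1 ψ + conj γ * expFn (-1) ψ) / 2) :
    (omegaMulGraph P f).topologicalClosure =
      jacobiGraph (hilbBasis P) 0 (fun k => γ * ladder P k) := by
  apply le_antisymm
  · refine Submodule.topologicalClosure_minimal _ (fun p hp => ?_) (isClosed_jacobiGraph _ _ _)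
    exact jacobiRel_of_mem_omegaMulGraph P hf hp
  · rintro ⟨x, y⟩ hxy
    have hxy : JacobiRel (hilbBasis P) 0 (fun k => γ * ladder P k) x y := hxy
    refine hxy.mem_of_isClosed (norm_mul_ladder_le P hγ) (Submodule.isClosed_topologicalClosure _)
      fun k => Submodule.le_topologicalClosure _ ?_
    obtain ⟨g, hg⟩ := exists_mem_omegaMulGraph P hf (charFn P k)
    have h1 := Submodule.smul_mem _ ((charNorm P k)⁻¹ : ℂ) hg
    have h2 : ((charNorm P k)⁻¹ : ℂ) • (emb P (charFn P k), emb P g) =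
        (hilbBasis P k, ((charNorm P k)⁻¹ : ℂ) • emb P g) := by
      rw [hilbBasis_apply, basisVec]; rfl
    rw [h2] at h1
    have h3 := (jacobiRel_of_mem_omegaMulGraph P hf h1).unique (jacobiRel_basis k)
    dsimp only at h3
    rwa [h3] at h1

theorem graph_omegaMul (f : C(ℝ, ℝ)) :
    (omegaMulGraph P f).toLinearPMap.graph = omegaMulGraph P f :=
  Submodule.toLinearPMap_graph_eq _ (omegaMulGraph_functional P f)

theorem mem_graph_closure_omegaMul (hγ : ‖γ‖ = 1)
    (hf : ∀ ψ, (f ψ : ℂ) = (γ * expFn 1 ψ + conj γ * expFn (-1) ψ) / 2) (x y : Hilb P) :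
    (x, y) ∈ (omegaMulGraph P f).toLinearPMap.closure.graph ↔
      JacobiRel (hilbBasis P) 0 (fun k => γ * ladder P k) x y := by
  have hcl : (omegaMulGraph P f).toLinearPMap.IsClosable := by
    -- Closability: the closure of the graph is the graph of the maximal operator, which is
    -- single-valued.
    refine ⟨(jacobiGraph (hilbBasis P) 0 (fun k => γ * ladder P k)).toLinearPMap, ?_⟩
    rw [graph_omegaMul, topologicalClosure_omegaMulGraph P hγ hf,
      Submodule.toLinearPMap_graph_eq]
    rintro ⟨u, v⟩ huv rfl
    have huv : JacobiRel (hilbBasis P) 0 (fun k => γ * ladder P k) 0 v := huv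
    exact huv.unique (jacobiGraph (hilbBasis P) 0 (fun k => γ * ladder P k)).zero_mem
  rw [← hcl.graph_closure_eq_closure_graph, graph_omegaMul, topologicalClosure_omegaMulGraph P hγ hf]
  rfl

theorem isSelfAdjoint_closure_omegaMul (hγ : ‖γ‖ = 1)
    (hf : ∀ ψ, (f ψ : ℂ) = (γ * expFn 1 ψ + conj γ * expFn (-1) ψ) / 2) :
    IsSelfAdjoint (omegaMulGraph P f).toLinearPMap.closure :=
  isSelfAdjoint_of_jacobi (norm_mul_ladder_le P hγ) (mem_graph_closure_omegaMul P hγ hf)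

theorem cos_eq_trig (ψ : ℝ) : ((⟨Real.cos, Real.continuous_cos⟩ : C(ℝ, ℝ)) ψ : ℂ) =
    ((1 : ℂ) * expFn 1 ψ + conj (1 : ℂ) * expFn (-1) ψ) / 2 := by
  rw [map_one, one_mul, one_mul]
  exact cos_eq_expFn ψ

theorem sin_eq_trig (ψ : ℝ) : ((⟨Real.sin, Real.continuous_sin⟩ : C(ℝ, ℝ)) ψ : ℂ) =
    (-I * expFn 1 ψ + conj (-I) * expFn (-1) ψ) / 2 := by
  rw [map_neg, conj_I, neg_neg]
  refine (sin_eq_expFn ψ).trans ?_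
  ring

/-! ### Continuous functions on the circle -/

/-- Continuous functions on the circle. -/
def contCircle : Submodule ℂ (ℝ → ℂ) where
  carrier := {h | Continuous h ∧ Function.Periodic h (2 * Real.pi)}
  zero_mem' := ⟨continuous_const, fun _ => rfl⟩
  add_mem' := fun ha hb => ⟨ha.1.add hb.1, ha.2.add hb.2⟩
  smul_mem' := fun c _ ha => ⟨continuous_const.smul ha.1, fun x => by simp [ha.2 x]⟩

theorem hasSum_sq_fcoeff {h : ℝ → ℂ} (hh : Continuous h) : HasSum (fun k => ‖fcoeff h k‖ ^ 2)
    ((2 * Real.pi)⁻¹ * ∫ ψ in (0 : ℝ)..2 * Real.pi, ‖h ψ‖ ^ 2) := by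
  have hpi : (0 : ℝ) < 2 * Real.pi := by positivity
  have hL : MemLp h 2 (volume.restrict (Set.Ioc 0 (2 * Real.pi))) := by
    rw [memLp_two_iff_integrable_sq_norm hh.aestronglyMeasurable]
    exact ((by fun_prop : Continuous fun ψ => ‖h ψ‖ ^ 2).integrableOn_Icc).mono_set
      Set.Ioc_subset_Icc_self
  have h1 := hasSum_sq_fourierCoeffOn hpi hL
  rw [sub_zero, smul_eq_mul] at h1
  convert! h1 using 3 with k
  rw [fourierCoeffOn_eq_integral, fcoeff_eq_expFn]
  rw [sub_zero, Complex.real_smul, one_div]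
  push_cast
  congr 2
  refine intervalIntegral.integral_congr fun ψ _ => ?_
  rw [fourier_coe_apply, smul_eq_mul, expFn]
  congr 2
  have : (Real.pi : ℂ) ≠ 0 := by exact_mod_cast Real.pi_ne_zero
  push_cast
  field_simp

section DiagMap

variable {H : Type*} [NormedAddCommGroup H] [InnerProductSpace ℂ H]
  (f : HilbertBasis ℤ ℂ H) {d : ℤ → ℂ} (hd : ∀ k, ‖d k‖ ≤ 1)

theorem memlp_diag (hd : ∀ k, ‖d k‖ ≤ 1) {h : ℝ → ℂ} (hh : Continuous h) :
    Memℓp (fun k => d k * fcoeff h k) 2 := by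
  refine memℓp_gen ?_
  have := (hasSum_sq_fcoeff hh).summable
  simp only [ENNReal.toReal_ofNat, Real.rpow_ofNat]
  refine Summable.of_nonneg_of_le (fun _ => by positivity) (fun k => ?_) this
  rw [norm_mul, mul_pow]
  exact mul_le_of_le_one_left (by positivity) (pow_le_one₀ (norm_nonneg _) (hd k))

/-- The map `Σ h_k e^{ikψ} ↦ Σ d_k h_k f_k`. -/
def diagMap : contCircle →ₗ[ℂ] H where
  toFun h := f.repr.symm ⟨fun k => d k * fcoeff h.1 k, memlp_diag hd h.2.1⟩
  map_add' h h' := by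
    rw [← map_add]
    congr 1
    ext k
    change d k * fcoeff (h + h' : contCircle).1 k = d k * fcoeff h.1 k + d k * fcoeff h'.1 k
    rw [← mul_add, ← fcoeff_add h.2.1 h'.2.1]
    rfl
  map_smul' c h := by
    rw [RingHom.id_apply, ← map_smul]
    congr 1
    ext k
    change d k * fcoeff (c • h : contCircle).1 k = c * (d k * fcoeff h.1 k)
    have : fcoeff (c • h : contCircle).1 k = c * fcoeff h.1 k := fcoeff_const_mul c h.1 k
    rw [this, mul_left_comm]

theorem repr_diagMap (h : contCircle) (k : ℤ) :
    f.repr (diagMap f hd h) k = d k * fcoeff h.1 k := by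
  change f.repr (f.repr.symm _) k = _
  rw [LinearIsometryEquiv.apply_symm_apply]

theorem norm_sq_diagMap (h : contCircle) :
    ‖diagMap f hd h‖ ^ 2 = ∑' k, ‖d k * fcoeff h.1 k‖ ^ 2 := by
  rw [← f.repr.norm_map]
  have := lp.norm_rpow_eq_tsum (p := 2) (by norm_num) (f.repr (diagMap f hd h))
  simp only [ENNReal.toReal_ofNat, Real.rpow_ofNat, repr_diagMap] at this
  exact this

/-- By Parseval and |d_k| ≤ 1 the norm is at most the L² norm for normalised measure, hence at most
the supremum. Uniform estimates on the circle thus become estimates in `H`. -/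
theorem norm_diagMap_le (h : contCircle) {M : ℝ} (hM : ∀ ψ, ‖h.1 ψ‖ ≤ M) :
    ‖diagMap f hd h‖ ≤ M := by
  have hpi : (0 : ℝ) < 2 * Real.pi := by positivity
  have hM0 : 0 ≤ M := (norm_nonneg _).trans (hM 0)
  refine (sq_le_sq₀ (norm_nonneg _) hM0).1 ?_
  have h1 := hasSum_sq_fcoeff h.2.1
  have h2 : ∫ ψ in (0 : ℝ)..2 * Real.pi, ‖h.1 ψ‖ ^ 2 ≤
      ∫ ψ in (0 : ℝ)..2 * Real.pi, M ^ 2 := by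
    have := h.2.1
    exact intervalIntegral.integral_mono_on hpi.le
      ((by fun_prop : Continuous fun ψ => ‖h.1 ψ‖ ^ 2).intervalIntegrable _ _)
      (continuous_const.intervalIntegrable _ _)
      fun ψ _ => pow_le_pow_left₀ (norm_nonneg _) (hM ψ) 2
  rw [intervalIntegral.integral_const, sub_zero, smul_eq_mul] at h2
  have hle : ∀ k, ‖d k * fcoeff h.1 k‖ ^ 2 ≤ ‖fcoeff h.1 k‖ ^ 2 := fun k => by
    rw [norm_mul, mul_pow]
    exact mul_le_of_le_one_left (by positivity) (pow_le_one₀ (norm_nonneg _) (hd k))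
  rw [norm_sq_diagMap]
  calc ∑' k, ‖d k * fcoeff h.1 k‖ ^ 2 ≤ ∑' k, ‖fcoeff h.1 k‖ ^ 2 :=
        (Summable.of_nonneg_of_le (fun _ => by positivity) hle h1.summable).tsum_le_tsum hle
          h1.summable
    _ = (2 * Real.pi)⁻¹ * ∫ ψ in (0 : ℝ)..2 * Real.pi, ‖h.1 ψ‖ ^ 2 := h1.tsum_eq
    _ ≤ (2 * Real.pi)⁻¹ * (2 * Real.pi * M ^ 2) := by gcongr
    _ = M ^ 2 := by field_simp

end DiagMap

/-- Mean value inequality with uniform continuity of the derivative on [-1, 1] × [0, 2π];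
periodicity covers all ψ. -/
theorem uniform_deriv {g G : ℝ → ℝ → ℂ} (hg : ∀ t ψ, HasDerivAt (fun t => g t ψ) (G t ψ) t)
    (hG : Continuous fun p : ℝ × ℝ => G p.1 p.2)
    (hp : ∀ t, Function.Periodic (g t) (2 * Real.pi))
    (hp' : ∀ t, Function.Periodic (G t) (2 * Real.pi)) {ε : ℝ} (hε : 0 < ε) :
    ∃ δ > 0, ∀ t, |t| < δ → ∀ ψ, ‖g t ψ - g 0 ψ - t * G 0 ψ‖ ≤ ε * |t| := by
  have hcomp : IsCompact (Set.Icc (-1 : ℝ) 1 ×ˢ Set.Icc (0 : ℝ) (2 * Real.pi)) :=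
    isCompact_Icc.prod isCompact_Icc
  have huc := hcomp.uniformContinuousOn_of_continuous hG.continuousOn
  obtain ⟨δ, hδ, h⟩ := Metric.uniformContinuousOn_iff.1 huc ε hε
  refine ⟨min δ 1, by positivity, fun t ht ψ => ?_⟩
  wlog hψ : ψ ∈ Set.Ico 0 (2 * Real.pi) generalizing ψ with H
  · have hper : Function.Periodic (fun ψ => g t ψ - g 0 ψ - t * G 0 ψ) (2 * Real.pi) := fun ψ => by
      simp only [hp t ψ, hp 0 ψ, hp' 0 ψ]
    obtain ⟨z, hz, h1⟩ := hper.exists_mem_Ico₀ (by positivity) ψ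
    rw [h1]
    exact H z hz
  have hder : ∀ s ∈ Metric.ball (0 : ℝ) (min δ 1), HasDerivWithinAt
      (fun s => g s ψ - s * G 0 ψ) (G s ψ - G 0 ψ) (Metric.ball 0 (min δ 1)) s := by
    intro s _
    have h1 : HasDerivAt (fun s : ℝ => (s : ℂ) * G 0 ψ) (G 0 ψ) s := by
      simpa using (hasDerivAt_id s).ofReal_comp.mul_const (G 0 ψ)
    exact ((hg s ψ).sub h1).hasDerivWithinAt
  have hbound : ∀ s ∈ Metric.ball (0 : ℝ) (min δ 1), ‖G s ψ - G 0 ψ‖ ≤ ε := by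
    intro s hs
    rw [mem_ball_zero_iff, Real.norm_eq_abs, lt_min_iff] at hs
    have := h (s, ψ) ⟨⟨by linarith [(abs_lt.1 hs.2).1], by linarith [(abs_lt.1 hs.2).2]⟩,
      hψ.1, hψ.2.le⟩ (0, ψ) ⟨⟨by norm_num, by norm_num⟩, hψ.1, hψ.2.le⟩ (by
        rw [Prod.dist_eq]; simpa using hs.1)
    rw [dist_eq_norm] at this
    exact this.le
  have := (convex_ball (0 : ℝ) (min δ 1)).norm_image_sub_le_of_norm_hasDerivWithin_le hder hbound
    (Metric.mem_ball_self (by positivity)) (y := t) (by simpa using ht)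
  rw [sub_zero, Real.norm_eq_abs] at this
  rwa [ofReal_zero, zero_mul, sub_zero, sub_right_comm] at this

/-! ### The light cone -/

/-- The forward light cone. -/
def cone : Set (Fin 3 → ℝ) := {v | 0 < v 0 ∧ v 0 ^ 2 = v 1 ^ 2 + v 2 ^ 2}

/-- The point of the cone over a point of the circle. -/
def circlePt (ψ : ℝ) : Fin 3 → ℝ := ![1, -Real.sin ψ, Real.cos ψ]

theorem circlePt_mem (ψ : ℝ) : circlePt ψ ∈ cone := by
  constructor
  · simp [circlePt]
  · simp [circlePt]

theorem lorentz_mulVec_mem (Λ : SO012) {v : Fin 3 → ℝ} (hv : v ∈ cone) :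
    Λ.1.1.mulVec v ∈ cone := by
  obtain ⟨h0, h1⟩ := hv
  have hΛ := Λ.2.1
  have hrow := lorentz_row hΛ
  have hpos : 0 < Λ.1.1 0 0 := Λ.2.2.2
  have hquad : ∀ w : Fin 3 → ℝ, w ⬝ᵥ eta.mulVec w = w 0 ^ 2 - w 1 ^ 2 - w 2 ^ 2 := by
    intro w
    simp [eta, dotProduct, Matrix.mulVec_diagonal, Fin.sum_univ_three]
    ring
  have hinv : Λ.1.1.mulVec v ⬝ᵥ eta.mulVec (Λ.1.1.mulVec v) = v ⬝ᵥ eta.mulVec v := by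
    conv_rhs => rw [← hΛ]
    rw [← Matrix.mulVec_mulVec, ← Matrix.mulVec_mulVec, Matrix.dotProduct_mulVec v,
      Matrix.vecMul_transpose]
  rw [hquad, hquad] at hinv
  refine ⟨?_, by linarith⟩
  have e : Λ.1.1.mulVec v 0 = Λ.1.1 0 0 * v 0 + Λ.1.1 0 1 * v 1 + Λ.1.1 0 2 * v 2 := by
    simp [Matrix.mulVec, dotProduct, Fin.sum_univ_three]
  rw [e]
  set a := Λ.1.1 0 0
  -- Cauchy–Schwarz: the square is at most (Λ₀₁² + Λ₀₂²)(v₁² + v₂²) = (Λ₀₀² - 1) v₀².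
  have h3 : (Λ.1.1 0 1 * v 1 + Λ.1.1 0 2 * v 2) ^ 2 < (a * v 0) ^ 2 := by
    have : 0 < v 0 ^ 2 := by positivity
    nlinarith [sq_nonneg (Λ.1.1 0 1 * v 2 - Λ.1.1 0 2 * v 1)]
  have := (abs_lt.1 (abs_lt_of_sq_lt_sq h3 (by positivity))).1
  linarith

/-- The degree of homogeneity is `-(1 + s⁺)`. -/
def homDeg : ℂ := 1 + P.sPlus

/-- Homogeneous functions of degree `-(1 + s⁺)` on the light cone. -/
def coneFn : Submodule ℂ ((Fin 3 → ℝ) → ℂ) where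
  carrier := {F | ∀ v ∈ cone, ContDiffAt ℝ 1 F v ∧
    ∀ a : ℝ, 0 < a → F (a • v) = cexp (-homDeg P * (Real.log a : ℝ)) * F v}
  zero_mem' := fun v _ => ⟨contDiffAt_const, by simp⟩
  add_mem' := fun hF hG v hv => ⟨(hF v hv).1.add (hG v hv).1, fun a ha => by
    rw [Pi.add_apply, (hF v hv).2 a ha, (hG v hv).2 a ha, Pi.add_apply, mul_add]⟩
  smul_mem' := fun c F hF v hv => ⟨contDiffAt_const.smul (hF v hv).1, fun a ha => by
    rw [Pi.smul_apply, (hF v hv).2 a ha, Pi.smul_apply, smul_eq_mul, smul_eq_mul, mul_left_comm]⟩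

theorem lorentz_apply_mem (Λ : SO012) {F : (Fin 3 → ℝ) → ℂ} (hF : F ∈ coneFn P) :
    (fun v => F (Λ.1.1.mulVec v)) ∈ coneFn P := by
  intro v hv
  have h := hF _ (lorentz_mulVec_mem Λ hv)
  refine ⟨?_, fun a ha => ?_⟩
  · exact h.1.comp v (Matrix.mulVecLin Λ.1.1).toContinuousLinearMap.contDiff.contDiffAt
  · change F (Λ.1.1.mulVec (a • v)) = _
    rw [Matrix.mulVec_smul]
    exact h.2 a ha

/-- The action of the Lorentz group on homogeneous functions. -/
def coneAct (Λ : SO012) : coneFn P ≃ₗ[ℂ] coneFn P where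
  toFun F := ⟨fun v => F.1 ((Λ⁻¹).1.1.mulVec v), lorentz_apply_mem P Λ⁻¹ F.2⟩
  invFun F := ⟨fun v => F.1 (Λ.1.1.mulVec v), lorentz_apply_mem P Λ F.2⟩
  map_add' _ _ := rfl
  map_smul' _ _ := rfl
  left_inv F := by
    ext v
    change F.1 ((Λ⁻¹).1.1.mulVec (Λ.1.1.mulVec v)) = F.1 v
    rw [Matrix.mulVec_mulVec, Subgroup.coe_inv, Units.inv_mul, Matrix.one_mulVec]
  right_inv F := by
    ext v
    change F.1 (Λ.1.1.mulVec ((Λ⁻¹).1.1.mulVec v)) = F.1 v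
    rw [Matrix.mulVec_mulVec, Subgroup.coe_inv, Units.mul_inv, Matrix.one_mulVec]

theorem coneAct_mul (Λ Λ' : SO012) (F : coneFn P) :
    coneAct P (Λ * Λ') F = coneAct P Λ (coneAct P Λ' F) := by
  ext v
  change F.1 (((Λ * Λ')⁻¹).1.1.mulVec v) = F.1 ((Λ'⁻¹).1.1.mulVec ((Λ⁻¹).1.1.mulVec v))
  rw [Matrix.mulVec_mulVec, mul_inv_rev]
  rfl

theorem continuous_circlePt : Continuous circlePt := by
  unfold circlePt
  refine continuous_pi fun i => ?_
  fin_cases i <;> simp <;> fun_prop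

/-- Restriction of homogeneous functions to the circle. -/
def coneRestr : coneFn P →ₗ[ℂ] contCircle where
  toFun F := ⟨fun ψ => F.1 (circlePt ψ), continuous_iff_continuousAt.2 fun ψ =>
    ContinuousAt.comp (f := circlePt) (F.2 _ (circlePt_mem ψ)).1.continuousAt
      continuous_circlePt.continuousAt, fun ψ => by simp [circlePt]⟩
  map_add' _ _ := rfl
  map_smul' _ _ := rfl

/-- The homogeneous extension of `e^{ikψ}`. -/
def coneChar (k : ℤ) : coneFn P :=
  ⟨fun v => cexp (-homDeg P * (Real.log (v 0) : ℝ)) * (((v 2 : ℂ) - I * v 1) / v 0) ^ k, by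
    intro v hv
    have h0 := hv.1
    -- Needed for negative powers. On the circle this number is e^{iψ}.
    have hz : (v 2 : ℂ) - I * v 1 ≠ 0 := by
      intro h
      have h1 := congrArg re h
      have h2 := congrArg im h
      simp at h1 h2
      have := hv.2
      rw [h1, h2] at this
      have : v 0 ^ 2 = 0 := by rw [this]; ring
      exact h0.ne' (pow_eq_zero_iff two_ne_zero |>.1 this)
    have hv0 : (v 0 : ℂ) ≠ 0 := by exact_mod_cast h0.ne'
    refine ⟨?_, fun a ha => ?_⟩
    · have hproj : ∀ i : Fin 3, ContDiffAt ℝ 1 (fun v : Fin 3 → ℝ => v i) v := fun i =>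
        (contDiff_apply ℝ ℝ i).contDiffAt
      have hprojC : ∀ i : Fin 3, ContDiffAt ℝ 1 (fun v : Fin 3 → ℝ => (v i : ℂ)) v := fun i =>
        ofRealCLM.contDiff.contDiffAt.comp v (hproj i)
      have hlog : ContDiffAt ℝ 1 (fun v : Fin 3 → ℝ => ((Real.log (v 0) : ℝ) : ℂ)) v :=
        ofRealCLM.contDiff.contDiffAt.comp v ((hproj 0).log h0.ne')
      refine (contDiffAt_const.mul hlog).cexp.mul ?_
      have hw : ContDiffAt ℝ 1 (fun v : Fin 3 → ℝ => ((v 2 : ℂ) - I * v 1) / v 0) v :=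
        by
          simp only [div_eq_mul_inv]
          exact ((hprojC 2).sub (contDiffAt_const.mul (hprojC 1))).mul ((hprojC 0).inv hv0)
      cases k with
      | ofNat n => simpa only [Int.ofNat_eq_natCast, zpow_natCast] using hw.pow n
      | negSucc n =>
        simp only [zpow_negSucc]
        exact (hw.pow (n + 1)).inv (pow_ne_zero _ (div_ne_zero hz hv0))
    · have ha' : (a : ℂ) ≠ 0 := by exact_mod_cast ha.ne'
      simp only [Pi.smul_apply, smul_eq_mul]
      rw [Real.log_mul ha.ne' h0.ne', ← mul_assoc, ← Complex.exp_add]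
      congr 2
      · push_cast; ring
      · push_cast; field_simp⟩

theorem coneRestr_coneChar (k : ℤ) : (coneRestr P (coneChar P k)).1 = expFn k := by
  funext ψ
  change cexp (-homDeg P * (Real.log (circlePt ψ 0) : ℝ)) *
    (((circlePt ψ 2 : ℂ) - I * circlePt ψ 1) / circlePt ψ 0) ^ k = expFn k ψ
  simp only [circlePt, Matrix.cons_val_zero, Matrix.cons_val_one, Matrix.cons_val]
  have : (Real.cos ψ : ℂ) - I * (-Real.sin ψ : ℝ) = cexp (I * ψ) := by
    rw [mul_comm I (ψ : ℂ), Complex.exp_mul_I]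
    push_cast; ring
  simp only [Real.log_one, ofReal_zero, mul_zero, Complex.exp_zero, one_mul, ofReal_one, div_one]
  rw [this, ← Complex.exp_int_mul, expFn]
  congr 1; push_cast; ring

theorem contDiffAt_fderiv (F : coneFn P) {v : Fin 3 → ℝ} (hv : v ∈ cone) :
    ContinuousAt (fderiv ℝ F.1) v :=
  ((F.2 v hv).1.fderiv_right (m := 0) (by norm_num)).continuousAt

theorem hasFDerivAt_coneFn (F : coneFn P) {v : Fin 3 → ℝ} (hv : v ∈ cone) :
    HasFDerivAt F.1 (fderiv ℝ F.1 v) v :=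
  ((F.2 v hv).1.differentiableAt (by norm_num)).hasFDerivAt

/-- Euler's identity: differentiate F(av) = a^{-(1+s⁺)} F(v) at a = 1. -/
theorem fderiv_coneFn_self (F : coneFn P) {v : Fin 3 → ℝ} (hv : v ∈ cone) :
    fderiv ℝ F.1 v v = -homDeg P * F.1 v := by
  have h1 : HasDerivAt (fun a : ℝ => F.1 (a • v)) (fderiv ℝ F.1 v v) 1 := by
    have h2 : HasDerivAt (fun a : ℝ => a • v) v 1 := by
      simpa using (hasDerivAt_id (1 : ℝ)).smul_const v
    have h3 : HasFDerivAt F.1 (fderiv ℝ F.1 v) ((1 : ℝ) • v) := by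
      rw [one_smul]; exact hasFDerivAt_coneFn P F hv
    exact h3.comp_hasDerivAt 1 h2
  have h2 : HasDerivAt (fun a : ℝ => cexp (-homDeg P * (Real.log a : ℝ)) * F.1 v)
      (-homDeg P * F.1 v) 1 := by
    have h3 := ((Real.hasDerivAt_log one_ne_zero).ofReal_comp.const_mul (-homDeg P)).cexp.mul_const
      (F.1 v)
    simpa using h3
  refine h1.unique (h2.congr_of_eventuallyEq ?_)
  filter_upwards [lt_mem_nhds (zero_lt_one (α := ℝ))] with a ha
  exact (F.2 v hv).2 a ha

/-- The derivative of the restriction to the circle. -/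
def coneDer (F : coneFn P) (ψ : ℝ) : ℂ :=
  fderiv ℝ F.1 (circlePt ψ) ![0, -Real.cos ψ, -Real.sin ψ]

theorem hasDerivAt_coneRestr (F : coneFn P) (ψ : ℝ) :
    HasDerivAt (coneRestr P F).1 (coneDer P F ψ) ψ := by
  have h1 : HasDerivAt circlePt ![0, -Real.cos ψ, -Real.sin ψ] ψ := by
    rw [hasDerivAt_pi]
    intro i
    fin_cases i
    · simpa [circlePt] using hasDerivAt_const ψ (1 : ℝ)
    · simpa [circlePt] using (Real.hasDerivAt_sin ψ).fun_neg
    · simpa [circlePt] using Real.hasDerivAt_cos ψ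
  exact (hasFDerivAt_coneFn P F (circlePt_mem ψ)).comp_hasDerivAt ψ h1

theorem continuous_fderiv_apply (F : coneFn P) {X : Type*} [TopologicalSpace X]
    {p w : X → Fin 3 → ℝ} (hp : Continuous p) (hpc : ∀ x, p x ∈ cone) (hw : Continuous w) :
    Continuous fun x => fderiv ℝ F.1 (p x) (w x) := by
  have h1 : Continuous fun x => fderiv ℝ F.1 (p x) := continuous_iff_continuousAt.2 fun x =>
    ContinuousAt.comp (f := p) (contDiffAt_fderiv P F (hpc x)) hp.continuousAt
  exact h1.clm_apply hw

theorem continuous_vec3 {X : Type*} [TopologicalSpace X] {a b c : X → ℝ} (ha : Continuous a)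
    (hb : Continuous b) (hc : Continuous c) : Continuous fun x => ![a x, b x, c x] := by
  refine continuous_pi fun i => ?_
  fin_cases i <;> simpa

theorem continuous_coneDer (F : coneFn P) : Continuous (coneDer P F) :=
  continuous_fderiv_apply P F continuous_circlePt circlePt_mem
    (continuous_vec3 (by fun_prop) (by fun_prop) (by fun_prop))

/-! ### Boosts and rotations acting on the cone -/

theorem Lambda1_mulVec (t : ℝ) (ψ : ℝ) : (Lambda1 t).1.1.mulVec (circlePt ψ) =
    ![Real.cosh t + Real.sinh t * Real.cos ψ, -Real.sin ψ,
      Real.sinh t + Real.cosh t * Real.cos ψ] := by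
  ext i
  fin_cases i <;> simp [Lambda1, SO012.mk, circlePt, Matrix.mulVec, dotProduct, Fin.sum_univ_three]

theorem SO012.ext {Λ Λ' : SO012} (h : ∀ i j, Λ.1.1 i j = Λ'.1.1 i j) : Λ = Λ' :=
  Subtype.ext (Units.ext (Matrix.ext h))

theorem SO012.mul_apply (Λ Λ' : SO012) (i j : Fin 3) : (Λ * Λ').1.1 i j =
    Λ.1.1 i 0 * Λ'.1.1 0 j + Λ.1.1 i 1 * Λ'.1.1 1 j + Λ.1.1 i 2 * Λ'.1.1 2 j := by
  change (Λ.1.1 * Λ'.1.1) i j = _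
  rw [Matrix.mul_apply, Fin.sum_univ_three]

theorem SO012.one_apply (i j : Fin 3) : (1 : SO012).1.1 i j = if i = j then 1 else 0 := by
  change (1 : Matrix (Fin 3) (Fin 3) ℝ) i j = _
  rw [Matrix.one_apply]

theorem SO012.mk_apply (A : Matrix (Fin 3) (Fin 3) ℝ) (h h1 h0) (i j : Fin 3) :
    (SO012.mk A h h1 h0).1.1 i j = A i j := rfl

theorem Lambda1_add (s t : ℝ) : Lambda1 (s + t) = Lambda1 s * Lambda1 t := by
  refine SO012.ext fun i j => ?_
  rw [SO012.mul_apply]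
  simp only [Lambda1, SO012.mk_apply]
  fin_cases i <;> fin_cases j <;> simp [Real.cosh_add, Real.sinh_add] <;> ring

theorem R0_add (s t : ℝ) : R0 (s + t) = R0 s * R0 t := by
  refine SO012.ext fun i j => ?_
  rw [SO012.mul_apply]
  simp only [R0, SO012.mk_apply]
  fin_cases i <;> fin_cases j <;> simp [Real.cos_add, Real.sin_add] <;> ring

theorem Lambda1_zero : Lambda1 0 = 1 := by
  refine SO012.ext fun i j => ?_
  rw [SO012.one_apply]
  simp only [Lambda1, SO012.mk_apply]
  fin_cases i <;> fin_cases j <;> simp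

theorem R0_zero : R0 0 = 1 := by
  refine SO012.ext fun i j => ?_
  rw [SO012.one_apply]
  simp only [R0, SO012.mk_apply]
  fin_cases i <;> fin_cases j <;> simp

theorem Lambda1_inv (t : ℝ) : (Lambda1 t)⁻¹ = Lambda1 (-t) := by
  rw [inv_eq_iff_mul_eq_one, ← Lambda1_add, add_neg_cancel, Lambda1_zero]

theorem R0_inv (t : ℝ) : (R0 t)⁻¹ = R0 (-t) := by
  rw [inv_eq_iff_mul_eq_one, ← R0_add, add_neg_cancel, R0_zero]

/-- The infinitesimal boost on homogeneous functions, restricted to the circle. -/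
def coneGen (F : coneFn P) : contCircle :=
  ⟨fun ψ => homDeg P * Real.cos ψ * (coneRestr P F).1 ψ + Real.sin ψ * coneDer P F ψ, by
    have h1 := (coneRestr P F).2.1
    have h2 := continuous_coneDer P F
    exact (by fun_prop), fun ψ => by
    have h1 := (coneRestr P F).2.2 ψ
    simp only [h1, coneDer, circlePt, Real.cos_add_two_pi, Real.sin_add_two_pi]⟩

variable {H : Type*} [NormedAddCommGroup H] [InnerProductSpace ℂ H]
  (f : HilbertBasis ℤ ℂ H) {d : ℤ → ℂ} (hd : ∀ k, ‖d k‖ ≤ 1)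

/-- The pointwise derivative in t holds uniformly in ψ, and `norm_diagMap_le` carries the uniform
estimate to `H`. -/
theorem hasDerivAt_diagMap_boost (F : coneFn P) :
    HasDerivAt (fun t => diagMap f hd (coneRestr P (coneAct P (Lambda1 t) F)))
      (diagMap f hd (coneGen P F)) 0 := by
  set p : ℝ → ℝ → Fin 3 → ℝ := fun t ψ => ![Real.cosh t - Real.sinh t * Real.cos ψ, -Real.sin ψ,
      -Real.sinh t + Real.cosh t * Real.cos ψ] with hp
  set w : ℝ → ℝ → Fin 3 → ℝ := fun t ψ => ![Real.sinh t - Real.cosh t * Real.cos ψ, 0,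
      -Real.cosh t + Real.sinh t * Real.cos ψ] with hw
  have hpe : ∀ t ψ, (Lambda1 (-t)).1.1.mulVec (circlePt ψ) = p t ψ := fun t ψ => by
    rw [Lambda1_mulVec, Real.cosh_neg, Real.sinh_neg, hp]
    simp only [neg_mul, ← sub_eq_add_neg]
  have hpc : ∀ t ψ, p t ψ ∈ cone := fun t ψ => by
    rw [← hpe]; exact lorentz_mulVec_mem _ (circlePt_mem ψ)
  have hval : ∀ t ψ, (coneRestr P (coneAct P (Lambda1 t) F)).1 ψ = F.1 (p t ψ) := fun t ψ => by
    rw [← hpe, ← Lambda1_inv]; rfl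
  have hder : ∀ t ψ, HasDerivAt (fun t => F.1 (p t ψ)) (fderiv ℝ F.1 (p t ψ) (w t ψ)) t := by
    intro t ψ
    have h1 : HasDerivAt (fun t => p t ψ) (w t ψ) t := by
      rw [hasDerivAt_pi]
      have hc := Real.hasDerivAt_cosh t
      have hs := Real.hasDerivAt_sinh t
      intro i
      fin_cases i
      · simpa [hp, hw] using hc.fun_sub (hs.mul_const (Real.cos ψ))
      · simpa [hp, hw] using hasDerivAt_const t (-Real.sin ψ)
      · simpa [hp, hw] using hs.fun_neg.fun_add (hc.mul_const (Real.cos ψ))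
    exact (hasFDerivAt_coneFn P F (hpc t ψ)).comp_hasDerivAt t h1
  have hcont : Continuous fun q : ℝ × ℝ => fderiv ℝ F.1 (p q.1 q.2) (w q.1 q.2) := by
    have c1 := Real.continuous_cosh
    have c2 := Real.continuous_sinh
    exact continuous_fderiv_apply P F (p := fun q : ℝ × ℝ => p q.1 q.2)
      (w := fun q : ℝ × ℝ => w q.1 q.2)
      (continuous_vec3 (by fun_prop) (by fun_prop) (by fun_prop)) (fun q => hpc q.1 q.2)
      (continuous_vec3 (by fun_prop) (by fun_prop) (by fun_prop))
  have hgen : ∀ ψ, (coneGen P F).1 ψ = fderiv ℝ F.1 (p 0 ψ) (w 0 ψ) := by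
    intro ψ
    have e1 : p 0 ψ = circlePt ψ := by simp [hp, circlePt]
    -- The velocity of the boosted point splits into a radial part, on which Euler's identity acts,
    -- and a part tangent to the circle.
    have e2 : w 0 ψ = (-Real.cos ψ) • circlePt ψ +
        Real.sin ψ • ![0, -Real.cos ψ, -Real.sin ψ] := by
      have := Real.sin_sq_add_cos_sq ψ
      ext i
      fin_cases i
      · simp [hw, circlePt]
      · simp [hw, circlePt]; ring
      · simp [hw, circlePt]; nlinarith
    rw [e1, e2, map_add, map_smul, map_smul, fderiv_coneFn_self P F (circlePt_mem ψ)]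
    change homDeg P * Real.cos ψ * F.1 (circlePt ψ) + Real.sin ψ * coneDer P F ψ = _
    rw [Complex.real_smul, Complex.real_smul, coneDer]
    push_cast; ring
  rw [hasDerivAt_iff_isLittleO, Asymptotics.isLittleO_iff]
  intro ε hε
  obtain ⟨δ, hδ, h⟩ := uniform_deriv hder hcont (fun t ψ => by simp [hp])
    (fun t ψ => by simp [hp, hw]) hε
  filter_upwards [Metric.ball_mem_nhds (0 : ℝ) hδ] with t ht
  rw [mem_ball_zero_iff, Real.norm_eq_abs] at ht
  rw [sub_zero, Real.norm_eq_abs, ← Complex.coe_smul, ← map_smul, ← map_sub, ← map_sub]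
  refine norm_diagMap_le f hd _ fun ψ => ?_
  have := h t ht ψ
  rw [← hval, ← hval, ← hgen] at this
  exact this

/-! ### The intertwiner with homogeneous functions -/

theorem exists_int_recurrence {c : ℤ → ℂ} (hc : ∀ k, c k ≠ 0) :
    ∃ d : ℤ → ℂ, d 0 = 1 ∧ ∀ k, d (k + 1) = c k * d k := by
  refine ⟨fun k => if 0 ≤ k then ∏ j ∈ Finset.range k.toNat, c j
    else ∏ j ∈ Finset.range (-k).toNat, (c (-j - 1))⁻¹, by simp, fun k => ?_⟩
  rcases le_or_gt 0 k with h | h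
  · obtain ⟨n, rfl⟩ := Int.eq_ofNat_of_zero_le h
    simp only
    rw [if_pos h, if_pos (by omega), show ((n : ℤ) + 1).toNat = n + 1 by omega,
      Int.toNat_natCast, Finset.prod_range_succ, mul_comm]
  · obtain ⟨n, hn⟩ := Int.eq_ofNat_of_zero_le (show 0 ≤ -k - 1 by omega)
    obtain rfl : k = -n - 1 := by omega
    have e : (if 0 ≤ -(n : ℤ) - 1 + 1 then ∏ j ∈ Finset.range (-(n : ℤ) - 1 + 1).toNat, c j
        else ∏ j ∈ Finset.range (-(-(n : ℤ) - 1 + 1)).toNat, (c (-j - 1))⁻¹) =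
        ∏ j ∈ Finset.range n, (c (-j - 1))⁻¹ := by
      rw [sub_add_cancel, neg_neg, Int.toNat_natCast]
      split_ifs with h0
      · obtain rfl : n = 0 := by omega
        simp
      · rfl
    refine e.trans ?_
    beta_reduce
    rw [if_neg (by omega), show (-(-(n : ℤ) - 1)).toNat = n + 1 by omega, Finset.prod_range_succ,
      mul_comm (∏ j ∈ Finset.range n, _), mul_inv_cancel_left₀ (hc _)]

theorem int_add_homDeg_ne_zero (k : ℤ) : (k : ℂ) + homDeg P ≠ 0 := by
  have := int_add_sPlus_ne_zero P (k + 1)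
  rw [homDeg]
  push_cast at this
  rwa [← add_assoc]

/-- With δ = 1 + s⁺ the left side is (k+1+s⁺)(k-s⁺). Hence (k+δ)/2 and (k+1-δ)/2, which up to sign
are opposite off-diagonal entries of the infinitesimal boost, have the product a_k². -/
theorem homDeg_mul (k : ℤ) : ((k : ℂ) + homDeg P) * (k + 1 - homDeg P) =
    (k * (k + 1) + P.zeta ^ 2 : ℝ) := by
  have := P.sPlus_eq
  rw [homDeg]
  push_cast
  linear_combination this

theorem four_mul_ladder_sq (k : ℤ) :
    4 * ladder P k ^ 2 = ‖(k : ℂ) + homDeg P‖ * ‖(k : ℂ) + 1 - homDeg P‖ := by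
  rw [← norm_mul, homDeg_mul, Complex.norm_real, Real.norm_of_nonneg (quad_pos P k).le, ladder_sq]
  ring

/-- Imaginary parts cancel. The difference vanishes in the principal series, where Re δ = 1/2;
otherwise its sign is that of 2k+1. -/
theorem normSq_homDeg_sub (k : ℤ) : ‖(k : ℂ) + homDeg P‖ ^ 2 - ‖(k : ℂ) + 1 - homDeg P‖ ^ 2 =
    (2 * (homDeg P).re - 1) * (2 * k + 1) := by
  rw [Complex.sq_norm, Complex.sq_norm, normSq_apply, normSq_apply]
  simp
  ring

theorem homDeg_re : 0 ≤ 2 * (homDeg P).re - 1 := by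
  have := P.sPlus_re.1
  simp only [homDeg, add_re, one_re]
  linarith

/-- The recursion gives |d_{k+1}/d_k|² = |k+1-δ| / |k+δ|, which is at most 1 for k ≥ 0 and at least
1 for k < 0. So |d_k| is largest at k = 0, where d₀ = 1. In the principal series all |d_k| are 1. -/
theorem exists_ladderPhase : ∃ d : ℤ → ℂ,
    (∀ k, d (k + 1) * (k + homDeg P) = 2 * I * ladder P k * d k) ∧ ∀ k, ‖d k‖ ≤ 1 ∧ d k ≠ 0 := by
  have hne := int_add_homDeg_ne_zero P
  have ha : ∀ k, (ladder P k : ℂ) ≠ 0 := fun k => by exact_mod_cast (ladder_pos P k).ne'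
  obtain ⟨d, hd0, hd⟩ := exists_int_recurrence
    (c := fun k => 2 * I * ladder P k / (k + homDeg P))
    fun k => div_ne_zero (mul_ne_zero (mul_ne_zero two_ne_zero I_ne_zero) (ha k)) (hne k)
  have hrec : ∀ k, d (k + 1) * (k + homDeg P) = 2 * I * ladder P k * d k := fun k => by
    rw [hd]
    have := hne k
    field_simp
  have hrecn : ∀ k : ℤ, ‖d (k + 1)‖ * ‖(k : ℂ) + homDeg P‖ = 2 * ladder P k * ‖d k‖ := fun k => by
    rw [← norm_mul, hrec, norm_mul, norm_mul, norm_mul, norm_I, Complex.norm_real,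
      Real.norm_of_nonneg (ladder_pos P k).le]
    simp
  refine ⟨d, hrec, fun k => ?_⟩
  induction k using Int.induction_on with
  | zero => rw [hd0]; simp
  | succ n ih =>
    obtain ⟨h1, h2⟩ := ih
    refine ⟨?_, ?_⟩
    · have h3 := hrecn n
      have h4 := four_mul_ladder_sq P n
      have h5 := normSq_homDeg_sub P n
      have h6 := homDeg_re P
      have h7 := ladder_pos P n
      have h8 : 0 < ‖((n : ℤ) : ℂ) + homDeg P‖ := norm_pos_iff.2 (hne n)
      have h9 : 0 ≤ (2 * (homDeg P).re - 1) * (2 * (n : ℤ) + 1) := mul_nonneg h6 (by positivity)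
      have h10 : ‖((n : ℤ) : ℂ) + 1 - homDeg P‖ ≤ ‖((n : ℤ) : ℂ) + homDeg P‖ :=
        (sq_le_sq₀ (norm_nonneg _) (norm_nonneg _)).1 (by linarith)
      have h11 : 2 * ladder P n ≤ ‖((n : ℤ) : ℂ) + homDeg P‖ := by
        refine (sq_le_sq₀ (by positivity) (norm_nonneg _)).1 ?_
        rw [mul_pow]
        nlinarith
      by_contra! hlt
      nlinarith
    · intro h
      have := hrec n
      rw [h, zero_mul] at this
      have h3 := ha n
      simp_all
  | pred n ih =>
    obtain ⟨h1, h2⟩ := ih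
    refine ⟨?_, ?_⟩
    · have h3 := hrecn (-n - 1)
      have h4 := four_mul_ladder_sq P (-n - 1)
      have h5 := normSq_homDeg_sub P (-n - 1)
      have h6 := homDeg_re P
      have h7 := ladder_pos P (-n - 1)
      rw [sub_add_cancel] at h3
      set z := ((-n - 1 : ℤ) : ℂ)
      have hn : (0 : ℝ) ≤ n := by positivity
      have h9 : 0 ≤ (2 * (homDeg P).re - 1) * (-(2 * ((-n - 1 : ℤ) : ℝ) + 1)) :=
        mul_nonneg h6 (by push_cast; linarith)
      have h10 : ‖z + homDeg P‖ ≤ ‖z + 1 - homDeg P‖ :=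
        (sq_le_sq₀ (norm_nonneg _) (norm_nonneg _)).1 (by linarith)
      have h11 : ‖z + homDeg P‖ ≤ 2 * ladder P (-n - 1) := by
        refine (sq_le_sq₀ (norm_nonneg _) (by positivity)).1 ?_
        rw [mul_pow]
        nlinarith [norm_nonneg (z + homDeg P)]
      have h12 : 2 * ladder P (-n - 1) * ‖d (-n - 1)‖ ≤ 2 * ladder P (-n - 1) * 1 := by
        rw [← h3]
        exact (mul_le_of_le_one_left (norm_nonneg _) h1).trans (by linarith)
      exact le_of_mul_le_mul_left h12 (by positivity)
    · intro h
      have := hrec (-n - 1)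
      rw [sub_add_cancel, h, mul_zero] at this
      exact (mul_ne_zero h2 (hne _)) this

/-- The coefficients of the intertwiner. -/
def ladderPhase : ℤ → ℂ := (exists_ladderPhase P).choose

theorem ladderPhase_succ (k : ℤ) :
    ladderPhase P (k + 1) * (k + homDeg P) = 2 * I * ladder P k * ladderPhase P k :=
  (exists_ladderPhase P).choose_spec.1 k

theorem norm_ladderPhase_le (k : ℤ) : ‖ladderPhase P k‖ ≤ 1 :=
  ((exists_ladderPhase P).choose_spec.2 k).1

theorem ladderPhase_ne_zero (k : ℤ) : ladderPhase P k ≠ 0 :=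
  ((exists_ladderPhase P).choose_spec.2 k).2

/-- The map from continuous functions on the circle to the time-zero Hilbert space. -/
def contCircleMap : contCircle →ₗ[ℂ] Hilb P := diagMap (hilbBasis P) (norm_ladderPhase_le P)

/-- The intertwiner from homogeneous functions on the cone to the time-zero Hilbert space. -/
def coneMap : coneFn P →ₗ[ℂ] Hilb P := contCircleMap P ∘ₗ coneRestr P

theorem repr_coneMap (F : coneFn P) (k : ℤ) :
    (hilbBasis P).repr (coneMap P F) k = ladderPhase P k * fcoeff (coneRestr P F).1 k :=
  repr_diagMap (hilbBasis P) (norm_ladderPhase_le P) _ _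

theorem coneMap_coneChar (k : ℤ) :
    coneMap P (coneChar P k) = ladderPhase P k • hilbBasis P k := by
  classical
  apply (hilbBasis P).repr.injective
  ext j
  rw [repr_coneMap, coneRestr_coneChar, fcoeff_expFn, map_smul, HilbertBasis.repr_self,
    lp.coeFn_smul, Pi.smul_apply, lp.single_apply, Pi.single_apply, smul_eq_mul]
  split_ifs with h
  · rw [h]
  · simp

theorem denseRange_coneMap : DenseRange (coneMap P) := by
  have h1 : Dense (Submodule.span ℂ (Set.range (hilbBasis P)) : Set (Hilb P)) := by
    rw [Submodule.dense_iff_topologicalClosure_eq_top]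
    exact (hilbBasis P).dense_span
  refine h1.mono ?_
  rw [← LinearMap.coe_range, SetLike.coe_subset_coe, Submodule.span_le]
  rintro _ ⟨k, rfl⟩
  refine ⟨(ladderPhase P k)⁻¹ • coneChar P k, ?_⟩
  rw [map_smul, coneMap_coneChar, smul_smul, inv_mul_cancel₀ (ladderPhase_ne_zero P k), one_smul]

theorem fcoeff_coneGen (F : coneFn P) (k : ℤ) : fcoeff (coneGen P F).1 k =
    (k - 1 + homDeg P) / 2 * fcoeff (coneRestr P F).1 (k - 1) +
      (homDeg P - k - 1) / 2 * fcoeff (coneRestr P F).1 (k + 1) := by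
  have h1 := (coneRestr P F).2.1
  have h2 := continuous_coneDer P F
  have hcos := fcoeff_trig_mul cos_eq_trig h1 (homDeg P) k
  have hsin := fcoeff_trig_mul sin_eq_trig h2 1 k
  have hder := fcoeff_deriv (hasDerivAt_coneRestr P F) h2 (coneRestr P F).2.2
  have e : (coneGen P F).1 = fun ψ =>
      (homDeg P * (⟨Real.cos, Real.continuous_cos⟩ : C(ℝ, ℝ)) ψ * (coneRestr P F).1 ψ) +
      (1 * (⟨Real.sin, Real.continuous_sin⟩ : C(ℝ, ℝ)) ψ * coneDer P F ψ) := by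
    funext ψ
    rw [one_mul]
    rfl
  rw [e, fcoeff_add (by simp only [ContinuousMap.coe_mk]; fun_prop)
    (by simp only [ContinuousMap.coe_mk]; fun_prop), hcos, hsin, hder, hder]
  rw [map_one, map_neg, conj_I]
  push_cast
  linear_combination (-(1 / 2 : ℂ) * ((k - 1) * fcoeff (coneRestr P F).1 (k - 1)) +
    (1 / 2 : ℂ) * ((k + 1) * fcoeff (coneRestr P F).1 (k + 1))) * I_sq

/-- Conjugation by the d_k turns -i times the infinitesimal boost into the Hermitian Jacobi matrix.
One off-diagonal entry is the recursion for d_k; the other also uses `homDeg_mul`. -/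
theorem jacobiRel_coneGen (F : coneFn P) :
    JacobiRel (hilbBasis P) 0 (fun k => (1 : ℂ) * ladder P k) (coneMap P F)
      (-I • contCircleMap P (coneGen P F)) := by
  intro k
  have hne := int_add_homDeg_ne_zero P k
  have h1 := ladderPhase_succ P (k - 1)
  have h2 := ladderPhase_succ P k
  have h3 : (ladder P k : ℂ) ^ 2 * 4 = (k + homDeg P) * (k + 1 - homDeg P) := by
    rw [homDeg_mul, ← ofReal_pow, ladder_sq]
    push_cast; ring
  rw [sub_add_cancel] at h1
  have h4 : -I * ladderPhase P k * ((homDeg P - k - 1) / 2) = ladder P k * ladderPhase P (k + 1) := by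
    apply mul_right_cancel₀ hne
    linear_combination (-(ladder P k : ℂ)) * h2 - (I / 2 * ladderPhase P k) * h3
  have e : (hilbBasis P).repr (-I • contCircleMap P (coneGen P F)) k =
      -I * (ladderPhase P k * fcoeff (coneGen P F).1 k) := by
    rw [map_smul, lp.coeFn_smul, Pi.smul_apply, smul_eq_mul]
    congr 1
    exact repr_diagMap (hilbBasis P) (norm_ladderPhase_le P) _ _
  rw [e, repr_coneMap, repr_coneMap, repr_coneMap, fcoeff_coneGen]
  simp only [one_mul, conj_ofReal, Pi.zero_apply, ofReal_zero, zero_mul, zero_add]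
  push_cast at h1
  linear_combination (-I / 2 * fcoeff (coneRestr P F).1 (k - 1)) * h1 +
    fcoeff (coneRestr P F).1 (k + 1) * h4 -
      (ladder P (k - 1) * ladderPhase P (k - 1) * fcoeff (coneRestr P F).1 (k - 1)) * I_sq

theorem hasDerivAt_coneMap_boost (F : coneFn P) (t : ℝ) :
    HasDerivAt (fun t => coneMap P (coneAct P (Lambda1 t) F))
      (contCircleMap P (coneGen P (coneAct P (Lambda1 t) F))) t := by
  have h0 : HasDerivAt (fun s => coneMap P (coneAct P (Lambda1 s) (coneAct P (Lambda1 t) F)))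
      (contCircleMap P (coneGen P (coneAct P (Lambda1 t) F))) (t - t) := by
    rw [sub_self]
    exact hasDerivAt_diagMap_boost P (hilbBasis P) (norm_ladderPhase_le P) _
  have h1 := HasDerivAt.scomp (h := fun s => s - t) t h0 ((hasDerivAt_id t).sub_const t)
  rw [one_smul] at h1
  refine h1.congr_of_eventuallyEq (Filter.Eventually.of_forall fun s => ?_)
  change _ = coneMap P (coneAct P (Lambda1 (s - t)) (coneAct P (Lambda1 t) F))
  rw [← coneAct_mul, ← Lambda1_add, sub_add_cancel]

/-- The orbit leaves the finite vectors but stays in the domain of the maximal Jacobi operator. This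
operator is symmetric by Carleman, so the derivative of the squared norm is zero. -/
theorem norm_coneMap_boost (F : coneFn P) (t : ℝ) :
    ‖coneMap P (coneAct P (Lambda1 t) F)‖ = ‖coneMap P F‖ := by
  set u : ℝ → Hilb P := fun t => coneMap P (coneAct P (Lambda1 t) F)
  have hd : ∀ t, HasDerivAt (fun t => inner ℂ (u t) (u t)) 0 t := fun t => by
    have h1 := hasDerivAt_coneMap_boost P F t
    have h2 := jacobiRel_coneGen P (coneAct P (Lambda1 t) F)
    have h3 := h2.inner_comm (norm_mul_ladder_le P norm_one) h2
    rw [inner_smul_left, inner_smul_right, map_neg, conj_I, neg_neg] at h3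
    have h4 := h1.inner ℂ h1
    convert! h4 using 1
    apply mul_left_cancel₀ I_ne_zero
    linear_combination h3
  have hconst := is_const_of_deriv_eq_zero (fun t => (hd t).differentiableAt)
    (fun t => (hd t).deriv) t 0
  have h0 : u 0 = coneMap P F := by
    change coneMap P (coneAct P (Lambda1 0) F) = _
    rw [Lambda1_zero]
    congr 1
    ext v
    change F.1 ((1 : SO012)⁻¹.1.1.mulVec v) = F.1 v
    rw [inv_one]
    exact congrArg F.1 (Matrix.one_mulVec v)
  simp only [inner_self_eq_norm_sq_to_K, h0] at hconst
  have h5 : ‖u t‖ ^ 2 = ‖coneMap P F‖ ^ 2 := by exact_mod_cast hconst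
  exact (sq_eq_sq₀ (norm_nonneg _) (norm_nonneg _)).1 h5

theorem fcoeff_translate {h : ℝ → ℂ} (hp : Function.Periodic h (2 * Real.pi)) (α : ℝ) (k : ℤ) :
    fcoeff (fun ψ => h (ψ - α)) k = expFn (-k) α * fcoeff h k := by
  rw [fcoeff_eq_expFn, fcoeff_eq_expFn, mul_left_comm]
  congr 1
  have hper : Function.Periodic (fun ψ => expFn (-k) (ψ + α) * h ψ) (2 * Real.pi) := fun ψ => by
    dsimp only
    rw [hp ψ, add_right_comm, expFn_periodic]
  have h1 := intervalIntegral.integral_comp_sub_right (a := 0) (b := 2 * Real.pi)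
    (fun ψ => expFn (-k) (ψ + α) * h ψ) α
  simp only [sub_add_cancel] at h1
  rw [h1, show (0 : ℝ) - α = -α by ring, show 2 * Real.pi - α = -α + 2 * Real.pi by ring,
    hper.intervalIntegral_add_eq (-α) 0, zero_add, ← intervalIntegral.integral_const_mul]
  congr 1
  funext ψ
  rw [← mul_assoc]
  congr 1
  unfold expFn
  rw [← Complex.exp_add]
  congr 1; push_cast; ring

theorem coneRestr_rotate (F : coneFn P) (α ψ : ℝ) :
    (coneRestr P (coneAct P (R0 α) F)).1 ψ = (coneRestr P F).1 (ψ - α) := by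
  change F.1 ((R0 α)⁻¹.1.1.mulVec (circlePt ψ)) = F.1 (circlePt (ψ - α))
  rw [R0_inv]
  have e : (R0 (-α)).1.1.mulVec (circlePt ψ) = circlePt (ψ - α) := by
    ext i
    simp only [R0, Matrix.mulVec, dotProduct, Fin.sum_univ_three, SO012.mk_apply]
    fin_cases i <;> simp [circlePt, Real.cos_sub, Real.sin_sub] <;> ring
  exact congrArg F.1 e

/-- A rotation multiplies each Fourier coefficient by a phase. -/
theorem norm_coneMap_rotate (F : coneFn P) (α : ℝ) :
    ‖coneMap P (coneAct P (R0 α) F)‖ = ‖coneMap P F‖ := by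
  refine (sq_eq_sq₀ (norm_nonneg _) (norm_nonneg _)).1 ?_
  refine (norm_sq_diagMap (hilbBasis P) (norm_ladderPhase_le P) _).trans
    (Eq.trans ?_ (norm_sq_diagMap (hilbBasis P) (norm_ladderPhase_le P) _).symm)
  congr 1
  funext k
  have e : (coneRestr P (coneAct P (R0 α) F)).1 = fun ψ => (coneRestr P F).1 (ψ - α) :=
    funext fun ψ => coneRestr_rotate P F α ψ
  rw [e, fcoeff_translate (coneRestr P F).2.2, norm_mul, norm_mul, norm_mul, norm_expFn, one_mul]

/-! ### The Cartan decomposition -/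

theorem SO012.orthogonal (Λ : SO012) (i j : Fin 3) :
    Λ.1.1 0 i * Λ.1.1 0 j - Λ.1.1 1 i * Λ.1.1 1 j - Λ.1.1 2 i * Λ.1.1 2 j = eta i j := by
  have := congrFun (congrFun Λ.2.1 i) j
  rw [← this]
  simp [eta, Matrix.mul_apply, Fin.sum_univ_three, Matrix.diagonal]
  ring

theorem exists_angle {x y ρ : ℝ} (hρ : 0 ≤ ρ) (h : x ^ 2 + y ^ 2 = ρ ^ 2) :
    ∃ α : ℝ, x = ρ * Real.cos α ∧ y = ρ * Real.sin α := by
  have hn : ‖(⟨x, y⟩ : ℂ)‖ = ρ := by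
    refine (sq_eq_sq₀ (norm_nonneg _) hρ).1 ?_
    rw [Complex.sq_norm, normSq_apply, ← h]; ring
  refine ⟨arg ⟨x, y⟩, ?_, ?_⟩
  · rw [← hn, Complex.norm_mul_cos_arg]
  · rw [← hn, Complex.norm_mul_sin_arg]

/-- The rest of the first row and column must vanish, and the remaining block is orthogonal with
determinant 1. -/
theorem eq_R0_of_apply_zero_zero {M : SO012} (h : M.1.1 0 0 = 1) : ∃ β, M = R0 β := by
  have hcol := lorentz_col M.2.1
  have hrow := lorentz_row M.2.1
  rw [h] at hcol hrow
  have h10 : M.1.1 1 0 = 0 := by nlinarith [sq_nonneg (M.1.1 1 0), sq_nonneg (M.1.1 2 0)]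
  have h20 : M.1.1 2 0 = 0 := by nlinarith [sq_nonneg (M.1.1 1 0), sq_nonneg (M.1.1 2 0)]
  have h01 : M.1.1 0 1 = 0 := by nlinarith [sq_nonneg (M.1.1 0 1), sq_nonneg (M.1.1 0 2)]
  have h02 : M.1.1 0 2 = 0 := by nlinarith [sq_nonneg (M.1.1 0 1), sq_nonneg (M.1.1 0 2)]
  have h11 := SO012.orthogonal M 1 1
  have h12 := SO012.orthogonal M 1 2
  have hdet := M.2.2.1
  rw [Matrix.det_fin_three, h, h10, h20, h01, h02] at hdet
  rw [h01] at h11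
  rw [h01, h02] at h12
  simp [eta] at h11 h12 hdet
  obtain ⟨β, hc, hs⟩ := exists_angle zero_le_one
    (show M.1.1 1 1 ^ 2 + M.1.1 2 1 ^ 2 = 1 ^ 2 by linarith)
  rw [one_mul] at hc hs
  have h22 : M.1.1 2 2 = M.1.1 1 1 := by
    linear_combination M.1.1 2 2 * h11 + M.1.1 1 1 * hdet - M.1.1 2 1 * h12
  have h21 : M.1.1 1 2 = -M.1.1 2 1 := by
    linear_combination M.1.1 1 2 * h11 - M.1.1 1 1 * h12 - M.1.1 2 1 * hdet
  refine ⟨β, SO012.ext fun i j => ?_⟩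
  simp only [R0, SO012.mk_apply]
  fin_cases i <;> fin_cases j <;> simp [h, h10, h20, h01, h02, h22, h21, hc, hs]

/-- A rotation brings the spatial part of the first column to the x₂-axis and a boost brings the
column to (1, 0, 0); what is left is a rotation. The boost parameter is given explicitly because its
continuity in Λ is needed for strong continuity. -/
theorem exists_cartan (Λ : SO012) : ∃ α β : ℝ, Λ = R0 α *
    Lambda1 (Real.arsinh √(Λ.1.1 1 0 ^ 2 + Λ.1.1 2 0 ^ 2)) * R0 β := by
  have hcol := lorentz_col Λ.2.1
  have hpos : 0 < Λ.1.1 0 0 := Λ.2.2.2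
  set ρ := √(Λ.1.1 1 0 ^ 2 + Λ.1.1 2 0 ^ 2) with hρ
  have hρ2 : ρ ^ 2 = Λ.1.1 1 0 ^ 2 + Λ.1.1 2 0 ^ 2 := Real.sq_sqrt (by positivity)
  -- The first column of R₀(α)Λ₁(t) is (cosh t, -sin α sinh t, cos α sinh t), hence the order and
  -- the sign.
  obtain ⟨α, hc, hs⟩ := exists_angle (Real.sqrt_nonneg _ : 0 ≤ ρ)
    (show Λ.1.1 2 0 ^ 2 + (-Λ.1.1 1 0) ^ 2 = ρ ^ 2 by rw [hρ2]; ring)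
  set t := Real.arsinh ρ with ht
  have hsinh : Real.sinh t = ρ := Real.sinh_arsinh ρ
  have hcosh : Real.cosh t = Λ.1.1 0 0 := by
    refine (sq_eq_sq₀ (Real.cosh_pos t).le hpos.le).1 ?_
    rw [Real.cosh_sq, hsinh, hρ2, hcol]; ring
  obtain ⟨β, hβ⟩ := eq_R0_of_apply_zero_zero (M := Lambda1 (-t) * (R0 (-α) * Λ)) (by
    rw [SO012.mul_apply, SO012.mul_apply, SO012.mul_apply, SO012.mul_apply]
    simp only [R0, Lambda1, SO012.mk_apply]
    have := Real.sin_sq_add_cos_sq α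
    simp
    rw [hcosh, hsinh]
    linear_combination hcol - hρ2 - ρ * Real.sin α * hs - ρ * Real.cos α * hc - ρ ^ 2 * this)
  refine ⟨α, β, ?_⟩
  rw [← hβ, ← Lambda1_inv, ← R0_inv]
  group

theorem norm_coneMap_act (Λ : SO012) (F : coneFn P) :
    ‖coneMap P (coneAct P Λ F)‖ = ‖coneMap P F‖ := by
  obtain ⟨α, β, hΛ⟩ := exists_cartan Λ
  rw [hΛ]
  rw [coneAct_mul, coneAct_mul, norm_coneMap_rotate, norm_coneMap_boost, norm_coneMap_rotate]

/-! ### The representation -/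

/-- The unitary operator of a Lorentz transformation. -/
def repOp (Λ : SO012) : Hilb P ≃ₗᵢ[ℂ] Hilb P :=
  (coneAct P Λ).extendOfIsometry (coneMap P) (coneMap P) (denseRange_coneMap P)
    (denseRange_coneMap P) (norm_coneMap_act P Λ)

theorem repOp_coneMap (Λ : SO012) (F : coneFn P) :
    repOp P Λ (coneMap P F) = coneMap P (coneAct P Λ F) :=
  LinearEquiv.extendOfIsometry_eq _ _ _ _ _ _ F

theorem ext_of_coneMap {A B : Hilb P ≃ₗᵢ[ℂ] Hilb P}
    (h : ∀ F, A (coneMap P F) = B (coneMap P F)) : A = B := by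
  have := (denseRange_coneMap P).equalizer A.continuous B.continuous (funext h)
  exact LinearIsometryEquiv.ext (congrFun this)

theorem coneAct_one (F : coneFn P) : coneAct P 1 F = F := by
  ext v
  change F.1 ((1 : SO012)⁻¹.1.1.mulVec v) = F.1 v
  rw [inv_one]
  exact congrArg F.1 (Matrix.one_mulVec v)

/-- The representation `û` of `SO₀(1,2)` on the time-zero Hilbert space. -/
def timeZeroRep : SO012 →* (Hilb P ≃ₗᵢ[ℂ] Hilb P) where
  toFun := repOp P
  map_one' := ext_of_coneMap P fun F => by
    rw [repOp_coneMap, coneAct_one]; rfl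
  map_mul' Λ Λ' := ext_of_coneMap P fun F => by
    rw [repOp_coneMap, coneAct_mul, LinearIsometryEquiv.coe_mul, Function.comp_apply,
      repOp_coneMap, repOp_coneMap]

theorem timeZeroRep_coneMap (Λ : SO012) (F : coneFn P) :
    timeZeroRep P Λ (coneMap P F) = coneMap P (coneAct P Λ F) := repOp_coneMap P Λ F

theorem hilbBasis_eq_coneMap (k : ℤ) :
    hilbBasis P k = (ladderPhase P k)⁻¹ • coneMap P (coneChar P k) := by
  rw [coneMap_coneChar, smul_smul, inv_mul_cancel₀ (ladderPhase_ne_zero P k), one_smul]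

theorem timeZeroRep_rotation_basis (α : ℝ) (k : ℤ) :
    timeZeroRep P (R0 α) (hilbBasis P k) = expFn (-k) α • hilbBasis P k := by
  rw [hilbBasis_eq_coneMap, map_smul, timeZeroRep_coneMap, smul_comm (expFn (-k) α)]
  congr 1
  rw [coneMap, LinearMap.comp_apply, LinearMap.comp_apply, ← map_smul]
  congr 1
  refine Subtype.ext (funext fun ψ => ?_)
  rw [coneRestr_rotate]
  change (coneRestr P (coneChar P k)).1 (ψ - α) = expFn (-k) α * (coneRestr P (coneChar P k)).1 ψ
  rw [coneRestr_coneChar]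
  unfold expFn
  rw [← Complex.exp_add]
  congr 1; push_cast; ring

theorem generatorRel_boost_basis (k : ℤ) :
    GeneratorRel (fun t => timeZeroRep P (Lambda1 t)) (hilbBasis P k)
      (jacobiBasis (hilbBasis P) 0 (fun k => (1 : ℂ) * ladder P k) k) := by
  have h1 : GeneratorRel (fun t => timeZeroRep P (Lambda1 t)) (coneMap P (coneChar P k))
      (-I • contCircleMap P (coneGen P (coneChar P k))) := by
    unfold GeneratorRel
    simp only [timeZeroRep_coneMap]
    rw [smul_smul, mul_neg, I_mul_I, neg_neg, one_smul]
    exact hasDerivAt_diagMap_boost P (hilbBasis P) (norm_ladderPhase_le P) _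
  have h2 := h1.smul (ladderPhase P k)⁻¹
  have h3 : JacobiRel (hilbBasis P) 0 (fun k => (1 : ℂ) * ladder P k) 
      ((ladderPhase P k)⁻¹ • coneMap P (coneChar P k))
      ((ladderPhase P k)⁻¹ • (-I • contCircleMap P (coneGen P (coneChar P k)))) :=
    (jacobiGraph (hilbBasis P) 0 (fun k => (1 : ℂ) * ladder P k)).smul_mem (ladderPhase P k)⁻¹
      (x := (_, _)) (jacobiRel_coneGen P (coneChar P k))
  rw [← hilbBasis_eq_coneMap] at h2 h3
  rwa [h3.unique (jacobiRel_basis k)] at h2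

/-! ### Generators -/

theorem GeneratorRel.conj {H : Type*} [NormedAddCommGroup H] [InnerProductSpace ℂ H]
    {V V' : ℝ → H ≃ₗᵢ[ℂ] H} {x y : H} (h : GeneratorRel V x y) (A : H ≃ₗᵢ[ℂ] H)
    (hA : ∀ t, V' t (A x) = A (V t x)) : GeneratorRel V' (A x) (A y) := by
  have h2 := (A.toContinuousLinearEquiv.toContinuousLinearMap.hasFDerivAt
    (x := V 0 x)).restrictScalars ℝ |>.comp_hasDerivAt 0 h
  unfold GeneratorRel
  rw [← map_smul]
  exact h2.congr_of_eventuallyEq (Filter.Eventually.of_forall hA)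

theorem expFn_add_right (k : ℤ) (a b : ℝ) : expFn k (a + b) = expFn k a * expFn k b := by
  unfold expFn
  rw [← Complex.exp_add]
  congr 1; push_cast; ring

theorem expFn_apply_zero (k : ℤ) : expFn k 0 = 1 := by simp [expFn]

theorem conj_expFn (k : ℤ) (α : ℝ) : conj (expFn k α) = expFn (-k) α := by
  unfold expFn
  rw [← Complex.exp_conj, map_mul, conj_I, conj_ofReal]
  congr 1; push_cast; ring

theorem timeZeroRep_mul_apply (Λ Λ' : SO012) (x : Hilb P) :
    timeZeroRep P (Λ * Λ') x = timeZeroRep P Λ (timeZeroRep P Λ' x) := by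
  rw [map_mul]; rfl

theorem timeZeroRep_one_apply (x : Hilb P) : timeZeroRep P 1 x = x := by
  rw [map_one]; rfl

/-- The rotation R₀(α) multiplies f_k by e^{-ikα}, so conjugation by it multiplies the entry from k
to k+1 by e^{-iα}. -/
theorem generatorRel_rotated_boost_basis (α : ℝ) (k : ℤ) :
    GeneratorRel (fun t => timeZeroRep P (R0 α * Lambda1 t * R0 (-α))) (hilbBasis P k)
      (jacobiBasis (hilbBasis P) 0 (fun k => expFn (-1) α * ladder P k) k) := by
  have e : ∀ m : ℤ, expFn k α * expFn (-m) α = expFn (k - m) α := fun m => by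
    rw [← expFn_add, sub_eq_add_neg]
  have h2 := (((generatorRel_boost_basis P k).conj
    (V' := fun t => timeZeroRep P (R0 α * Lambda1 t * R0 (-α))) (timeZeroRep P (R0 α))) fun t => by
      rw [timeZeroRep_mul_apply, timeZeroRep_mul_apply, ← timeZeroRep_mul_apply P (R0 (-α)),
        ← R0_add, neg_add_cancel, R0_zero, timeZeroRep_one_apply]).smul (expFn k α)
  have e1 : expFn k α • timeZeroRep P (R0 α) (hilbBasis P k) = hilbBasis P k := by
    rw [timeZeroRep_rotation_basis, smul_smul, e, sub_self, expFn_zero, one_smul]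
  have e2 : expFn k α • timeZeroRep P (R0 α)
      (jacobiBasis (hilbBasis P) 0 (fun k => (1 : ℂ) * ladder P k) k) =
      jacobiBasis (hilbBasis P) 0 (fun k => expFn (-1) α * ladder P k) k := by
    simp only [jacobiBasis, map_add, map_smul, timeZeroRep_rotation_basis, smul_add,
      Pi.zero_apply, ofReal_zero, zero_smul, zero_add, one_mul, map_mul, conj_expFn,
      neg_neg, conj_ofReal]
    rw [smul_smul, smul_smul, smul_smul, smul_smul, mul_right_comm, e, mul_right_comm, e,
      sub_sub_cancel,
      show k - (k + 1) = -1 by ring]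
  rwa [e1, e2] at h2

theorem norm_expFn_mul_ladder_le (α : ℝ) (k : ℤ) :
    ‖expFn (-1) α * ladder P k‖ ≤ (1 + P.zeta) * (1 + |(k : ℝ)|) :=
  norm_mul_ladder_le P (norm_expFn _ _) k

theorem rotated_boost_zero (α : ℝ) : R0 α * Lambda1 0 * R0 (-α) = 1 := by
  rw [Lambda1_zero, mul_one, ← R0_add, add_neg_cancel, R0_zero]

theorem rotated_boost_add (α s t : ℝ) : R0 α * Lambda1 (s + t) * R0 (-α) =
    (R0 α * Lambda1 s * R0 (-α)) * (R0 α * Lambda1 t * R0 (-α)) := by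
  rw [Lambda1_add, ← R0_inv]
  group

theorem generatorRel_rotated_boost (α : ℝ) {x y : Hilb P} :
    GeneratorRel (fun t => timeZeroRep P (R0 α * Lambda1 t * R0 (-α))) x y ↔
      JacobiRel (hilbBasis P) 0 (fun k => expFn (-1) α * ladder P k) x y :=
  generatorRel_iff_jacobiRel (norm_expFn_mul_ladder_le P α)
    (by rw [rotated_boost_zero, map_one]) (fun s t => by rw [rotated_boost_add, map_mul])
    (generatorRel_rotated_boost_basis P α)

/-- The closure of ω r f and the generator of the conjugated boosts are both the maximal operator of
one Jacobi matrix. -/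
theorem isExpI_rotated_boost (α : ℝ) {f : C(ℝ, ℝ)} (hf : ∀ ψ, (f ψ : ℂ) =
    (expFn (-1) α * expFn 1 ψ + conj (expFn (-1) α) * expFn (-1) ψ) / 2) :
    IsExpI (omegaMulGraph P f).toLinearPMap.closure
      (fun t => timeZeroRep P (R0 α * Lambda1 t * R0 (-α))) where
  selfAdjoint := isSelfAdjoint_closure_omegaMul P (norm_expFn _ _) hf
  map_zero := by rw [rotated_boost_zero, map_one]
  map_add s t := by rw [rotated_boost_add, map_mul]
  continuous := continuous_of_basis (fun s t => by rw [rotated_boost_add, map_mul])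
    (generatorRel_rotated_boost_basis P α)
  generator x y := by
    rw [mem_graph_closure_omegaMul P (norm_expFn _ _) hf, generatorRel_rotated_boost]

theorem rotated_boost_zero_angle (t : ℝ) : R0 0 * Lambda1 t * R0 (-0) = Lambda1 t := by
  rw [neg_zero, R0_zero, one_mul, mul_one]

theorem rotated_boost_right_angle (t : ℝ) :
    R0 (-(Real.pi / 2)) * Lambda1 t * R0 (-(-(Real.pi / 2))) = Lambda2 t := by
  refine SO012.ext fun i j => ?_
  simp only [SO012.mul_apply, R0, Lambda1, Lambda2, SO012.mk_apply]
  fin_cases i <;> fin_cases j <;> simp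

theorem rotated_boost_neg_right_angle (t : ℝ) :
    R0 (Real.pi / 2) * Lambda1 t * R0 (-(Real.pi / 2)) = Lambda2 (-t) := by
  refine SO012.ext fun i j => ?_
  simp only [SO012.mul_apply, R0, Lambda1, Lambda2, SO012.mk_apply]
  fin_cases i <;> fin_cases j <;> simp

theorem expFn_right_angle : expFn (-1) (Real.pi / 2) = -I := by
  rw [expFn, show I * (((-1 : ℤ) : ℝ) * (Real.pi / 2) : ℝ) = -(Real.pi / 2 * I) by push_cast; ring,
    Complex.exp_neg, Complex.exp_pi_div_two_mul_I, inv_I]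

theorem expFn_neg_right_angle : expFn (-1) (-(Real.pi / 2)) = I := by
  rw [expFn, show I * (((-1 : ℤ) : ℝ) * -(Real.pi / 2) : ℝ) = Real.pi / 2 * I by push_cast; ring,
    Complex.exp_pi_div_two_mul_I]

theorem generatorRel_lambda1 {x y : Hilb P} :
    GeneratorRel (fun t => timeZeroRep P (Lambda1 t)) x y ↔
      JacobiRel (hilbBasis P) 0 (fun k => (1 : ℂ) * ladder P k) x y := by
  have := generatorRel_rotated_boost P 0 (x := x) (y := y)
  simpa only [rotated_boost_zero_angle, expFn_apply_zero] using this

theorem generatorRel_lambda2 {x y : Hilb P} :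
    GeneratorRel (fun t => timeZeroRep P (Lambda2 t)) x y ↔
      JacobiRel (hilbBasis P) 0 (fun k => I * ladder P k) x y := by
  have := generatorRel_rotated_boost P (-(Real.pi / 2)) (x := x) (y := y)
  simpa only [rotated_boost_right_angle, expFn_neg_right_angle] using this

theorem isExpI_lambda1 :
    IsExpI (omegaRCos P).closure (fun t => timeZeroRep P (Lambda1 t)) := by
  have := isExpI_rotated_boost P 0 (f := ⟨Real.cos, Real.continuous_cos⟩) (by
    simp only [expFn_apply_zero]; exact cos_eq_trig)
  simp only [rotated_boost_zero_angle] at this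
  exact this

theorem isExpI_lambda2 :
    IsExpI (omegaRSin P).closure (fun t => timeZeroRep P (Lambda2 (-t))) := by
  have := isExpI_rotated_boost P (Real.pi / 2) (f := ⟨Real.sin, Real.continuous_sin⟩) (by
    simp only [expFn_right_angle]; exact sin_eq_trig)
  simp only [rotated_boost_neg_right_angle] at this
  exact this

theorem generatorRel_rotation_basis (k : ℤ) :
    GeneratorRel (fun α => timeZeroRep P (R0 α)) (hilbBasis P k)
      (jacobiBasis (hilbBasis P) (fun k => -k) 0 k) := by
  unfold GeneratorRel
  simp only [timeZeroRep_rotation_basis]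
  have h := (hasDerivAt_expFn (-k) 0).smul_const (hilbBasis P k)
  rw [expFn_apply_zero] at h
  convert! h using 1
  simp [jacobiBasis, smul_smul]

theorem generatorRel_rotation {x y : Hilb P} :
    GeneratorRel (fun α => timeZeroRep P (R0 α)) x y ↔
      JacobiRel (hilbBasis P) (fun k => -k) 0 x y :=
  -- The matrix is diagonal, so the growth condition is trivial.
  generatorRel_iff_jacobiRel (C := 0) (fun k => by simp)
    (by rw [R0_zero, map_one]) (fun s t => by rw [R0_add, map_mul])
    (generatorRel_rotation_basis P)

theorem repr_timeZeroRep_rotation (α : ℝ) (x : Hilb P) (k : ℤ) :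
    (hilbBasis P).repr (timeZeroRep P (R0 α) x) k = expFn (-k) α * (hilbBasis P).repr x k := by
  have h : hilbBasis P k = timeZeroRep P (R0 α) (expFn k α • hilbBasis P k) := by
    rw [map_smul, timeZeroRep_rotation_basis, smul_smul, ← expFn_add, add_neg_cancel, expFn_zero,
      one_smul]
  rw [HilbertBasis.repr_apply_apply, HilbertBasis.repr_apply_apply]
  conv_lhs => rw [h]
  rw [LinearIsometryEquiv.inner_map_map, inner_smul_left, conj_expFn]

theorem isTimeZeroRep_timeZeroRep : IsTimeZeroRep P (timeZeroRep P) where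
  rotation α h := by
    apply (hilbBasis P).repr.injective
    ext k
    rw [repr_timeZeroRep_rotation, repr_emb, repr_emb]
    have := fcoeff_translate h.2.2 α k
    change _ = charNorm P k * fcoeff (fun ψ => h.1 (ψ - α)) k
    rw [this]
    ring
  boost := isExpI_lambda1 P

theorem denseRange_emb : DenseRange (emb P) := UniformSpace.Completion.denseRange_coe

-- Density of C^∞(S¹) settles the rotations, uniqueness of the exponential settles the boosts, and
-- these generate the group by the Cartan decomposition.
variable {P} in
theorem IsTimeZeroRep.unique {U U' : SO012 →* (Hilb P ≃ₗᵢ[ℂ] Hilb P)} (h : IsTimeZeroRep P U)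
    (h' : IsTimeZeroRep P U') : U = U' := by
  have hR : ∀ α, U (R0 α) = U' (R0 α) := fun α => by
    have := (denseRange_emb P).equalizer (U (R0 α)).continuous (U' (R0 α)).continuous
      (funext fun x => (h.rotation α x).trans (h'.rotation α x).symm)
    exact LinearIsometryEquiv.ext (congrFun this)
  have hL : ∀ t, U (Lambda1 t) = U' (Lambda1 t) := congrFun (h.boost.unique h'.boost)
  refine MonoidHom.ext fun Λ => ?_
  obtain ⟨α, β, hΛ⟩ := exists_cartan Λ
  rw [hΛ]
  simp only [map_mul, hR, hL]

/-! ### Strong continuity -/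

theorem stronglyContinuous_of_continuousAt_one {H : Type*} [NormedAddCommGroup H]
    [InnerProductSpace ℂ H] {U : SO012 →* (H ≃ₗᵢ[ℂ] H)} {s : Set H}
    (hs : Dense (Submodule.span ℂ s : Set H))
    (h : ∀ x ∈ s, ContinuousAt (fun Λ => U Λ x) 1) : StronglyContinuous U := by
  have hspan : ∀ x ∈ Submodule.span ℂ s, ContinuousAt (fun Λ => U Λ x) 1 := by
    intro x hx
    induction hx using Submodule.span_induction with
    | mem x hx => exact h x hx
    | zero => simpa using continuousAt_const
    | add x x' _ _ h h' => simpa using ContinuousAt.fun_add h h'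
    | smul c x _ h => simpa using ContinuousAt.fun_const_smul h c
  have key : ∀ x, ContinuousAt (fun Λ => U Λ x) 1 := by
    intro x
    rw [ContinuousAt, Metric.tendsto_nhds]
    intro ε hε
    obtain ⟨u, hu, hxu⟩ := Metric.dense_iff.1 hs x (ε / 3) (by positivity)
    rw [Metric.mem_ball] at hu
    filter_upwards [Metric.tendsto_nhds.1 (hspan u hxu) (ε / 3) (by positivity)] with Λ hΛ
    calc dist (U Λ x) (U 1 x)
        ≤ dist (U Λ x) (U Λ u) + dist (U Λ u) (U 1 u) + dist (U 1 u) (U 1 x) :=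
          dist_triangle4 _ _ _ _
      _ < ε := by
        rw [LinearIsometryEquiv.dist_map, LinearIsometryEquiv.dist_map, dist_comm x u]
        linarith
  intro x
  rw [continuous_iff_continuousAt]
  intro Λ
  have h1 : ContinuousAt (fun Λ' => U Λ (U (Λ⁻¹ * Λ') x)) Λ := by
    refine (U Λ).continuous.continuousAt.comp (f := fun Λ' => U (Λ⁻¹ * Λ') x) ?_
    have := key x
    rw [← inv_mul_cancel Λ] at this
    exact this.comp (f := fun Λ' => Λ⁻¹ * Λ') (continuous_const.mul continuous_id).continuousAt
  refine h1.congr (Filter.Eventually.of_forall fun Λ' => ?_)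
  change (U Λ * U (Λ⁻¹ * Λ')) x = U Λ' x
  rw [← map_mul, mul_inv_cancel_left]

theorem SO012.continuous_apply (i j : Fin 3) : Continuous fun Λ : SO012 => Λ.1.1 i j :=
  (Units.continuous_val.comp continuous_subtype_val).matrix_elem i j

theorem expFn_eq_zpow (k : ℤ) (θ : ℝ) : expFn k θ = expFn 1 θ ^ k := by
  rw [expFn, expFn, ← Complex.exp_int_mul]
  congr 1; push_cast; ring

theorem expFn_one_eq (θ : ℝ) : expFn 1 θ = Real.cos θ + Real.sin θ * I := by
  rw [expFn, ofReal_cos, ofReal_sin, ← Complex.exp_mul_I]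
  congr 1; push_cast; ring

/-- It suffices to treat basis vectors at the identity. There t(Λ) tends to 0, and although the
Cartan angles need not converge separately, e^{i(α+β)} tends to 1. -/
theorem stronglyContinuous_timeZeroRep : StronglyContinuous (timeZeroRep P) := by
  refine stronglyContinuous_of_continuousAt_one (s := Set.range (hilbBasis P)) ?_ ?_
  · rw [Submodule.dense_iff_topologicalClosure_eq_top]
    exact (hilbBasis P).dense_span
  rintro _ ⟨k, rfl⟩
  -- The angles are arbitrary choices with no continuity in Λ; only t and α + β modulo 2π are
  -- controlled.
  choose α β hΛ using exists_cartan
  set t : SO012 → ℝ := fun Λ => Real.arsinh √(Λ.1.1 1 0 ^ 2 + Λ.1.1 2 0 ^ 2) with ht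
  have hcont := SO012.continuous_apply
  have htc : Continuous t := by
    have h1 := hcont 1 0
    have h2 := hcont 2 0
    exact Real.continuous_arsinh.comp (by fun_prop)
  have ht1 : t 1 = 0 := by simp [ht]
  have hent : ∀ Λ i j, Λ.1.1 i j = (R0 (α Λ) * Lambda1 (t Λ) * R0 (β Λ)).1.1 i j := fun Λ i j => by
    rw [← hΛ]
  have h00 : ∀ Λ, Λ.1.1 0 0 = Real.cosh (t Λ) := fun Λ => by
    rw [hent Λ]
    simp only [SO012.mul_apply, R0, Lambda1, SO012.mk_apply]
    simp
  have h11 : ∀ Λ, Λ.1.1 1 1 = Real.cos (α Λ + β Λ) -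
      (Real.cosh (t Λ) - 1) * (Real.sin (α Λ) * Real.sin (β Λ)) := fun Λ => by
    rw [hent Λ, Real.cos_add]
    simp only [SO012.mul_apply, R0, Lambda1, SO012.mk_apply]
    simp
    ring
  have h21 : ∀ Λ, Λ.1.1 2 1 = Real.sin (α Λ + β Λ) +
      (Real.cosh (t Λ) - 1) * (Real.cos (α Λ) * Real.sin (β Λ)) := fun Λ => by
    rw [hent Λ, Real.sin_add]
    simp only [SO012.mul_apply, R0, Lambda1, SO012.mk_apply]
    simp
    ring
  -- The entries (1,1) and (2,1) differ from cos(α+β) and sin(α+β) by terms with the factor cosh t -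
  -- 1 = Λ₀₀ - 1.
  have hb : ∀ Λ, ‖expFn 1 (α Λ + β Λ) - (Λ.1.1 1 1 + Λ.1.1 2 1 * I)‖ ≤ |Λ.1.1 0 0 - 1| := by
    intro Λ
    have e : expFn 1 (α Λ + β Λ) - (Λ.1.1 1 1 + Λ.1.1 2 1 * I) =
        ((Λ.1.1 0 0 - 1) * -Real.sin (β Λ) : ℝ) * (I * expFn 1 (α Λ)) := by
      rw [expFn_one_eq, expFn_one_eq, h11, h21, h00]
      push_cast
      linear_combination ((Complex.cosh (t Λ) - 1) * Complex.sin (β Λ) * Complex.sin (α Λ)) * I_sq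
    rw [e, norm_mul, norm_mul, norm_I, norm_expFn, Complex.norm_real, Real.norm_eq_abs, abs_mul,
      abs_neg, mul_one, mul_one]
    exact mul_le_of_le_one_right (abs_nonneg _) (Real.abs_sin_le_one _)
  have hz : Filter.Tendsto (fun Λ => expFn 1 (α Λ + β Λ)) (nhds 1) (nhds 1) := by
    have h1 : Continuous fun Λ : SO012 => |Λ.1.1 0 0 - 1| := by
      have := hcont 0 0
      fun_prop
    have h2 : Continuous fun Λ : SO012 => (Λ.1.1 1 1 + Λ.1.1 2 1 * I : ℂ) := by
      have := hcont 1 1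
      have := hcont 2 1
      fun_prop
    have h3 := squeeze_zero_norm hb (by simpa [SO012.one_apply] using h1.tendsto 1)
    have h4 : Filter.Tendsto (fun Λ : SO012 => (Λ.1.1 1 1 + Λ.1.1 2 1 * I : ℂ)) (nhds 1) (nhds 1) := by
      simpa [SO012.one_apply] using h2.tendsto 1
    simpa using h3.add h4
  have hzk : Filter.Tendsto (fun Λ => expFn (-k) (α Λ + β Λ)) (nhds 1) (nhds 1) := by
    have h1 := (continuousAt_zpow₀ (1 : ℂ) (-k) (Or.inl one_ne_zero)).tendsto.comp hz
    rw [one_zpow] at h1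
    refine h1.congr fun Λ => ?_
    rw [expFn_eq_zpow (-k)]
    rfl
  have hboost : Filter.Tendsto (fun Λ => timeZeroRep P (Lambda1 (t Λ)) (hilbBasis P k)) (nhds 1)
      (nhds (hilbBasis P k)) := by
    have h1 := (((isExpI_lambda1 P).continuous (hilbBasis P k)).comp htc).tendsto 1
    simp only [Function.comp_apply, ht1, Lambda1_zero, timeZeroRep_one_apply] at h1
    exact h1
  have hle : ∀ Λ, ‖timeZeroRep P Λ (hilbBasis P k) - hilbBasis P k‖ ≤
      ‖timeZeroRep P (Lambda1 (t Λ)) (hilbBasis P k) - hilbBasis P k‖ +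
        ‖expFn (-k) (α Λ + β Λ) - 1‖ := by
    intro Λ
    -- R₀(β) acts first and gives a phase on f_k; inserting f_k after the boost separates the effect
    -- of the boost from that of the total rotation α + β.
    have e : timeZeroRep P Λ (hilbBasis P k) - hilbBasis P k =
        expFn (-k) (β Λ) • timeZeroRep P (R0 (α Λ))
          (timeZeroRep P (Lambda1 (t Λ)) (hilbBasis P k) - hilbBasis P k) +
        (expFn (-k) (α Λ + β Λ) - 1) • hilbBasis P k := by
      conv_lhs => rw [hΛ Λ]
      rw [map_mul, map_mul, LinearIsometryEquiv.coe_mul, Function.comp_apply,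
        timeZeroRep_rotation_basis, map_smul, map_sub, smul_sub, timeZeroRep_rotation_basis,
        smul_smul, expFn_add_right, sub_smul, one_smul, mul_comm]
      change _ • timeZeroRep P (R0 (α Λ)) (timeZeroRep P (Lambda1 (t Λ)) _) - _ = _
      abel
    rw [e]
    refine (norm_add_le _ _).trans (add_le_add ?_ ?_)
    · rw [norm_smul, norm_expFn, one_mul, LinearIsometryEquiv.norm_map]
    · rw [norm_smul, (hilbBasis P).orthonormal.1 k, mul_one]
  have h0 : Filter.Tendsto (fun Λ =>
      ‖timeZeroRep P (Lambda1 (t Λ)) (hilbBasis P k) - hilbBasis P k‖ +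
        ‖expFn (-k) (α Λ + β Λ) - 1‖) (nhds 1) (nhds 0) := by
    have := ((hboost.sub_const (hilbBasis P k)).norm).add ((hzk.sub_const 1).norm)
    simpa using this
  rw [ContinuousAt, map_one, tendsto_iff_norm_sub_tendsto_zero]
  exact squeeze_zero (fun _ => norm_nonneg _) hle h0

/-! ### Irreducibility -/

theorem timeZeroRep_mem_orthogonal {K : Submodule ℂ (Hilb P)}
    (hK : ∀ Λ, ∀ x ∈ K, timeZeroRep P Λ x ∈ K) (Λ : SO012) {x : Hilb P} (hx : x ∈ Kᗮ) :
    timeZeroRep P Λ x ∈ Kᗮ := by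
  rw [Submodule.mem_orthogonal]
  intro u hu
  have h1 : u = timeZeroRep P Λ (timeZeroRep P Λ⁻¹ u) := by
    rw [← timeZeroRep_mul_apply, mul_inv_cancel, timeZeroRep_one_apply]
  rw [h1, LinearIsometryEquiv.inner_map_map]
  exact hx _ (hK _ _ hu)

theorem eq_smul_of_rotation_eigenvector {x : Hilb P} {k : ℤ}
    (h : ∀ α, timeZeroRep P (R0 α) x = expFn (-k) α • x) :
    x = (hilbBasis P).repr x k • hilbBasis P k := by
  classical
  apply (hilbBasis P).repr.injective
  ext j
  rw [map_smul, HilbertBasis.repr_self, lp.coeFn_smul, Pi.smul_apply, lp.single_apply,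
    Pi.single_apply, smul_eq_mul]
  split_ifs with hj
  · rw [hj, mul_one]
  · rw [mul_zero]
    by_contra hx
    -- At the angle π/(k-j) the characters with indices k and j differ by the factor -1.
    have h1 := repr_timeZeroRep_rotation P (Real.pi / (k - j)) x j
    rw [h, map_smul, lp.coeFn_smul, Pi.smul_apply, smul_eq_mul] at h1
    have h2 := mul_right_cancel₀ hx h1
    have h3 : expFn (k - j) (Real.pi / (k - j)) = 1 := by
      rw [sub_eq_add_neg, expFn_add, ← h2, ← expFn_add, add_neg_cancel,
        expFn_zero]
    have hkj : ((k : ℝ) - j) ≠ 0 := sub_ne_zero.2 (by exact_mod_cast Ne.symm hj)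
    rw [expFn, show (((k - j : ℤ) : ℝ) * (Real.pi / (k - j)) : ℝ) = Real.pi by
      push_cast; field_simp, mul_comm, Complex.exp_pi_mul_I] at h3
    norm_num at h3

/-- The orthogonal projection of f_k to K is a rotation eigenvector of the same weight. Weights are
simple, so it is a multiple of f_k. -/
theorem basis_mem_or_mem_orthogonal {K : Submodule ℂ (Hilb P)} (hc : IsClosed (K : Set (Hilb P)))
    (hK : ∀ Λ, ∀ x ∈ K, timeZeroRep P Λ x ∈ K) (k : ℤ) :
    hilbBasis P k ∈ K ∨ hilbBasis P k ∈ Kᗮ := by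
  have : CompleteSpace K := hc.completeSpace_coe
  obtain ⟨p, hp, q, hq, hpq⟩ := K.exists_add_mem_mem_orthogonal (hilbBasis P k)
  have hrot : ∀ α, timeZeroRep P (R0 α) p = expFn (-k) α • p := fun α => by
    rw [← sub_eq_zero, ← Submodule.mem_bot ℂ, ← K.inf_orthogonal_eq_bot, Submodule.mem_inf]
    refine ⟨K.sub_mem (hK _ _ hp) (K.smul_mem _ hp), ?_⟩
    have h1 := timeZeroRep_rotation_basis P α k
    rw [hpq, map_add, smul_add] at h1
    have h2 : timeZeroRep P (R0 α) p - expFn (-k) α • p =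
        expFn (-k) α • q - timeZeroRep P (R0 α) q := by
      rw [sub_eq_sub_iff_add_eq_add, h1, add_comm]
    rw [h2]
    exact Kᗮ.sub_mem (Kᗮ.smul_mem _ hq) (timeZeroRep_mem_orthogonal P hK _ hq)
  have he := eq_smul_of_rotation_eigenvector P hrot
  by_cases h0 : (hilbBasis P).repr p k = 0
  · right
    rw [h0, zero_smul] at he
    rwa [hpq, he, zero_add]
  · left
    rw [he] at hp
    exact (K.smul_mem_iff h0).1 hp

/-- The generator applied to f_k is a limit of difference quotients in K, so it lies in K. Its
components along f_{k±1} are non-zero, which excludes that these vectors are orthogonal to K. -/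
theorem basis_neighbors_mem {K : Submodule ℂ (Hilb P)} (hc : IsClosed (K : Set (Hilb P)))
    (hK : ∀ Λ, ∀ x ∈ K, timeZeroRep P Λ x ∈ K) {k : ℤ} (hk : hilbBasis P k ∈ K) :
    hilbBasis P (k + 1) ∈ K ∧ hilbBasis P (k - 1) ∈ K := by
  classical
  set y := jacobiBasis (hilbBasis P) 0 (fun k => (1 : ℂ) * ladder P k) k with hy
  have hyK : y ∈ K := by
    have h1 := generatorRel_boost_basis P k
    rw [← hy] at h1
    have h2 := (hasDerivAt_iff_tendsto_slope.1 h1)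
    have h3 : I • y ∈ K := by
      refine hc.mem_of_tendsto h2 (Filter.Eventually.of_forall fun t => ?_)
      change slope (fun t => timeZeroRep P (Lambda1 t) (hilbBasis P k)) 0 t ∈ K
      rw [slope_def_module]
      exact (K.restrictScalars ℝ).smul_mem _ (K.sub_mem (hK _ _ hk) (hK _ _ hk))
    exact (K.smul_mem_iff I_ne_zero).1 h3
  have hrel := jacobiRel_basis (f := hilbBasis P) (b := 0) (α := fun k => (1 : ℂ) * ladder P k) k
  rw [← hy] at hrel
  have hlad : ∀ k, (ladder P k : ℂ) ≠ 0 := fun k => by exact_mod_cast (ladder_pos P k).ne'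
  have hrepr : ∀ j, (hilbBasis P).repr (hilbBasis P k) j = if j = k then 1 else 0 := fun j => by
    rw [HilbertBasis.repr_self, lp.single_apply, Pi.single_apply]
  constructor
  · refine (basis_mem_or_mem_orthogonal P hc hK (k + 1)).resolve_right fun h => ?_
    have h1 := (Submodule.mem_orthogonal' _ _).1 h y hyK
    rw [← HilbertBasis.repr_apply_apply, hrel] at h1
    simp [hrepr, hlad, show ¬ k + 1 + 1 = k by omega] at h1
  · refine (basis_mem_or_mem_orthogonal P hc hK (k - 1)).resolve_right fun h => ?_
    have h1 := (Submodule.mem_orthogonal' _ _).1 h y hyK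
    rw [← HilbertBasis.repr_apply_apply, hrel] at h1
    simp [hrepr, hlad, show ¬ k - 1 - 1 = k by omega] at h1

/-- If K contains one basis vector, it contains all of them by moving to neighbours; otherwise all
are orthogonal to K. -/
theorem isIrreducibleRep_timeZeroRep : IsIrreducibleRep (timeZeroRep P) := by
  refine ⟨⟨⟨hilbBasis P 0, 0, (hilbBasis P).orthonormal.ne_zero 0⟩⟩, fun K hc hK => ?_⟩
  by_cases h : ∃ k, hilbBasis P k ∈ K
  · right
    obtain ⟨k, hk⟩ := h
    have hall : ∀ j, hilbBasis P j ∈ K := fun j => by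
      induction j using Int.inductionOn' (b := k) with
      | zero => exact hk
      | succ j _ ih => exact (basis_neighbors_mem P hc hK ih).1
      | pred j _ ih => exact (basis_neighbors_mem P hc hK ih).2
    rw [eq_top_iff, ← (hilbBasis P).dense_span]
    exact Submodule.topologicalClosure_minimal _
      (Submodule.span_le.2 (Set.range_subset_iff.2 hall)) hc
  · left
    rw [not_exists] at h
    rw [eq_bot_iff]
    intro x hx
    rw [Submodule.mem_bot]
    apply (hilbBasis P).repr.injective
    ext k
    rw [HilbertBasis.repr_apply_apply, map_zero]
    exact (Submodule.mem_orthogonal' _ _).1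
      ((basis_mem_or_mem_orthogonal P hc hK k).resolve_left (h k)) x hx

/-! ### The Casimir operator -/

/-- The generators act coefficientwise on their full domains. In L₁² + L₂² the second-neighbour
terms cancel because 1² + i² = 0, and the diagonal is 2(a_k² + a_{k-1}²) = k² + ζ²; subtracting K₀²
leaves ζ². -/
theorem casimirRel_eq {x y : Hilb P} (h : CasimirRel (timeZeroRep P) x y) :
    y = (P.zeta : ℂ) ^ 2 • x := by
  obtain ⟨x₀, x₁, x₂, y₀, y₁, y₂, h0, h0', h1, h1', h2, h2', rfl⟩ := h
  rw [generatorRel_rotation] at h0 h0'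
  rw [generatorRel_lambda1] at h1 h1'
  rw [generatorRel_lambda2] at h2 h2'
  apply (hilbBasis P).repr.injective
  ext k
  have hl : ∀ k, (ladder P k : ℂ) ^ 2 * 4 = k * (k + 1) + (P.zeta : ℂ) ^ 2 := fun k => by
    rw [← ofReal_pow, ladder_sq]
    push_cast; ring
  have e1 := hl k
  have e2 := hl (k - 1)
  simp only [map_add, map_neg, map_smul, lp.coeFn_add, lp.coeFn_neg, lp.coeFn_smul, Pi.add_apply,
    Pi.neg_apply, Pi.smul_apply, smul_eq_mul]
  rw [h0' k, h0 k, h1' k, h1 (k - 1), h1 (k + 1), h2' k, h2 (k - 1), h2 (k + 1)]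
  simp only [sub_add_cancel, add_sub_cancel_right, Pi.zero_apply, ofReal_zero, zero_mul, map_zero,
    add_zero, zero_add, one_mul, map_mul, conj_I, conj_ofReal]
  push_cast at e1 e2 ⊢
  set u := (hilbBasis P).repr x
  linear_combination (u k / 2) * e1 + (u k / 2) * e2 +
    (ladder P (k - 1) * ladder P (k - 1 - 1) * u (k - 1 - 1) -
      (ladder P (k - 1) : ℂ) ^ 2 * u k - (ladder P k : ℂ) ^ 2 * u k +
      ladder P k * ladder P (k + 1) * u (k + 1 + 1)) * I_sq

theorem exists_jacobiRel_emb_rotation (h : TestFn P) :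
    ∃ g : TestFn P, JacobiRel (hilbBasis P) (fun k => -k) 0 (emb P h) (emb P g) := by
  obtain ⟨g, hg⟩ := exists_testFn_of_multiplier P h (m := fun k => -k) (C := 1) fun k => by
    rw [norm_neg, Complex.norm_intCast, one_mul]
    nlinarith [sq_nonneg (|(k : ℝ)| - 1), abs_nonneg (k : ℝ)]
  refine ⟨g, fun k => ?_⟩
  rw [repr_emb, repr_emb, hg]
  simp
  ring

theorem exists_jacobiRel_emb {γ : ℂ} {f : C(ℝ, ℝ)}
    (hf : ∀ ψ, (f ψ : ℂ) = (γ * expFn 1 ψ + conj γ * expFn (-1) ψ) / 2) (h : TestFn P) :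
    ∃ g : TestFn P,
      JacobiRel (hilbBasis P) 0 (fun k => γ * ladder P k) (emb P h) (emb P g) := by
  obtain ⟨g, hg⟩ := exists_mem_omegaMulGraph P hf h
  exact ⟨g, jacobiRel_of_mem_omegaMulGraph P hf hg⟩

theorem neg_sin_eq_trig (ψ : ℝ) : ((-⟨Real.sin, Real.continuous_sin⟩ : C(ℝ, ℝ)) ψ : ℂ) =
    (I * expFn 1 ψ + conj I * expFn (-1) ψ) / 2 := by
  have := sin_eq_trig ψ
  rw [ContinuousMap.neg_apply, ofReal_neg, this, map_neg]
  ring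

/-- All three generators map C^∞(S¹) to itself, so each can be applied twice. The value then comes
from `casimirRel_eq`. -/
theorem casimirRel_emb (h : TestFn P) :
    CasimirRel (timeZeroRep P) (emb P h) ((P.zeta : ℂ) ^ 2 • emb P h) := by
  obtain ⟨g₀, h0⟩ := exists_jacobiRel_emb_rotation P h
  obtain ⟨g₀', h0'⟩ := exists_jacobiRel_emb_rotation P g₀
  obtain ⟨g₁, h1⟩ := exists_jacobiRel_emb P cos_eq_trig h
  obtain ⟨g₁', h1'⟩ := exists_jacobiRel_emb P cos_eq_trig g₁
  -- The negative sine, since ω r sin_ψ belongs to s ↦ Λ₂(-s).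
  obtain ⟨g₂, h2⟩ := exists_jacobiRel_emb P neg_sin_eq_trig h
  obtain ⟨g₂', h2'⟩ := exists_jacobiRel_emb P neg_sin_eq_trig g₂
  have key : CasimirRel (timeZeroRep P) (emb P h) (-emb P g₀' + emb P g₁' + emb P g₂') :=
    ⟨_, _, _, _, _, _, (generatorRel_rotation P).2 h0, (generatorRel_rotation P).2 h0',
      (generatorRel_lambda1 P).2 h1, (generatorRel_lambda1 P).2 h1',
      (generatorRel_lambda2 P).2 h2, (generatorRel_lambda2 P).2 h2', rfl⟩
  rwa [casimirRel_eq P key] at key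

theorem emb_mem_domain_omegaRCos (h : TestFn P) : emb P h ∈ (omegaRCos P).domain := by
  obtain ⟨g, hg⟩ := exists_mem_omegaMulGraph P cos_eq_trig h
  rw [← graph_omegaMul] at hg
  exact LinearPMap.mem_domain_of_mem_graph hg

end DeSitter
end

/-! ### The main theorem -/

theorem mainTheorem9 (P : DeSitter.Params) :
    (∀ h : DeSitter.TestFn P, DeSitter.emb P h ∈ (DeSitter.omegaRCos P).domain) ∧
    (∀ k : ℤ,
      DeSitter.omegaTilde P k * DeSitter.omegaTilde P (k + 1) =
        ((P.r : ℂ) ^ 2)⁻¹ * (k * (k + 1)) + (P.μ : ℂ) ^ 2 ∧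
      DeSitter.omegaTilde P k * DeSitter.omegaTilde P (k - 1) =
        ((P.r : ℂ) ^ 2)⁻¹ * (k * (k - 1)) + (P.μ : ℂ) ^ 2) ∧
    ∃ U : DeSitter.SO012 →* (DeSitter.Hilb P ≃ₗᵢ[ℂ] DeSitter.Hilb P),
      DeSitter.IsTimeZeroRep P U ∧
      (∀ U' : DeSitter.SO012 →* (DeSitter.Hilb P ≃ₗᵢ[ℂ] DeSitter.Hilb P),
        DeSitter.IsTimeZeroRep P U' → U' = U) ∧
      DeSitter.StronglyContinuous U ∧
      DeSitter.IsExpI (DeSitter.omegaRSin P).closure (fun s => U (DeSitter.Lambda2 (-s))) ∧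
      DeSitter.IsIrreducibleRep U ∧
      (∀ h : DeSitter.TestFn P,
        DeSitter.CasimirRel U (DeSitter.emb P h) ((P.zeta : ℂ) ^ 2 • DeSitter.emb P h)) ∧
      (∀ x y : DeSitter.Hilb P, DeSitter.CasimirRel U x y → y = (P.zeta : ℂ) ^ 2 • x) := by
  refine ⟨DeSitter.emb_mem_domain_omegaRCos P,
    fun k => ⟨DeSitter.omegaTilde_mul_succ P k, DeSitter.omegaTilde_mul_pred P k⟩,
    DeSitter.timeZeroRep P, DeSitter.isTimeZeroRep_timeZeroRep P,
    fun U' hU' => hU'.unique (DeSitter.isTimeZeroRep_timeZeroRep P),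
    DeSitter.stronglyContinuous_timeZeroRep P, DeSitter.isExpI_lambda2 P,
    DeSitter.isIrreducibleRep_timeZeroRep P, DeSitter.casimirRel_emb P,
    fun x y => DeSitter.casimirRel_eq P⟩
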